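/- **Setting.** Let $\Sigma_C=\{\mathsf{pub}\text{ (unary)},\mathsf{sign},\mathsf{blind},\langle\cdot,\cdot\rangle,\{\cdot\}_{\cdot}\text{ (binary)}\}$ be the set of constructors. Let $n\ge 1$ and let $E_1,\dots,E_n$ be theories with finite signatures $\Sigma_{E_1},\dots,\Sigma_{E_n}$, disjoint from each other and from $\Sigma_C$. Each $E_i$ is given by the AC laws of at most one binary symbol $\oplus_i\in\Sigma_{E_i}$ and by a set of rewrite rules over $\Sigma_{E_i}$ that is terminating and confluent modulo AC. Let $E$ be their union, and assume that its rewrite system is also terminating and confluent modulo AC. Messages for a theory are ground terms over names, constructors and the symbols of the theory. Write $\equiv$ for equality modulo AC and $\approx_T$ for equality modulo a theory $T$. A sequent $\Gamma\vdash M$ consists of a finite set $\Gamma$ of messages and a message $M$, all in normal form for rewriting modulo AC. A $\Sigma_{E_i}$-context $C$ is a term built only from holes and symbols of $\Sigma_{E_i}$. **Elementary deduction.** For messages of the theory $E_i$: $\Gamma\Vdash_{E_i}M$ iff $C[M_1,\dots,M_k]\approx_{E_i}M$ for some $\Sigma_{E_i}$-context $C$ and some $M_1,\dots,M_k\in\Gamma$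 ($k\ge0$). **The system $\mathcal{LD}$.** For messages of $E$, let $\Gamma\Vdash_{\mathcal{RD}}M$ be the least relation such that: $\Gamma\Vdash_{\mathcal{RD}}M$ if $M\approx_E C[M_1,\dots,M_k]$ for some $i$, some $\Sigma_{E_i}$-context $C$ and some $M_1,\dots,M_k\in\Gamma$; and $\Gamma\Vdash_{\mathcal{RD}}c(M,N)$ if $\Gamma\Vdash_{\mathcal{RD}}M$ and $\Gamma\Vdash_{\mathcal{RD}}N$, where $c$ is any of the four binary constructors. Then $\Gamma\Vdash_{\mathcal{LD}}M$ is the least relation that holds whenever $\Gamma\Vdash_{\mathcal{RD}}M$, and whenever $\Gamma\cup\Delta\Vdash_{\mathcal{LD}}M$ for some $\Delta$ of one of the following forms: * $\Delta=\{A,B\}$, where $\langle A,B\rangle\in\Gamma$; * $\Delta=\{A,K\}$, where $\{A\}_K\in\Gamma$ or $\mathsf{blind}(A,K)\in\Gamma$, and $\Gamma\Vdash_{\mathcal{RD}}K$; * $\Delta=\{A\}$, where $\mathsf{sign}(A,K),\mathsf{pub}(L)\in\Gamma$ and $K\equiv L$; * $\Delta=\{\mathsf{sign}(A,K),R\}$,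 where $\mathsf{sign}(\mathsf{blind}(A,R),K)\in\Gamma$ and $\Gamma\Vdash_{\mathcal{RD}}R$; * $\Delta=\{A\}$, where $\Gamma\Vdash_{\mathcal{RD}}A$ and $A$ is a guarded subterm (a name, or headed by a constructor) or a cross-theory subterm (headed by a symbol of some $\Sigma_{E_i}$, and an immediate subterm of a subterm headed by a symbol of some $\Sigma_{E_j}$, $j\ne i$) of some term of $\Gamma\cup\{M\}$. **Inputs and complexity.** Let $pst(\Gamma)$ be the set of proper subterms of terms of $\Gamma$, and let $St(\Gamma)=\Gamma\cup pst(\Gamma)\cup\{\mathsf{sign}(A,B): A,B\in pst(\Gamma)\}$. The size of $\Gamma\vdash M$ is $|St(\Gamma\cup\{M\})|$. The sequent is input as the DAG of $St(\Gamma\cup\{M\})$ with maximal sharing (one node per term, nodes listed after their children), with tags that mark the elements of $\Gamma$ and the node $M$. Algorithms are structured while programs on binary trees whose leaves are natural numbers (a Turing-complete model), with unit-cost pairing, projections, constants, and successor and equality test on leaves; names and node addresses are leaves. A problem is decidable in time $O(f)$ if some program answers it correctly on every input and for some constant $c$ takes at most $c\,f(m)$ steps on every input of size $m$. **Theorem.**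 The problem $\Vdash_{\mathcal{LD}}$ is polynomially reducible to $\Vdash_{E_1},\dots,\Vdash_{E_n}$: there is a constant $k$ such that, for every nondecreasing $f:\mathbb N\to\mathbb N$, if each elementary deduction problem $\Vdash_{E_i}$ is decidable in time $O(f(m))$, then $\Vdash_{\mathcal{LD}}$ is decidable in time $O(m^k f(m))$. In particular, if each $\Vdash_{E_i}$ is decidable, then $\Vdash_{\mathcal{LD}}$ is decidable. -/

import Mathlib

namespace Intruder

/-! ### Terms, theories and messages -/

/-- First-order terms over the function symbols `F` with arities `ar` and leaves in `X`. -/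
inductive Term (F : Type) (ar : F → ℕ) (X : Type) : Type
  | leaf (x : X) : Term F ar X
  | app (f : F) (ts : Fin (ar f) → Term F ar X) : Term F ar X

/-- The constructors: public key, signature, blinding, pairing and symmetric encryption. -/
inductive Con : Type
  | pub | sign | blind | pair | enc

def Con.arity : Con → ℕ
  | .pub => 1
  | .sign => 2
  | .blind => 2
  | .pair => 2
  | .enc => 2

/-- A number standing for a constructor in the input of a program. -/
def Con.code : Con → ℕ
  | .pub => 0
  | .sign => 1
  | .blind => 2
  | .pair => 3
  | .enc => 4

/-- A theory presented by rewrite rules modulo AC: a finite signature, the set of its binary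
symbols that are associative and commutative, and a set of rewrite rules over open terms (whose
variables are natural numbers). The theory itself consists of the AC laws and of the rules read
as equations. `code` is a numbering of the symbols, by which programs refer to them. -/
structure Theory where
  Op : Type
  finite : Finite Op
  code : Op → ℕ
  code_injective : Function.Injective code
  arity : Op → ℕ
  ac : Set Op
  ac_binary : ∀ f ∈ ac, arity f = 2
  rules : Set (Term Op arity ℕ × Term Op arity ℕ)

def Theory.msgArity (T : Theory) : Con ⊕ T.Op → ℕ := Sum.elim Con.arity T.arity

/-- Ground messages: built from names (numbered by `ℕ`), constructors and the symbols of the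
theory, which are disjoint from the constructors. -/
abbrev Msg (T : Theory) : Type := Term (Con ⊕ T.Op) T.msgArity ℕ

variable {T : Theory}

def name (a : ℕ) : Msg T := .leaf a
def pub (M : Msg T) : Msg T := .app (.inl .pub) (fun _ : Fin 1 => M)
def sign (M K : Msg T) : Msg T := .app (.inl .sign) (![M, K] : Fin 2 → Msg T)
def blind (M K : Msg T) : Msg T := .app (.inl .blind) (![M, K] : Fin 2 → Msg T)
def pair (M N : Msg T) : Msg T := .app (.inl .pair) (![M, N] : Fin 2 → Msg T)
def enc (M K : Msg T) : Msg T := .app (.inl .enc) (![M, K] : Fin 2 → Msg T)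

/-- The message `f(M, N)` for a binary symbol `f` of the theory. -/
def bin (f : T.Op) (hf : T.arity f = 2) (M N : Msg T) : Msg T :=
  .app (.inr f) (fun j => (![M, N] : Fin 2 → Msg T) (Fin.cast hf j))

/-- Replaces the leaves of a term over the symbols of the theory by messages. This is both the
instantiation of the variables of a rule and the filling of the holes of a context. -/
def Term.fill {X : Type} (σ : X → Msg T) : Term T.Op T.arity X → Msg T
  | .leaf x => σ x
  | .app f ts => .app (.inr f) (fun j => (ts j).fill σ)

/-! ### Rewriting modulo AC and the equational theory -/

/-- Equality modulo associativity and commutativity of the AC symbols. -/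
inductive ACEq : Msg T → Msg T → Prop
  | refl (M) : ACEq M M
  | symm {M N} : ACEq M N → ACEq N M
  | trans {M N P} : ACEq M N → ACEq N P → ACEq M P
  | congr (f) {ts us : Fin (T.msgArity f) → Msg T} :
      (∀ j, ACEq (ts j) (us j)) → ACEq (.app f ts) (.app f us)
  | comm (f) (hf : f ∈ T.ac) (M N) :
      ACEq (bin f (T.ac_binary f hf) M N) (bin f (T.ac_binary f hf) N M)
  | assoc (f) (hf : f ∈ T.ac) (M N P) :
      ACEq (bin f (T.ac_binary f hf) (bin f (T.ac_binary f hf) M N) P)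
        (bin f (T.ac_binary f hf) M (bin f (T.ac_binary f hf) N P))

/-- One application of a rule at some position. -/
inductive RuleStep : Msg T → Msg T → Prop
  | root (q) (hq : q ∈ T.rules) (σ : ℕ → Msg T) : RuleStep (q.1.fill σ) (q.2.fill σ)
  | arg (f) (ts : Fin (T.msgArity f) → Msg T) (j) (u) :
      RuleStep (ts j) u → RuleStep (.app f ts) (.app f (Function.update ts j u))

/-- One rewrite step modulo AC. -/
def Rew (M N : Msg T) : Prop := ∃ M' N', ACEq M M' ∧ RuleStep M' N' ∧ ACEq N' N

def Normal (M : Msg T) : Prop := ∀ N, ¬ Rew M N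

/-- Equality modulo the equational theory. -/
def EqMod : Msg T → Msg T → Prop :=
  Relation.EqvGen (fun M N => ACEq M N ∨ RuleStep M N)

/-- The rewrite system is terminating and confluent modulo AC. -/
structure Theory.ACConvergent (T : Theory) : Prop where
  terminating : WellFounded (fun N M : Msg T => Rew M N)
  confluent : ∀ M₁ M₂ N₁ N₂ : Msg T, ACEq M₁ M₂ →
    Relation.ReflTransGen Rew M₁ N₁ → Relation.ReflTransGen Rew M₂ N₂ →
    ∃ P₁ P₂, Relation.ReflTransGen Rew N₁ P₁ ∧ Relation.ReflTransGen Rew N₂ P₂ ∧ ACEq P₁ P₂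

/-! ### Disjoint combinations -/

/-- A term over the `i`-th signature as a term over the disjoint union of the signatures. -/
def embed {n : ℕ} (T : Fin n → Theory) (i : Fin n) {X : Type} :
    Term (T i).Op (T i).arity X →
      Term (Σ i, (T i).Op) (fun f => (T f.1).arity f.2) X
  | .leaf x => .leaf x
  | .app f ts => .app ⟨i, f⟩ (fun j => embed T i (ts j))

/-- The union of the theories `T 0, …, T (n - 1)`, whose signatures are made disjoint. -/
def combine {n : ℕ} (T : Fin n → Theory) : Theory where
  Op := Σ i, (T i).Op
  finite := by
    have := fun i => (T i).finite
    infer_instance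
  code f := Nat.pair f.1 ((T f.1).code f.2)
  code_injective := by
    rintro ⟨i, f⟩ ⟨j, g⟩ h
    obtain ⟨h₁, h₂⟩ := Nat.pair_eq_pair.mp h
    obtain rfl : i = j := Fin.ext h₁
    exact congrArg _ ((T i).code_injective h₂)
  arity f := (T f.1).arity f.2
  ac := {f | f.2 ∈ (T f.1).ac}
  ac_binary f hf := (T f.1).ac_binary f.2 hf
  rules := {p | ∃ i, ∃ q ∈ (T i).rules, p = (embed T i q.1, embed T i q.2)}

/-! ### Subterms and saturated sets -/

/-- `Subterm N M`: the message `N` is a subterm of `M`. -/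
inductive Subterm : Msg T → Msg T → Prop
  | refl (M) : Subterm M M
  | arg (f) (ts : Fin (T.msgArity f) → Msg T) (j) {N} :
      Subterm N (ts j) → Subterm N (.app f ts)

/-- The proper subterms of the messages in `Γ`. -/
def pst (Γ : Set (Msg T)) : Set (Msg T) := {N | ∃ M ∈ Γ, Subterm N M ∧ N ≠ M}

def sst (Γ : Set (Msg T)) : Set (Msg T) := {P | ∃ M ∈ pst Γ, ∃ N ∈ pst Γ, P = sign M N}

/-- The saturated set of `Γ`. -/
def St (Γ : Set (Msg T)) : Set (Msg T) := Γ ∪ pst Γ ∪ sst Γ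

/-- A ground message is guarded if it is a name or headed by a constructor. -/
def Guarded (M : Msg T) : Prop :=
  (∃ a, M = name a) ∨ ∃ (c : Con) (ts : _), M = .app (.inl c) ts

/-- `N` is a cross-theory subterm of `M`: it is headed by a symbol of one theory and is an
immediate subterm of a subterm of `M` headed by a symbol of another theory. -/
def CrossSubterm {n : ℕ} {T : Fin n → Theory} (N M : Msg (combine T)) : Prop :=
  ∃ (f g : (combine T).Op) (ts : _) (us : Fin ((combine T).msgArity (.inr g)) → Msg (combine T)),
    f.1 ≠ g.1 ∧ N = .app (.inr f) ts ∧ (∃ j, us j = N) ∧ Subterm (.app (.inr g) us) M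

/-! ### Elementary deduction and the system LD -/

/-- Elementary deduction for one theory: `M` equals, modulo the theory, a context over the
signature of the theory (with holes in `Fin k`) filled with messages of `Γ`. -/
def Elem (Γ : Set (Msg T)) (M : Msg T) : Prop :=
  ∃ (k : ℕ) (C : Term T.Op T.arity (Fin k)) (σ : Fin k → Msg T),
    (∀ j, σ j ∈ Γ) ∧ EqMod (C.fill σ) M

/-- Derivability by right rules only. -/
inductive RD {n : ℕ} {T : Fin n → Theory} (Γ : Set (Msg (combine T))) :
    Msg (combine T) → Prop
  | id {M} (i : Fin n) (k : ℕ) (C : Term (T i).Op (T i).arity (Fin k))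
      (σ : Fin k → Msg (combine T)) : (∀ j, σ j ∈ Γ) →
      EqMod M (Term.fill (T := combine T) σ (embed T i C)) → RD Γ M
  | pair {M N} : RD Γ M → RD Γ N → RD Γ (pair M N)
  | enc {M K} : RD Γ M → RD Γ K → RD Γ (enc M K)
  | sign {M K} : RD Γ M → RD Γ K → RD Γ (sign M K)
  | blind {M K} : RD Γ M → RD Γ K → RD Γ (blind M K)

/-- Derivability in the linear system LD. -/
inductive LD {n : ℕ} {T : Fin n → Theory} : Set (Msg (combine T)) → Msg (combine T) → Prop
  | r {Γ M} : RD Γ M → LD Γ M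
  | lp {Γ M N P} : pair M N ∈ Γ → LD (Γ ∪ {M, N}) P → LD Γ P
  | le {Γ M K P} : enc M K ∈ Γ → RD Γ K → LD (Γ ∪ {M, K}) P → LD Γ P
  | sign {Γ M K L P} : sign M K ∈ Γ → pub L ∈ Γ → ACEq K L → LD (Γ ∪ {M}) P → LD Γ P
  | blind₁ {Γ M K P} : blind M K ∈ Γ → RD Γ K → LD (Γ ∪ {M, K}) P → LD Γ P
  | blind₂ {Γ M R K P} : sign (blind M R) K ∈ Γ → RD Γ R →
      LD (Γ ∪ {sign M K, R}) P → LD Γ P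
  | ls {Γ A P} : Guarded A → (∃ M ∈ Γ ∪ {P}, Subterm A M) → RD Γ A →
      LD (Γ ∪ {A}) P → LD Γ P
  | lcs {Γ A P} : (∃ M ∈ Γ ∪ {P}, CrossSubterm A M) → RD Γ A →
      LD (Γ ∪ {A}) P → LD Γ P

/-! ### Programs with a step count: structured while programs on binary trees -/

/-- The data of programs: binary trees with atoms in `ℕ`. -/
inductive Tree : Type
  | atom (a : ℕ) : Tree
  | cons (x y : Tree) : Tree

namespace Tree

def fst : Tree → Tree
  | atom _ => atom 0
  | cons x _ => x

def snd : Tree → Tree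
  | atom _ => atom 0
  | cons _ y => y

def succ : Tree → Tree
  | atom a => atom (a + 1)
  | cons _ _ => atom 0

/-- Compares the two components of a pair if both are atoms. -/
def eqAtoms : Tree → Tree
  | cons (atom a) (atom b) => if a = b then atom 1 else atom 0
  | _ => atom 0

/-- Lists, terminated by `atom 0`. -/
def ofList : List Tree → Tree
  | [] => atom 0
  | x :: xs => cons x (ofList xs)

end Tree

inductive Prog : Type
  | id : Prog
  | const (a : ℕ) : Prog
  | fst : Prog
  | snd : Prog
  | succ : Prog
  | eqAtoms : Prog
  | pair (p q : Prog) : Prog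
  | seq (p q : Prog) : Prog
  | cond (b p q : Prog) : Prog
  | loop (b p : Prog) : Prog

/-- `Runs p x y t`: the program `p` halts on the input `x` with the output `y` after exactly `t`
steps. Tests take `atom 0` as false and every other tree as true. -/
inductive Runs : Prog → Tree → Tree → ℕ → Prop
  | id (x) : Runs .id x x 1
  | const (a x) : Runs (.const a) x (.atom a) 1
  | fst (x) : Runs .fst x x.fst 1
  | snd (x) : Runs .snd x x.snd 1
  | succ (x) : Runs .succ x x.succ 1
  | eqAtoms (x) : Runs .eqAtoms x x.eqAtoms 1
  | pair {p q x y z s t} : Runs p x y s → Runs q x z t →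
      Runs (.pair p q) x (.cons y z) (s + t + 1)
  | seq {p q x y z s t} : Runs p x y s → Runs q y z t → Runs (.seq p q) x z (s + t + 1)
  | cond_true {b p q x v y s t} : Runs b x v s → v ≠ .atom 0 → Runs p x y t →
      Runs (.cond b p q) x y (s + t + 1)
  | cond_false {b p q x y s t} : Runs b x (.atom 0) s → Runs q x y t →
      Runs (.cond b p q) x y (s + t + 1)
  | loop_done {b p x s} : Runs b x (.atom 0) s → Runs (.loop b p) x x (s + 1)
  | loop_step {b p x v y z s t u} : Runs b x v s → v ≠ .atom 0 → Runs p x y t →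
      Runs (.loop b p) y z u → Runs (.loop b p) x z (s + t + u + 1)

/-! ### Sequents as inputs, and decision procedures -/

/-- A representation of `Γ ⊢ M` as a DAG with maximal sharing: every element of the saturated set
of `Γ ∪ {M}` is exactly one node, nodes have distinct addresses, and they are listed in an order
in which every node comes after its children. -/
structure Dag (Γ : Set (Msg T)) (M : Msg T) where
  nodes : List (Msg T)
  nodup : nodes.Nodup
  mem_nodes : ∀ N, N ∈ nodes ↔ N ∈ St (Γ ∪ {M})
  sorted : ∀ l₁ f (ts : Fin (T.msgArity f) → Msg T) l₂,
    nodes = l₁ ++ .app f ts :: l₂ → ∀ j, ts j ∈ l₁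
  addr : Msg T → ℕ
  addr_injOn : Set.InjOn addr {N | N ∈ nodes}

/-- The label of a node (its kind, and the name or symbol), together with the list of the
addresses of its children. -/
def nodeTree (addr : Msg T → ℕ) : Msg T → Tree
  | .leaf a => .cons (.cons (.atom 0) (.atom a)) (.atom 0)
  | .app (.inl c) ts => .cons (.cons (.atom 1) (.atom c.code))
      (Tree.ofList (List.ofFn fun j => .atom (addr (ts j))))
  | .app (.inr f) ts => .cons (.cons (.atom 2) (.atom (T.code f)))
      (Tree.ofList (List.ofFn fun j => .atom (addr (ts j))))

open Classical in
noncomputable def bit (p : Prop) : Tree := if p then .atom 1 else .atom 0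

/-- The input given to programs: the list of the nodes, each with its address, two tags (is it in
`Γ`? is it `M`?), its label and its children. -/
noncomputable def Dag.tree {Γ : Set (Msg T)} {M : Msg T} (G : Dag Γ M) : Tree :=
  Tree.ofList (G.nodes.map fun N =>
    .cons (.atom (G.addr N)) (.cons (.cons (bit (N ∈ Γ)) (bit (N = M))) (nodeTree G.addr N)))

/-- The size of a sequent: the number of elements of its saturated set. -/
noncomputable def size (Γ : Set (Msg T)) (M : Msg T) : ℕ := (St (Γ ∪ {M})).ncard

/-- The program `p` answers correctly, within the time bound `bound` (in the size of the
sequent), whether `D Γ M`, for all sequents with finite `Γ` whose terms are in normal form. -/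
def Prog.DecidesWithin (p : Prog) (D : Set (Msg T) → Msg T → Prop) (bound : ℕ → ℕ) : Prop :=
  ∀ (Γ : Set (Msg T)) (M : Msg T), Γ.Finite → (∀ N ∈ Γ, Normal N) → Normal M →
    ∀ G : Dag Γ M, ∃ t ≤ bound (size Γ M), Runs p G.tree (bit (D Γ M)) t

/-- The deduction problem `D` is decidable in time `O(f)`. -/
def DecidableInTime (D : Set (Msg T) → Msg T → Prop) (f : ℕ → ℕ) : Prop :=
  ∃ (p : Prog) (c : ℕ), p.DecidesWithin D (fun m => c * f m)

/-- The deduction problem `D` is decidable (by a program that always halts). -/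
def DecidableProblem (D : Set (Msg T) → Msg T → Prop) : Prop :=
  ∃ p : Prog, ∀ (Γ : Set (Msg T)) (M : Msg T), Γ.Finite → (∀ N ∈ Γ, Normal N) → Normal M →
    ∀ G : Dag Γ M, ∃ t, Runs p G.tree (bit (D Γ M)) t

end Intruder

namespace Intruder

/-! ### Programs with oracles, relative to an instance -/

/-! Two reductions carry the theorem. The first removes the left rules. Derivability is monotone in
the hypotheses, and a left rule only adds messages of the saturated set of the sequent: they are
subterms, except that unblinding yields a signature `sign A K` of two proper subterms, which is what
the extra part of `St` is for (`LeftStep.mem_st`). Hence `LD` derives the goal iff `RD` derives it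
from the closure of the hypotheses under `LeftStep`, and this closure is reached after at most as
many rounds as `St` has elements (`ld_iff_rd_saturate`). `RD` either splits the goal at a binary
constructor or uses a context over one signature (`rd_iff`), so it is decided by recursion on the
nodes.

The second reduction treats the case of a context, `Direct i`. The abstraction `abs i ν` replaces
names and maximal alien subterms (those headed by a symbol of another theory) by names, AC-equal
ones by the same name. In a context over theory `i` filled with normal messages all maximal aliens
are normal, so rewriting in the union never touches them and uses only rules of theory `i` outside
them (`RuleStep.abs`). The rewriting of the filled context to the normal goal thus projects to an
equality of theory `i`; conversely, putting messages back for names lifts equalities of theory `i`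
(`direct_iff_elem`). The nodes of the abstracted query are abstractions of given nodes, so the query
is not larger than the sequent (`Dag.query_size`).

It remains to carry this out in polynomial time on DAGs, whose messages can be exponentially large
as trees. AC equality is decided node by node from a table of representatives of the earlier nodes;
at an AC symbol, multiplicities of the classes of the flattened arguments are compared, and these
fit into as many binary digits as there are nodes (`aceq_iff`, `cnt_lt`). Equality of abstractions
is decided in the same manner (`Dag.same_iff`). The programs are assembled in a calculus of
computable values, `Cmp`, whose members are programs parametrized by oracles with a constant and an
exponent that do not depend on the oracles. This is why `k` precedes `f`, and why the same program
also gives plain decidability: each instance raises only finitely many queries. -/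

theorem Runs.pos {p : Prog} {x y : Tree} {t : ℕ} (h : Runs p x y t) : 1 ≤ t := by
  cases h <;> omega

/-- The resources of an instance: oracle programs, its size and the cost of one oracle call. -/
structure Machine (n : ℕ) where
  oracle : Fin n → Prog
  size : ℕ
  cost : ℕ
  size_pos : 1 ≤ size
  cost_pos : 1 ≤ cost

/-- A family of instances, with the input tree of each. -/
structure Setup (n : ℕ) where
  Inst : Type
  mach : Inst → Machine n
  root : Inst → Tree

/-- A family of environments: each valid `a` belongs to an instance and carries a tree `vars a`
that stores the values of the variables. -/
structure Env {n : ℕ} (Θ : Setup n) (α : Type) where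
  valid : α → Prop
  inst : α → Θ.Inst
  vars : α → Tree

variable {n : ℕ} {Θ : Setup n} {α β γ : Type}

def Env.mach (E : Env Θ α) (a : α) : Machine n := Θ.mach (E.inst a)

def Env.input (E : Env Θ α) (a : α) : Tree := .cons (Θ.root (E.inst a)) (E.vars a)

/-- One program maps `x a` to `y a` for all valid `a`, in time polynomial in the size of the
instance, times the cost of an oracle call. -/
def CmpFrom (E : Env Θ α) (x y : α → Tree) : Prop :=
  ∃ (P : (Fin n → Prog) → Prog) (c k : ℕ), ∀ a, E.valid a →
    ∃ t ≤ c * (E.mach a).size ^ k * (E.mach a).cost, Runs (P (E.mach a).oracle) (x a) (y a) t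

/-- The values `v a` can be computed in the environment `E`. -/
def Cmp (E : Env Θ α) (v : α → Tree) : Prop := CmpFrom E E.input v

/-- The proposition `p a` can be decided in the environment `E`. -/
def CmpP (E : Env Θ α) (p : α → Prop) : Prop := Cmp E (fun a => bit (p a))

/-- Positivity of `m` and `g` lets the additional step be absorbed and both powers be raised to a
common exponent, for which the sum of the exponents is good enough. -/
theorem bound_add {m g c₁ c₂ k₁ k₂ s t : ℕ} (hm : 1 ≤ m) (hg : 1 ≤ g)
    (hs : s ≤ c₁ * m ^ k₁ * g) (ht : t ≤ c₂ * m ^ k₂ * g) :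
    s + t + 1 ≤ (c₁ + c₂ + 1) * m ^ (k₁ + k₂) * g := by
  have h1 : m ^ k₁ ≤ m ^ (k₁ + k₂) := Nat.pow_le_pow_right hm (by omega)
  have h2 : m ^ k₂ ≤ m ^ (k₁ + k₂) := Nat.pow_le_pow_right hm (by omega)
  have h3 : 1 ≤ m ^ (k₁ + k₂) := Nat.one_le_pow _ _ hm
  calc s + t + 1 ≤ c₁ * m ^ (k₁ + k₂) * g + c₂ * m ^ (k₁ + k₂) * g + m ^ (k₁ + k₂) * g := by
        have : 1 ≤ m ^ (k₁ + k₂) * g := Nat.one_le_iff_ne_zero.mpr (by positivity)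
        have : s ≤ c₁ * m ^ (k₁ + k₂) * g := hs.trans (by gcongr)
        have : t ≤ c₂ * m ^ (k₁ + k₂) * g := ht.trans (by gcongr)
        omega
    _ = _ := by ring

theorem bound_const (M : Machine n) (c : ℕ) : c ≤ c * M.size ^ 0 * M.cost := by
  have := M.cost_pos
  simpa using Nat.le_mul_of_pos_right c this

namespace CmpFrom

variable {E : Env Θ α} {x y z w : α → Tree}

theorem congr (h : CmpFrom E x y) (hx : ∀ a, E.valid a → x a = z a)
    (hy : ∀ a, E.valid a → y a = w a) : CmpFrom E z w := by
  obtain ⟨P, c, k, h⟩ := h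
  refine ⟨P, c, k, fun a ha => ?_⟩
  rw [← hx a ha, ← hy a ha]
  exact h a ha

theorem of_prog (p : Prog) (h : ∀ a, E.valid a → Runs p (x a) (y a) 1) : CmpFrom E x y :=
  ⟨fun _ => p, 1, 0, fun a ha => ⟨1, bound_const _ 1, h a ha⟩⟩

theorem refl : CmpFrom E x x := of_prog .id fun _ _ => .id _

theorem fst (h : CmpFrom E x (fun a => .cons (y a) (z a))) : CmpFrom E x y := by
  obtain ⟨P, c, k, h⟩ := h
  refine ⟨fun O => .seq (P O) .fst, c + 1 + 1, k + 0, fun a ha => ?_⟩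
  obtain ⟨t, ht, hr⟩ := h a ha
  exact ⟨_, bound_add (E.mach a).size_pos (E.mach a).cost_pos ht (bound_const _ 1),
    .seq hr (.fst _)⟩

theorem comp (h₁ : CmpFrom E x y) (h₂ : CmpFrom E y z) : CmpFrom E x z := by
  obtain ⟨P, c, k, h⟩ := h₁
  obtain ⟨P', c', k', h'⟩ := h₂
  refine ⟨fun O => .seq (P O) (P' O), c + c' + 1, k + k', fun a ha => ?_⟩
  obtain ⟨t, ht, hr⟩ := h a ha
  obtain ⟨t', ht', hr'⟩ := h' a ha
  exact ⟨_, bound_add (E.mach a).size_pos (E.mach a).cost_pos ht ht', .seq hr hr'⟩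

theorem snd (h : CmpFrom E x (fun a => .cons (y a) (z a))) : CmpFrom E x z :=
  h.comp (of_prog .snd fun _ _ => .snd _)

theorem cons (h₁ : CmpFrom E x y) (h₂ : CmpFrom E x z) :
    CmpFrom E x (fun a => .cons (y a) (z a)) := by
  obtain ⟨P, c, k, h⟩ := h₁
  obtain ⟨P', c', k', h'⟩ := h₂
  refine ⟨fun O => .pair (P O) (P' O), c + c' + 1, k + k', fun a ha => ?_⟩
  obtain ⟨t, ht, hr⟩ := h a ha
  obtain ⟨t', ht', hr'⟩ := h' a ha
  exact ⟨_, bound_add (E.mach a).size_pos (E.mach a).cost_pos ht ht', .pair hr hr'⟩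

theorem atom (c : ℕ) : CmpFrom E x (fun _ => .atom c) := of_prog (.const c) fun _ _ => .const _ _

theorem oracle (i : Fin n)
    (h : ∀ a, E.valid a → ∃ t ≤ (E.mach a).cost, Runs ((E.mach a).oracle i) (x a) (y a) t) :
    CmpFrom E x y :=
  ⟨fun O => O i, 1, 0, fun a ha => by simpa using h a ha⟩

/-- A program sees only its input tree, so it serves every family that maps to the given one and
keeps the instances. All changes of environment rest on this. -/
theorem reindex {F : Env Θ β} (φ : β → α) (h : CmpFrom E x y)
    (hv : ∀ b, F.valid b → E.valid (φ b)) (hi : ∀ b, F.valid b → F.inst b = E.inst (φ b)) :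
    CmpFrom F (fun b => x (φ b)) (fun b => y (φ b)) := by
  obtain ⟨P, c, k, h⟩ := h
  refine ⟨P, c, k, fun b hb => ?_⟩
  have := h (φ b) (hv b hb)
  rwa [Env.mach, ← hi b hb] at this

end CmpFrom

theorem bit_true {p : Prop} (h : p) : bit p = .atom 1 := if_pos h
theorem bit_false {p : Prop} (h : ¬ p) : bit p = .atom 0 := if_neg h

theorem bit_congr {p q : Prop} (h : p ↔ q) : bit p = bit q := by rw [propext h]

/-- The environment restricted to the `a` with `q a`. -/
def Env.assume (E : Env Θ α) (q : α → Prop) : Env Θ α := { E with valid := fun a => E.valid a ∧ q a }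

/-- The environment extended by a variable with the values `v a x`. -/
def Env.bind (E : Env Θ α) (Q : α → γ → Prop) (v : α → γ → Tree) : Env Θ (α × γ) where
  valid p := E.valid p.1 ∧ Q p.1 p.2
  inst p := E.inst p.1
  vars p := .cons (v p.1 p.2) (E.vars p.1)

namespace Cmp

variable {E : Env Θ α} {x y z : α → Tree} {p q : α → Prop}

theorem congr (h : Cmp E x) (hx : ∀ a, E.valid a → x a = y a) : Cmp E y :=
  CmpFrom.congr h (fun _ _ => rfl) hx

theorem fst (h : Cmp E (fun a => .cons (x a) (y a))) : Cmp E x := CmpFrom.fst h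
theorem snd (h : Cmp E (fun a => .cons (x a) (y a))) : Cmp E y := CmpFrom.snd h
theorem cons (h₁ : Cmp E x) (h₂ : Cmp E y) : Cmp E (fun a => .cons (x a) (y a)) :=
  CmpFrom.cons h₁ h₂
theorem atom (c : ℕ) : Cmp E (fun _ => .atom c) := CmpFrom.atom c
theorem root : Cmp E (fun a => Θ.root (E.inst a)) := CmpFrom.fst .refl
theorem vars : Cmp E (fun a => E.vars a) := CmpFrom.snd .refl
theorem oracle (i : Fin n) (hx : Cmp E x)
    (h : ∀ a, E.valid a → ∃ t ≤ (E.mach a).cost, Runs ((E.mach a).oracle i) (x a) (y a) t) :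
    Cmp E y :=
  CmpFrom.comp hx (.oracle i h)

theorem assume (h : Cmp E x) : Cmp (E.assume q) x :=
  CmpFrom.reindex (F := E.assume q) id h (fun _ h => h.1) (fun _ _ => rfl)

/-- The program first drops the new variable from its input and then runs as before. -/
theorem weaken {Q : α → γ → Prop} {v : α → γ → Tree} (h : Cmp E x) :
    Cmp (E.bind Q v) (fun p => x p.1) := by
  refine CmpFrom.comp (CmpFrom.cons root vars.snd : CmpFrom _ _ _)
    (CmpFrom.reindex (F := E.bind Q v) Prod.fst h (fun _ h => h.1) (fun _ _ => rfl))

theorem top {Q : α → γ → Prop} {v : α → γ → Tree} :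
    Cmp (E.bind Q v) (fun p => v p.1 p.2) := vars.fst

/-- Each branch has to be correct, and to halt in time, only where its side of the test holds. -/
theorem cond (hp : CmpP E p) (hx : Cmp (E.assume p) x) (hy : Cmp (E.assume fun a => ¬ p a) y)
    (hz : ∀ a, E.valid a → (p a → z a = x a) ∧ (¬ p a → z a = y a)) : Cmp E z := by
  obtain ⟨B, c, k, h⟩ := hp
  obtain ⟨P, c₁, k₁, h₁⟩ := hx
  obtain ⟨P', c₂, k₂, h₂⟩ := hy
  refine ⟨fun O => .cond (B O) (P O) (P' O), c + (c₁ + c₂ + 1) + 1, k + (k₁ + k₂), fun a ha => ?_⟩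
  obtain ⟨t, ht, hr⟩ := h a ha
  have hm := (E.mach a).size_pos
  have hg := (E.mach a).cost_pos
  by_cases hpa : p a
  · obtain ⟨t₁, ht₁, hr₁⟩ := h₁ a ⟨ha, hpa⟩
    rw [(hz a ha).1 hpa]
    refine ⟨t + t₁ + 1, ?_, .cond_true hr (by simp [bit_true hpa]) hr₁⟩
    have h3 := bound_add (c₂ := c₂) (k₂ := k₂) hm hg ht₁ (Nat.zero_le _)
    have h4 := bound_add hm hg ht h3
    omega
  · obtain ⟨t₁, ht₁, hr₁⟩ := h₂ a ⟨ha, hpa⟩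
    rw [(hz a ha).2 hpa]
    refine ⟨t + t₁ + 1, ?_, .cond_false (by simpa [bit_false hpa] using hr) hr₁⟩
    have h3 := bound_add (c₁ := c₁) (k₁ := k₁) hm hg (Nat.zero_le _) ht₁
    have h4 := bound_add hm hg ht h3
    omega

end Cmp

namespace CmpP

variable {E : Env Θ α} {p q : α → Prop}

theorem congr (h : CmpP E p) (hp : ∀ a, E.valid a → (p a ↔ q a)) : CmpP E q :=
  Cmp.congr h fun a ha => bit_congr (hp a ha)

theorem assume {r : α → Prop} (h : CmpP E p) : CmpP (E.assume r) p := Cmp.assume h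

theorem weaken {Q : α → γ → Prop} {v : α → γ → Tree} (h : CmpP E p) :
    CmpP (E.bind Q v) (fun x => p x.1) := Cmp.weaken h

theorem true : CmpP E (fun _ => True) :=
  Cmp.congr (.atom 1) fun _ _ => (bit_true trivial).symm

theorem false : CmpP E (fun _ => False) :=
  Cmp.congr (.atom 0) fun _ _ => (bit_false id).symm

theorem not (h : CmpP E p) : CmpP E (fun a => ¬ p a) :=
  Cmp.cond h (.atom 0) (.atom 1) fun _ _ =>
    ⟨fun h => bit_false (by simpa using h), fun h => bit_true h⟩

/-- The short-circuit form matters when the second test makes sense only after the first one, as in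
reading an argument once the head symbol is known. -/
theorem and' (h : CmpP E p) (h' : CmpP (E.assume p) q) : CmpP E (fun a => p a ∧ q a) :=
  Cmp.cond h h' (.atom 0) fun _ _ =>
    ⟨fun h => bit_congr (by simp [h]), fun h => bit_false (by simp [h])⟩

theorem and (h : CmpP E p) (h' : CmpP E q) : CmpP E (fun a => p a ∧ q a) := h.and' h'.assume

theorem or (h : CmpP E p) (h' : CmpP E q) : CmpP E (fun a => p a ∨ q a) :=
  (h.not.and h'.not).not.congr fun _ _ => by tauto

theorem iff (h : CmpP E p) (h' : CmpP E q) : CmpP E (fun a => p a ↔ q a) :=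
  ((h.and h').or (h.not.and h'.not)).congr fun _ _ => by tauto

theorem eqAtoms {x y : α → ℕ} (hx : Cmp E (fun a => .atom (x a)))
    (hy : Cmp E (fun a => .atom (y a))) : CmpP E (fun a => x a = y a) :=
  CmpFrom.comp (CmpFrom.cons hx hy)
    (.of_prog .eqAtoms fun a _ => by
      have := Runs.eqAtoms (.cons (.atom (x a)) (.atom (y a)))
      by_cases h : x a = y a <;> simpa [Tree.eqAtoms, bit, h] using this)

theorem of_bit (h : Cmp E (fun a => bit (p a))) : CmpP E p := h

theorem exists_finite {κ : Type} [Finite κ] {p : κ → α → Prop} (h : ∀ i, CmpP E (p i)) :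
    CmpP E (fun a => ∃ i, p i a) := by
  classical
  have := Fintype.ofFinite κ
  have key : ∀ s : Finset κ, CmpP E (fun a => ∃ i ∈ s, p i a) := by
    intro s
    induction s using Finset.induction_on with
    | empty => exact CmpP.false.congr fun _ _ => by simp
    | insert i s _ ih => exact ((h i).or ih).congr fun _ _ => by simp
  exact (key Finset.univ).congr fun _ _ => by simp

theorem forall_finite {κ : Type} [Finite κ] {p : κ → α → Prop} (h : ∀ i, CmpP E (p i)) :
    CmpP E (fun a => ∀ i, p i a) :=
  (exists_finite fun i => (h i).not).not.congr fun _ _ => by simp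

end CmpP

/-- The index type is fixed for all inputs, so the case distinction is a fixed nest of conditionals.
Cases may overlap as long as their values agree with `w`. -/
theorem Cmp.choose_finite {κ : Type} [Finite κ] {E : Env Θ α} {p : κ → α → Prop}
    {v : κ → α → Tree} {w : α → Tree} (hp : ∀ i, CmpP E (p i))
    (hv : ∀ i, Cmp (E.assume (p i)) (v i)) (hex : ∀ a, E.valid a → ∃ i, p i a)
    (hw : ∀ a, E.valid a → ∀ i, p i a → w a = v i a) : Cmp E w := by
  classical
  have := Fintype.ofFinite κ
  have key : ∀ s : Finset κ, Cmp (E.assume fun a => ∃ i ∈ s, p i a) w := by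
    intro s
    induction s using Finset.induction_on with
    -- No environment is valid here, so any program will do, even with the bound zero.
    | empty => exact ⟨fun _ => .id, 0, 0, fun a ha => by simpa using ha.2⟩
    | insert i s _ ih =>
      refine Cmp.cond (p := p i) (x := w) (y := w) (hp i).assume ?_ ?_
        (fun a ha => ⟨fun _ => rfl, fun _ => rfl⟩)
      · refine Cmp.congr (x := v i) ?_ (fun a ha => (hw a ha.1.1 i ha.2).symm)
        exact CmpFrom.reindex id (hv i) (fun a ha => ⟨ha.1.1, ha.2⟩) (fun _ _ => rfl)
      · refine CmpFrom.reindex id ih (fun a ha => ⟨ha.1.1, ?_⟩) (fun _ _ => rfl)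
        obtain ⟨j, hj, hpj⟩ := ha.1.2
        rcases Finset.mem_insert.mp hj with rfl | hj
        · exact absurd hpj ha.2
        · exact ⟨j, hj, hpj⟩
  refine CmpFrom.reindex id (key Finset.univ) (fun a ha => ⟨ha, ?_⟩) (fun _ _ => rfl)
  simpa using hex a ha

/-! ### Lists -/

open Intruder.Tree (ofList)

/-- The lengths of the lists `l a` are polynomially bounded. -/
def LenBdd (E : Env Θ α) (l : α → List γ) : Prop :=
  ∃ c k, ∀ a, E.valid a → (l a).length ≤ c * (E.mach a).size ^ k

theorem LenBdd.mono {E : Env Θ α} {l : α → List γ} {l' : α → List β} (h : LenBdd E l)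
    (hl : ∀ a, E.valid a → (l' a).length ≤ (l a).length) : LenBdd E l' := by
  obtain ⟨c, k, h⟩ := h
  exact ⟨c, k, fun a ha => (hl a ha).trans (h a ha)⟩

theorem LenBdd.weaken {E : Env Θ α} {l : α → List γ} (h : LenBdd E l) {Q : α → β → Prop}
    {v : α → β → Tree} : LenBdd (E.bind Q v) (fun p => l p.1) := by
  obtain ⟨c, k, h⟩ := h
  exact ⟨c, k, fun a ha => h a.1 ha.1⟩

/-- The environment of the body of a loop over `l a`, with the state `S a l₁` after the
prefix `l₁`. -/
def Env.step (E : Env Θ α) (l : α → List γ) (enc : α → γ → Tree) (S : α → List γ → Tree) :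
    Env Θ (α × List γ × γ × List γ) :=
  E.bind (fun a q => l a = q.1 ++ q.2.1 :: q.2.2) (fun a q => .cons (enc a q.2.1) (S a q.1))

/-- The loop test is the first component, the unread rest of the list: it is a pair until the list
is exhausted and `atom 0` afterwards. A round costs the body, one step for the test and one for the
loop; leaving costs two. -/
theorem Runs.fold_aux {M : Machine n} {body : Prog} {inp : Tree} {γ : Type} {enc : γ → Tree}
    {S : List γ → Tree} {B : ℕ} : ∀ (l₂ l₁ : List γ),
    (∀ pre x suf, l₁ ++ l₂ = pre ++ x :: suf → ∃ t ≤ B, Runs body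
      (.cons (ofList ((x :: suf).map enc)) (.cons (S pre) inp))
      (.cons (ofList (suf.map enc)) (.cons (S (pre ++ [x])) inp)) t) →
    ∃ t ≤ l₂.length * (B + 2) + 2, Runs (.loop .fst body)
      (.cons (ofList (l₂.map enc)) (.cons (S l₁) inp))
      (.cons (.atom 0) (.cons (S (l₁ ++ l₂)) inp)) t
  | [], l₁, _ => ⟨2, by simp, by simpa [ofList] using Runs.loop_done (Runs.fst _)⟩
  | x :: l₂, l₁, h => by
    obtain ⟨u, hu, hr⟩ := Runs.fold_aux (M := M) l₂ (l₁ ++ [x]) (by simpa using h)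
    obtain ⟨t, ht, hb⟩ := h l₁ x l₂ rfl
    refine ⟨1 + t + u + 1, ?_, .loop_step (Runs.fst _) (by simp [ofList, Tree.fst]) hb
      (by simpa using hr)⟩
    simp only [List.length_cons, Nat.add_mul]
    omega

/-- `S` is a loop invariant: it prescribes the state after each prefix. The body receives as data
only the current element and the state, while its correctness may refer to the whole splitting of
the list. Its time bound depends on the instance alone and not on the size of the state, so the
total is polynomial. -/
theorem Cmp.fold {E : Env Θ α} {l : α → List γ} {enc : α → γ → Tree} (S : α → List γ → Tree)
    (hl : Cmp E (fun a => ofList ((l a).map (enc a)))) (hlen : LenBdd E l)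
    (h₀ : Cmp E (fun a => S a []))
    (hs : Cmp (E.step l enc S) (fun q => S q.1 (q.2.1 ++ [q.2.2.1]))) :
    Cmp E (fun a => S a (l a)) := by
  have hbody : CmpFrom (E.step l enc S)
      (fun q => .cons (ofList ((q.2.2.1 :: q.2.2.2).map (enc q.1)))
        (.cons (S q.1 q.2.1) (E.input q.1)))
      (fun q => .cons (ofList (q.2.2.2.map (enc q.1)))
        (.cons (S q.1 (q.2.1 ++ [q.2.2.1])) (E.input q.1))) := by
    have i₀ := CmpFrom.refl (E := E.step l enc S) (x := fun q =>
      .cons (ofList ((q.2.2.1 :: q.2.2.2).map (enc q.1))) (.cons (S q.1 q.2.1) (E.input q.1)))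
    have i₁ := i₀.fst
    simp only [List.map_cons, ofList] at i₁
    refine i₁.snd.cons (.cons (.comp ?_ hs) i₀.snd.snd)
    have i₃ := i₀.snd.snd
    simp only [Env.input] at i₃
    exact i₃.fst.cons ((i₁.fst.cons i₀.snd.fst).cons i₃.snd)
  have hstart : Cmp E (fun a => .cons (ofList ((l a).map (enc a))) (.cons (S a []) (E.input a))) :=
    hl.cons (h₀.cons CmpFrom.refl)
  have hloop : CmpFrom E
      (fun a => .cons (ofList ((l a).map (enc a))) (.cons (S a []) (E.input a)))
      (fun a => .cons (.atom 0) (.cons (S a (l a)) (E.input a))) := by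
    obtain ⟨P, c, k, h⟩ := hbody
    obtain ⟨c', k', hlen⟩ := hlen
    refine ⟨fun O => .loop .fst (P O), c' * (c + 2) + 2, k' + k, fun a ha => ?_⟩
    obtain ⟨t, ht, hr⟩ := Runs.fold_aux (M := E.mach a) (body := P (E.mach a).oracle)
      (inp := E.input a) (enc := enc a) (S := S a)
      (B := c * (E.mach a).size ^ k * (E.mach a).cost) (l a) []
      (fun pre x suf hx => h (a, pre, x, suf) ⟨ha, hx⟩)
    refine ⟨t, ht.trans ?_, by simpa using hr⟩
    have hl := hlen a ha
    have hm := (E.mach a).size_pos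
    have hg := (E.mach a).cost_pos
    set m := (E.mach a).size
    set g := (E.mach a).cost
    have h1 : 1 ≤ m ^ k * g := Nat.one_le_iff_ne_zero.mpr (by positivity)
    have h2 : 1 ≤ m ^ (k' + k) * g := Nat.one_le_iff_ne_zero.mpr (by positivity)
    calc (l a).length * (c * m ^ k * g + 2) + 2
        ≤ (c' * m ^ k') * (c * m ^ k * g + 2 * (m ^ k * g)) + 2 * (m ^ (k' + k) * g) := by
          gcongr <;> omega
      _ = (c' * (c + 2) + 2) * m ^ (k' + k) * g := by ring
  exact CmpFrom.fst (CmpFrom.snd (CmpFrom.comp hstart hloop))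

namespace Cmp

variable {E : Env Θ α} {l : α → List γ} {enc : α → γ → Tree}

theorem step_elem {S : α → List γ → Tree} :
    Cmp (E.step l enc S) (fun q => enc q.1 q.2.2.1) :=
  (Cmp.top : Cmp (E.step l enc S) fun q => .cons (enc q.1 q.2.2.1) (S q.1 q.2.1)).fst

theorem step_state {S : α → List γ → Tree} : Cmp (E.step l enc S) (fun q => S q.1 q.2.1) :=
  (Cmp.top : Cmp (E.step l enc S) fun q => .cons (enc q.1 q.2.2.1) (S q.1 q.2.1)).snd

theorem step_weaken {S : α → List γ → Tree} {x : α → Tree} (h : Cmp E x) :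
    Cmp (E.step l enc S) (fun q => x q.1) := by
  unfold Env.step
  exact weaken h

theorem top_fst {Q : α → γ → Prop} {x y : α → γ → Tree} :
    Cmp (E.bind Q fun a c => .cons (x a c) (y a c)) (fun p => x p.1 p.2) :=
  (top : Cmp (E.bind Q fun a c => .cons (x a c) (y a c)) fun p => .cons (x p.1 p.2) (y p.1 p.2)).fst

theorem top_snd {Q : α → γ → Prop} {x y : α → γ → Tree} :
    Cmp (E.bind Q fun a c => .cons (x a c) (y a c)) (fun p => y p.1 p.2) :=
  (top : Cmp (E.bind Q fun a c => .cons (x a c) (y a c)) fun p => .cons (x p.1 p.2) (y p.1 p.2)).snd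

theorem of_step {S : α → List γ → Tree} {w : α → γ → Tree} {Q : α → γ → Prop}
    (hQ : ∀ a, E.valid a → ∀ x ∈ l a, Q a x)
    (h : Cmp (E.bind Q enc) (fun p => w p.1 p.2)) :
    Cmp (E.step l enc S) (fun q => w q.1 q.2.2.1) := by
  refine CmpFrom.comp (CmpFrom.cons root (step_elem.cons vars.snd) : CmpFrom _ _ _)
    (CmpFrom.reindex (F := E.step l enc S) (fun q => (q.1, q.2.2.1)) h
      (fun q h => ⟨h.1, hQ _ h.1 _ ?_⟩) (fun _ _ => rfl))
  rw [h.2]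
  simp

theorem reverse (hl : Cmp E (fun a => ofList ((l a).map (enc a)))) (hlen : LenBdd E l) :
    Cmp E (fun a => ofList ((l a).reverse.map (enc a))) := by
  refine Cmp.fold (fun a l => ofList (l.reverse.map (enc a))) hl hlen (.atom 0) ?_
  simpa [ofList] using step_elem.cons step_state

/-- Consing during the loop yields the result backwards, whence the final reversal. -/
theorem filterMap {p : α → γ → Prop} {h : α → γ → Tree} [∀ a, DecidablePred (p a)]
    (hl : Cmp E (fun a => ofList ((l a).map (enc a)))) (hlen : LenBdd E l)
    (hp : CmpP (E.bind (fun a x => x ∈ l a) enc) (fun q => p q.1 q.2))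
    (hh : Cmp (E.bind (fun a x => x ∈ l a ∧ p a x) enc) (fun q => h q.1 q.2)) :
    Cmp E (fun a => ofList (((l a).filter (p a)).map (h a))) := by
  have h1 : Cmp E (fun a => ofList ((((l a).filter (p a)).reverse).map (h a))) := by
    refine Cmp.fold (fun a l => ofList ((l.filter (p a)).reverse.map (h a))) hl hlen (.atom 0) ?_
    have hp' : CmpP (E.step l enc fun a l => ofList ((l.filter (p a)).reverse.map (h a)))
        (fun q => p q.1 q.2.2.1) :=
      of_step (w := fun a x => bit (p a x)) (fun _ _ _ hx => hx) hp
    refine Cmp.cond hp' ?_ step_state.assume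
      (x := fun q => .cons (h q.1 q.2.2.1) (ofList ((q.2.1.filter (p q.1)).reverse.map (h q.1))))
      fun q hq => ⟨fun hpq => ?_, fun hpq => ?_⟩
    · refine Cmp.cons ?_ step_state.assume
      refine CmpFrom.comp (CmpFrom.cons root ((step_elem.cons vars.snd).assume) : CmpFrom _ _ _)
        (CmpFrom.reindex (F := (E.step l enc _).assume fun q => p q.1 q.2.2.1)
          (fun q => (q.1, q.2.2.1)) hh (fun q h => ⟨h.1.1, ?_, h.2⟩) (fun _ _ => rfl))
      rw [h.1.2]
      simp
    · simp [List.filter_append, hpq, ofList]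
    · simp [List.filter_append, hpq]
  have h2 := reverse h1 (hlen.mono fun a _ => by simpa using List.length_filter_le _ _)
  simpa using h2

theorem map {h : α → γ → Tree} (hl : Cmp E (fun a => ofList ((l a).map (enc a))))
    (hlen : LenBdd E l)
    (hh : Cmp (E.bind (fun a x => x ∈ l a) enc) (fun q => h q.1 q.2)) :
    Cmp E (fun a => ofList ((l a).map (h a))) := by
  refine (filterMap (p := fun _ _ => True) hl hlen .true (h := h) ?_).congr fun a _ => by simp
  exact CmpFrom.reindex id hh (fun a ha => ⟨ha.1, ha.2.1⟩) (fun _ _ => rfl)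

/-- Search in a list. -/
theorem find {p : α → γ → Prop} {h : α → γ → Tree} {w : α → Tree}
    (hl : Cmp E (fun a => ofList ((l a).map (enc a)))) (hlen : LenBdd E l)
    (hp : CmpP (E.bind (fun a x => x ∈ l a) enc) (fun q => p q.1 q.2))
    (hh : Cmp (E.bind (fun a x => x ∈ l a) enc) (fun q => h q.1 q.2))
    (hw : ∀ a, E.valid a → ∀ x ∈ l a, p a x → h a x = w a)
    (hex : ∀ a, E.valid a → ∃ x ∈ l a, p a x) : Cmp E w := by
  classical
  -- The state is a dummy until the first hit. Later hits overwrite it, harmlessly, since by `hw`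
  -- all hits give the same value.
  have h1 : Cmp E (fun a => if ∃ x ∈ l a, p a x then w a else .atom 0) := by
    refine Cmp.fold (fun a l => if ∃ x ∈ l, p a x then w a else .atom 0) hl hlen
      (by simpa using Cmp.atom 0) ?_
    have hp' : CmpP (E.step l enc fun a l => if ∃ x ∈ l, p a x then w a else .atom 0)
        (fun q => p q.1 q.2.2.1) :=
      of_step (w := fun a x => bit (p a x)) (fun _ _ _ hx => hx) hp
    have hh' : Cmp (E.step l enc fun a l => if ∃ x ∈ l, p a x then w a else .atom 0)
        (fun q => h q.1 q.2.2.1) :=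
      of_step (w := h) (fun _ _ _ hx => hx) hh
    refine Cmp.cond hp' hh'.assume step_state.assume fun q hq => ⟨fun hpq => ?_, fun hpq => ?_⟩
    · rw [if_pos ⟨_, by simp, hpq⟩, hw _ hq.1 _ _ hpq]
      rw [hq.2]; simp
    · have : (∃ x ∈ q.2.1 ++ [q.2.2.1], p q.1 x) ↔ ∃ x ∈ q.2.1, p q.1 x := by
        simp only [List.mem_append, List.mem_singleton]
        constructor
        · rintro ⟨x, hx | rfl, h⟩
          · exact ⟨x, hx, h⟩
          · exact absurd h hpq
        · rintro ⟨x, hx, h⟩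
          exact ⟨x, .inl hx, h⟩
      simp only [this]
  exact h1.congr fun a ha => if_pos (hex a ha)

/-- Iteration of a function on encoded states, once for each element of a list. -/
theorem iterate {F : α → β → β} {s : α → β} {encS : α → β → Tree}
    (hl : Cmp E (fun a => ofList ((l a).map (enc a)))) (hlen : LenBdd E l)
    (h₀ : Cmp E (fun a => encS a (s a)))
    (hF : Cmp (E.bind (fun _ _ => True) encS) (fun q => encS q.1 (F q.1 q.2))) :
    Cmp E (fun a => encS a ((F a)^[(l a).length] (s a))) := by
  refine Cmp.fold (fun a l => encS a ((F a)^[l.length] (s a))) hl hlen h₀ ?_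
  simp only [List.length_append, List.length_singleton, Function.iterate_succ_apply']
  exact CmpFrom.comp (CmpFrom.cons root (step_state.cons vars.snd) : CmpFrom _ _ _)
    (CmpFrom.reindex (F := E.step l enc _) (fun q => (q.1, (F q.1)^[q.2.1.length] (s q.1))) hF
      (fun q h => ⟨h.1, trivial⟩) (fun _ _ => rfl))

/-- Pairs the entries of two lists of the same length. -/
theorem zip {f h : α → γ → Tree} (hf : Cmp E (fun a => ofList ((l a).map (f a))))
    (hh : Cmp E (fun a => ofList ((l a).map (h a)))) (hlen : LenBdd E l) :
    Cmp E (fun a => ofList ((l a).map fun x => .cons (f a x) (h a x))) := by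
  classical
  -- The loop runs over the first list; the state holds the unread part of the second one and the
  -- pairs made so far.
  have h1 : Cmp E (fun a => .cons (ofList (((l a).drop (l a).length).map (h a)))
      (ofList ((l a).reverse.map fun x => .cons (f a x) (h a x)))) := by
    refine Cmp.fold (fun a l₁ => .cons (ofList (((l a).drop l₁.length).map (h a)))
      (ofList (l₁.reverse.map fun x => .cons (f a x) (h a x)))) hf hlen
      (by simpa [ofList] using hh.cons (.atom 0)) ?_
    have hst := step_state (E := E) (l := l) (enc := f)
      (S := fun a l₁ => .cons (ofList (((l a).drop l₁.length).map (h a)))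
        (ofList (l₁.reverse.map fun x => .cons (f a x) (h a x))))
    have hrest : Cmp (E.step l f fun a l₁ => .cons (ofList (((l a).drop l₁.length).map (h a)))
        (ofList (l₁.reverse.map fun x => .cons (f a x) (h a x))))
        (fun q => .cons (h q.1 q.2.2.1) (ofList (q.2.2.2.map (h q.1)))) :=
      hst.fst.congr fun q hq => by rw [hq.2]; simp [ofList]
    refine (hrest.snd.cons ((step_elem.cons hrest.fst).cons hst.snd)).congr fun q hq => ?_
    rw [hq.2]
    simp [ofList, List.drop_append, List.drop_eq_nil_of_le]
  have h2 := reverse h1.snd (hlen.mono fun a _ => by simp)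
  simpa using h2

end Cmp

theorem CmpP.exists_mem {E : Env Θ α} {l : α → List γ} {enc : α → γ → Tree} {p : α → γ → Prop}
    (hl : Cmp E (fun a => ofList ((l a).map (enc a)))) (hlen : LenBdd E l)
    (hp : CmpP (E.bind (fun a x => x ∈ l a) enc) (fun q => p q.1 q.2)) :
    CmpP E (fun a => ∃ x ∈ l a, p a x) := by
  refine Cmp.fold (fun a l => bit (∃ x ∈ l, p a x)) hl hlen
    ((Cmp.atom 0).congr fun _ _ => (bit_false (by simp)).symm) ?_
  have hp' : CmpP (E.step l enc fun a l => bit (∃ x ∈ l, p a x)) (fun q => p q.1 q.2.2.1) :=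
    Cmp.of_step (w := fun a x => bit (p a x)) (fun _ _ _ hx => hx) hp
  have hs : CmpP (E.step l enc fun a l => bit (∃ x ∈ l, p a x))
    (fun q => ∃ x ∈ q.2.1, p q.1 x) := Cmp.step_state
  refine (hs.or hp').congr fun q _ => ?_
  simp only [List.mem_append, List.mem_singleton]
  constructor
  · rintro (⟨x, hx, h⟩ | h)
    · exact ⟨x, .inl hx, h⟩
    · exact ⟨_, .inr rfl, h⟩
  · rintro ⟨x, hx | rfl, h⟩
    · exact .inl ⟨x, hx, h⟩
    · exact .inr h

theorem CmpP.forall_mem {E : Env Θ α} {l : α → List γ} {enc : α → γ → Tree} {p : α → γ → Prop}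
    (hl : Cmp E (fun a => ofList ((l a).map (enc a)))) (hlen : LenBdd E l)
    (hp : CmpP (E.bind (fun a x => x ∈ l a) enc) (fun q => p q.1 q.2)) :
    CmpP E (fun a => ∀ x ∈ l a, p a x) :=
  (CmpP.exists_mem (p := fun a x => ¬ p a x) hl hlen hp.not).not.congr fun _ _ => by simp

end Intruder
namespace Intruder

/-! ### Equality modulo AC -/

section AC

variable {T : Theory}

def acSetoid (T : Theory) : Setoid (Msg T) := ⟨ACEq, .refl, .symm, .trans⟩

abbrev Cls (T : Theory) : Type := Quotient (acSetoid T)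

def cls (M : Msg T) : Cls T := Quotient.mk (acSetoid T) M

theorem cls_eq {M N : Msg T} : cls M = cls N ↔ ACEq M N := Quotient.eq (r := acSetoid T)

theorem forall_bin {α : Type} {k : ℕ} (hk : k = 2) (M N : α) (p : α → Prop) :
    (∀ j, p ((![M, N] : Fin 2 → α) (Fin.cast hk j))) ↔ p M ∧ p N := by
  subst hk
  simp [Fin.forall_fin_two]

theorem map_vec₂ {α β : Type} {k : ℕ} (hk : k = 2) (g : α → β) (M N : α) :
    (fun j => g ((![M, N] : Fin 2 → α) (Fin.cast hk j))) =
      fun j => (![g M, g N] : Fin 2 → β) (Fin.cast hk j) := by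
  subst hk
  funext j
  fin_cases j <;> rfl

theorem app_eq_bin {f : T.Op} (hf : T.arity f = 2) (ts : Fin (T.msgArity (.inr f)) → Msg T) :
    ∃ M N, (.app (.inr f) ts : Msg T) = bin f hf M N ∧
      ts (Fin.cast hf.symm (0 : Fin 2)) = M ∧ ts (Fin.cast hf.symm (1 : Fin 2)) = N := by
  refine ⟨_, _, ?_, rfl, rfl⟩
  unfold bin
  congr 1
  funext j
  obtain ⟨i, rfl⟩ : ∃ i : Fin 2, j = Fin.cast hf.symm i := ⟨Fin.cast hf j, rfl⟩
  fin_cases i <;> rfl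

open Classical in
/-- The head of a message, with the classes of the arguments if it is not an AC symbol. -/
noncomputable def shape :
    Msg T → ℕ ⊕ (Σ f : Con ⊕ T.Op, Option (Fin (T.msgArity f) → Cls T))
  | .leaf a => .inl a
  | .app f ts => .inr ⟨f, if f ∈ Sum.inr '' T.ac then none else some fun j => cls (ts j)⟩

/-- The AC laws relate only terms headed by the same AC symbol, where `shape` forgets the arguments.
This invariant yields all the inversion facts about `ACEq` away from AC symbols. -/
theorem ACEq.shape_eq {M N : Msg T} (h : ACEq M N) : shape M = shape N := by
  induction h with
  | refl => rfl
  | symm _ ih => exact ih.symm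
  | trans _ _ ih₁ ih₂ => exact ih₁.trans ih₂
  | congr f h =>
    simp only [shape]
    congr 3
    congr 1
    funext j
    exact cls_eq.2 (h j)
  | comm f hf => simp [shape, bin, hf]
  | assoc f hf => simp [shape, bin, hf]

theorem aceq_leaf {a : ℕ} {N : Msg T} : ACEq (.leaf a) N ↔ N = .leaf a := by
  refine ⟨fun h => ?_, fun h => h ▸ .refl _⟩
  have := h.shape_eq
  cases N with
  | leaf b => simp only [shape, Sum.inl.injEq] at this; rw [this]
  | app f ts => simp [shape] at this

theorem aceq_app_leaf {f} {ts : Fin (T.msgArity f) → Msg T} {a : ℕ} :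
    ¬ ACEq (.app f ts) (.leaf a) := fun h => by simpa [shape] using h.shape_eq

theorem aceq_app_head {f g} {ts : Fin (T.msgArity f) → Msg T} {us : Fin (T.msgArity g) → Msg T}
    (h : ACEq (.app f ts) (.app g us)) : f = g := by
  have := h.shape_eq
  simp only [shape, Sum.inr.injEq, Sigma.mk.injEq] at this
  exact this.1

theorem aceq_app {f} (hf : f ∉ Sum.inr '' T.ac) {ts us : Fin (T.msgArity f) → Msg T} :
    ACEq (.app f ts) (.app f us) ↔ ∀ j, ACEq (ts j) (us j) := by
  refine ⟨fun h j => ?_, .congr f⟩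
  have := h.shape_eq
  simp only [shape, Sum.inr.injEq, Sigma.mk.injEq, hf, if_false, heq_eq_eq, true_and,
    Option.some.injEq] at this
  exact cls_eq.1 (congrFun this j)

theorem ACEq.fill_congr {X : Type} {σ τ : X → Msg T} (h : ∀ x, ACEq (σ x) (τ x)) :
    ∀ t : Term T.Op T.arity X, ACEq (t.fill σ) (t.fill τ)
  | .leaf x => h x
  | .app f ts => .congr (.inr f) fun j => ACEq.fill_congr h (ts j)

open Classical in
/-- The multiset of the classes of the arguments of a nested application of `f`. -/
noncomputable def flat (f : T.Op) : Msg T → Multiset (Cls T)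
  | .leaf a => {cls (.leaf a)}
  | .app g ts => if g = .inr f then ∑ j, flat f (ts j) else {cls (.app g ts)}

open Classical in
/-- The number of arguments with the property `p` of a nested application of `f`. -/
noncomputable def cnt (p : Msg T → Prop) (f : T.Op) : Msg T → ℕ
  | .leaf a => if p (.leaf a) then 1 else 0
  | .app g ts => if g = .inr f then ∑ j, cnt p f (ts j) else if p (.app g ts) then 1 else 0

theorem flat_bin (f : T.Op) (hf : T.arity f = 2) (M N : Msg T) :
    flat f (bin f hf M N) = flat f M + flat f N := by
  rw [bin, flat, if_pos rfl]
  exact (Fintype.sum_equiv (finCongr hf) _ (fun j => flat f ((![M, N] : Fin 2 → Msg T) j))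
    fun j => rfl).trans (by simp [Fin.sum_univ_two])

theorem cnt_bin (p : Msg T → Prop) (f : T.Op) (hf : T.arity f = 2) (M N : Msg T) :
    cnt p f (bin f hf M N) = cnt p f M + cnt p f N := by
  rw [bin, cnt, if_pos rfl]
  exact (Fintype.sum_equiv (finCongr hf) _ (fun j => cnt p f ((![M, N] : Fin 2 → Msg T) j))
    fun j => rfl).trans (by simp [Fin.sum_univ_two])

theorem flat_bin_ne {f g : T.Op} (h : g ≠ f) (hg : T.arity g = 2) (M N : Msg T) :
    flat f (bin g hg M N) = {cls (bin g hg M N)} := by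
  rw [bin, flat, if_neg (by simpa using h)]

theorem ACEq.flat_eq {M N : Msg T} (f : T.Op) (h : ACEq M N) : flat f M = flat f N := by
  induction h with
  | refl => rfl
  | symm _ ih => exact ih.symm
  | trans _ _ ih₁ ih₂ => exact ih₁.trans ih₂
  | congr g h ih =>
    simp only [flat]
    split_ifs
    · exact Finset.sum_congr rfl fun j _ => ih j
    · rw [cls_eq.2 (.congr g h)]
  | comm g hg M N =>
    by_cases h : g = f
    · subst h; simp only [flat_bin]; exact add_comm _ _
    · rw [flat_bin_ne h, flat_bin_ne h, cls_eq.2 (.comm g hg M N)]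
  | assoc g hg M N P =>
    by_cases h : g = f
    · subst h; simp only [flat_bin]; exact add_assoc _ _ _
    · rw [flat_bin_ne h, flat_bin_ne h, cls_eq.2 (.assoc g hg M N P)]

/-- The commutative semigroup of the messages modulo AC, for an AC symbol. -/
@[reducible] def clsSemigroup (f : T.Op) (hf : f ∈ T.ac) : AddCommSemigroup (Cls T) where
  add := Quotient.map₂ (bin f (T.ac_binary f hf)) fun _ _ h _ _ h' =>
    .congr (.inr f) fun j => by
      generalize Fin.cast (T.ac_binary f hf) j = i
      fin_cases i
      exacts [h, h']
  add_assoc := by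
    rintro ⟨a⟩ ⟨b⟩ ⟨c⟩
    exact Quotient.sound (.assoc f hf a b c)
  add_comm := by
    rintro ⟨a⟩ ⟨b⟩
    exact Quotient.sound (.comm f hf a b)

/-- In the commutative semigroup of classes, the class of a message is the sum of its flattened
arguments, hence a function of their multiset. A zero is adjoined because sums of multisets need
one. -/
theorem aceq_of_flat_eq {f : T.Op} (hf : f ∈ T.ac) {M N : Msg T} (h : flat f M = flat f N) :
    ACEq M N := by
  let := clsSemigroup f hf
  have key : ∀ M : Msg T, ((flat f M).map ((↑) : Cls T → WithZero (Cls T))).sum = (cls M : Cls T) := by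
    intro M
    induction M with
    | leaf a => simp [flat]
    | app g ts ih =>
      by_cases hg : g = .inr f
      · subst hg
        obtain ⟨M, N, h, rfl, rfl⟩ := app_eq_bin (T.ac_binary f hf) ts
        rw [h, flat_bin, Multiset.map_add, Multiset.sum_add, ih, ih]
        rfl
      · simp [flat, hg]
  have := key M
  rw [h, key N] at this
  exact cls_eq.1 (WithZero.coe_inj.1 this.symm)

open Classical in
theorem count_flat (f : T.Op) (c : Cls T) (M : Msg T) :
    (flat f M).count c = cnt (fun K => cls K = c) f M := by
  induction M with
  | leaf a => simp [flat, cnt, Multiset.count_singleton, eq_comm]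
  | app g ts ih =>
    by_cases hg : g = .inr f
    · simp [flat, cnt, hg, Multiset.count_sum', ih]
    · simp [flat, cnt, hg, Multiset.count_singleton, eq_comm]

theorem Subterm.trans {M N P : Msg T} (h₁ : Subterm M N) (h₂ : Subterm N P) : Subterm M P := by
  induction h₂ with
  | refl => exact h₁
  | arg f ts j _ ih => exact .arg f ts j (ih h₁)

open Classical in
theorem cnt_congr {p q : Msg T → Prop} (f : T.Op) {M : Msg T}
    (h : ∀ K, Subterm K M → (p K ↔ q K)) : cnt p f M = cnt q f M := by
  induction M with
  | leaf a => exact if_congr (h _ (.refl _)) rfl rfl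
  | app g ts ih =>
    have := fun j => ih j fun K hK => h K (.arg _ _ j hK)
    simp only [cnt, this]
    exact if_congr .rfl rfl (if_congr (h _ (.refl _)) rfl rfl)

/-- Every class that is counted is the class of a subterm. -/
theorem exists_subterm_of_mem_flat {f : T.Op} {c : Cls T} {M : Msg T} (h : c ∈ flat f M) :
    ∃ K, Subterm K M ∧ cls K = c ∧ ∀ ts, M = .app (.inr f) ts → ∃ j, Subterm K (ts j) := by
  induction M with
  | leaf a => exact ⟨_, .refl _, by simpa [flat, eq_comm] using h, by simp⟩
  | app g ts ih =>
    by_cases hg : g = .inr f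
    · subst hg
      simp only [flat, if_true, Multiset.mem_sum, Finset.mem_univ, true_and] at h
      obtain ⟨j, hj⟩ := h
      obtain ⟨K, hK, hc, -⟩ := ih j hj
      refine ⟨K, .arg _ _ j hK, hc, fun us hus => ⟨j, ?_⟩⟩
      cases hus
      exact hK
    · exact ⟨_, .refl _, by simpa [flat, hg, eq_comm] using h, fun us hus => by
        cases hus; exact absurd rfl hg⟩

end AC

/-! ### Rewriting -/

section Rewriting

variable {T : Theory}

theorem EqMod.refl (M : Msg T) : EqMod M M := Relation.EqvGen.refl M
theorem EqMod.symm {M N : Msg T} (h : EqMod M N) : EqMod N M := Relation.EqvGen.symm _ _ h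
theorem EqMod.trans {M N P : Msg T} (h : EqMod M N) (h' : EqMod N P) : EqMod M P :=
  Relation.EqvGen.trans _ _ _ h h'
theorem ACEq.eqMod {M N : Msg T} (h : ACEq M N) : EqMod M N := .rel _ _ (.inl h)
theorem RuleStep.eqMod {M N : Msg T} (h : RuleStep M N) : EqMod M N := .rel _ _ (.inr h)

theorem ACEq.update {f} {ts : Fin (T.msgArity f) → Msg T} {j} {u v : Msg T} (h : ACEq u v) :
    ACEq (.app f (Function.update ts j u)) (.app f (Function.update ts j v)) :=
  .congr f fun k => by
    by_cases hk : k = j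
    · subst hk; simpa using h
    · simpa [hk] using ACEq.refl _

theorem RuleStep.update {f} {ts : Fin (T.msgArity f) → Msg T} {j} {u v : Msg T}
    (h : RuleStep u v) :
    RuleStep (.app f (Function.update ts j u)) (.app f (Function.update ts j v)) := by
  simpa using RuleStep.arg f (Function.update ts j u) j v (by simpa using h)

theorem EqMod.arg {f} {ts : Fin (T.msgArity f) → Msg T} {j} {u : Msg T} (h : EqMod (ts j) u) :
    EqMod (.app f ts) (.app f (Function.update ts j u)) := by
  have key : ∀ v w : Msg T, EqMod v w →
      EqMod (.app f (Function.update ts j v)) (.app f (Function.update ts j w)) := by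
    intro v w h
    induction h with
    | rel v w h => exact h.elim (fun h => h.update.eqMod) fun h => h.update.eqMod
    | refl => exact .refl _
    | symm _ _ _ ih => exact ih.symm
    | trans _ _ _ _ _ ih₁ ih₂ => exact ih₁.trans ih₂
  simpa using key _ _ h

theorem RuleStep.arg_eq {f} {ts us : Fin (T.msgArity f) → Msg T} {j} {u : Msg T}
    (h : RuleStep (ts j) u) (hu : us = Function.update ts j u) :
    RuleStep (.app f ts) (.app f us) := hu ▸ .arg f ts j u h

theorem EqMod.arg_eq {f} {ts us : Fin (T.msgArity f) → Msg T} {j} {u : Msg T}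
    (h : EqMod (ts j) u) (hu : us = Function.update ts j u) :
    EqMod (.app f ts) (.app f us) := hu ▸ h.arg

theorem Rew.ac_left {M N P : Msg T} (h : ACEq M N) (h' : Rew N P) : Rew M P := by
  obtain ⟨N', P', h₁, h₂, h₃⟩ := h'
  exact ⟨N', P', h.trans h₁, h₂, h₃⟩

theorem RuleStep.rew {M N : Msg T} (h : RuleStep M N) : Rew M N :=
  ⟨M, N, .refl _, h, .refl _⟩

theorem Normal.congr {M N : Msg T} (h : ACEq M N) : Normal M ↔ Normal N :=
  ⟨fun hM P hP => hM P (hP.ac_left h), fun hN P hP => hN P (hP.ac_left h.symm)⟩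

theorem Normal.arg {f} {ts : Fin (T.msgArity f) → Msg T} (h : Normal (.app f ts)) (j) :
    Normal (ts j) := by
  rintro u ⟨v, w, h₁, h₂, h₃⟩
  refine h (.app f (Function.update ts j u)) ⟨_, _, ?_, h₂.update, h₃.update⟩
  simpa using h₁.update (ts := ts) (j := j)

theorem Normal.subterm {M N : Msg T} (h : Subterm N M) (hM : Normal M) : Normal N := by
  induction h with
  | refl => exact hM
  | arg f ts j _ ih => exact ih (hM.arg j)

theorem rewrites_of_ac {M N P : Msg T} (h : ACEq M N) (h' : Relation.ReflTransGen Rew N P) :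
    ∃ Q, Relation.ReflTransGen Rew M Q ∧ ACEq Q P := by
  cases h'.cases_head with
  | inl h' => subst h'; exact ⟨M, .refl, h⟩
  | inr h' =>
    obtain ⟨R, hR, hP⟩ := h'
    exact ⟨P, .head (hR.ac_left h) hP, .refl _⟩

/-- Induction on the equivalence closure. For transitivity, the two reductions of the middle message
are joined by confluence, and the joins are transported along AC equality. -/
theorem Theory.ACConvergent.church_rosser (hT : T.ACConvergent) {M N : Msg T} (h : EqMod M N) :
    ∃ P Q, Relation.ReflTransGen Rew M P ∧ Relation.ReflTransGen Rew N Q ∧ ACEq P Q := by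
  induction h with
  | rel M N h =>
    rcases h with h | h
    · exact ⟨M, N, .refl, .refl, h⟩
    · exact ⟨N, N, .single h.rew, .refl, .refl _⟩
  | refl M => exact ⟨M, M, .refl, .refl, .refl _⟩
  | symm M N _ ih =>
    obtain ⟨P, Q, h₁, h₂, h₃⟩ := ih
    exact ⟨Q, P, h₂, h₁, h₃.symm⟩
  | trans M N P _ _ ih₁ ih₂ =>
    obtain ⟨A, B, h₁, h₂, h₃⟩ := ih₁
    obtain ⟨C, D, h₄, h₅, h₆⟩ := ih₂
    obtain ⟨R, S, hR, hS, hRS⟩ := hT.confluent N N B C (.refl _) h₂ h₄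
    obtain ⟨R', hR', hR''⟩ := rewrites_of_ac h₃ hR
    obtain ⟨S', hS', hS''⟩ := rewrites_of_ac h₆.symm hS
    exact ⟨R', S', h₁.trans hR', h₅.trans hS', hR''.trans (hRS.trans hS''.symm)⟩

theorem Theory.ACConvergent.rewrites_to_normal (hT : T.ACConvergent) {M N : Msg T}
    (hM : Normal M) (h : EqMod M N) : ∃ P, Relation.ReflTransGen Rew N P ∧ ACEq P M := by
  obtain ⟨P, Q, h₁, h₂, h₃⟩ := hT.church_rosser h
  rcases h₁.cases_head with rfl | ⟨R, hR, -⟩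
  · exact ⟨Q, h₂, h₃.symm⟩
  · exact absurd hR (hM R)

theorem RuleStep.of_subterm {t u v : Msg T} (h : Subterm t u) (hv : RuleStep t v) :
    ∃ w, RuleStep u w ∧ Subterm v w := by
  induction h with
  | refl => exact ⟨v, hv, .refl _⟩
  | arg f ts j _ ih =>
    obtain ⟨w, hw, hvw⟩ := ih hv
    exact ⟨_, .arg f ts j w hw, .arg f _ j (by simpa using hvw)⟩

/-- Otherwise every message that contains `t` rewrites to another message that contains `t`, and
rewriting never stops. -/
theorem Theory.ACConvergent.not_subterm (hT : T.ACConvergent) {t u : Msg T} (h : RuleStep t u) :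
    ¬ Subterm t u := by
  intro htu
  have key : ∀ w, ¬ Subterm t w := by
    intro w
    induction w using hT.terminating.induction with
    | _ w ih =>
      intro hw
      obtain ⟨w', h₁, h₂⟩ := h.of_subterm hw
      exact ih w' h₁.rew (htu.trans h₂)
  exact key t (.refl _)

/-- The variable `x` occurs in the term. -/
def Term.Occ {F : Type} {ar : F → ℕ} {X : Type} (x : X) : Term F ar X → Prop
  | .leaf y => y = x
  | .app _ ts => ∃ j, (ts j).Occ x

theorem Term.fill_congr {X : Type} {σ τ : X → Msg T} :
    ∀ t : Term T.Op T.arity X, (∀ x, t.Occ x → σ x = τ x) → t.fill σ = t.fill τ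
  | .leaf x, h => h x rfl
  | .app f ts, h => by
    simp only [fill]
    congr 1
    funext j
    exact Term.fill_congr (ts j) fun x hx => h x ⟨j, hx⟩

theorem Term.Occ.subterm_fill {X : Type} {σ : X → Msg T} {x : X} :
    ∀ {t : Term T.Op T.arity X}, t.Occ x → Subterm (σ x) (t.fill σ)
  | .leaf y, h => by cases h; exact .refl _
  | .app f ts, ⟨j, h⟩ => .arg (.inr f) _ j h.subterm_fill

/-- This is not required of rules but follows from termination: a variable that is new on the right
can be instantiated by the left side itself, which then reappears as a subterm after the step. -/
theorem Theory.ACConvergent.occ_left (hT : T.ACConvergent) {q} (hq : q ∈ T.rules) {x : ℕ}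
    (h : q.2.Occ x) : q.1.Occ x := by
  by_contra hx
  let σ : ℕ → Msg T := Function.update (fun _ => .leaf 0) x (q.1.fill fun _ => .leaf 0)
  have h₁ : q.1.fill σ = q.1.fill fun _ => .leaf 0 := by
    refine Term.fill_congr _ fun y hy => ?_
    have : y ≠ x := by rintro rfl; exact hx hy
    simp [σ, this]
  refine hT.not_subterm (.root q hq σ) ?_
  have := h.subterm_fill (σ := σ)
  rw [h₁]
  simpa [σ] using this

/-- A rule with a variable on the left would apply to every message, against termination. -/
theorem Theory.ACConvergent.left_ne_leaf (hT : T.ACConvergent) {q} (hq : q ∈ T.rules) (x : ℕ) :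
    q.1 ≠ .leaf x := by
  intro h
  have key : ∀ _ : Msg T, False := by
    intro w
    induction w using hT.terminating.induction with
    | _ w ih =>
      have := RuleStep.root q hq fun _ => w
      rw [h] at this
      exact ih _ this.rew
  exact key (.leaf 0)

/-- No left side is headed by a constructor, and AC equality preserves the head. This makes the
additional signatures in the saturated set normal. -/
theorem Theory.ACConvergent.normal_con (hT : T.ACConvergent) {c : Con}
    {ts : Fin (T.msgArity (.inl c)) → Msg T} (h : ∀ j, Normal (ts j)) :
    Normal (.app (.inl c) ts) := by
  rintro N ⟨M', N', h₁, h₂, -⟩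
  cases h₂ with
  | root q hq σ =>
    cases hq' : q.1 with
    | leaf x => exact hT.left_ne_leaf hq x hq'
    | app f us =>
      rw [hq'] at h₁
      simpa using aceq_app_head h₁
  | arg f us j u hu =>
    obtain rfl := aceq_app_head h₁
    exact h j u (hu.rew.ac_left ((aceq_app (by simp)).1 h₁ j))

end Rewriting

/-! ### Abstraction of alien subterms -/

section Abstraction

variable {n : ℕ} {T : Fin n → Theory}

def conApp {T : Theory} (c : Con) (ts : Fin c.arity → Msg T) : Msg T := .app (.inl c) ts

def opApp {T : Theory} (f : T.Op) (ts : Fin (T.arity f) → Msg T) : Msg T := .app (.inr f) ts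

/-- A symbol of the theory `i` as a symbol of the combined theory. -/
def own (i : Fin n) (f : (T i).Op) : (combine T).Op := ⟨i, f⟩

def ownApp (i : Fin n) (f : (T i).Op) (ts : Fin ((T i).arity f) → Msg (combine T)) :
    Msg (combine T) := opApp (T := combine T) (own i f) ts

/-- An application of a symbol of the theory `i` is kept, any other one is replaced by a name. -/
def absOp (i : Fin n) (f : Σ i, (T i).Op) (us : Fin ((T f.1).arity f.2) → Msg (T i)) (a : ℕ) :
    Msg (T i) :=
  match f, us with
  | ⟨j, g⟩, us => if h : j = i then by subst h; exact opApp g us else .leaf a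

/-- The message as a message of the theory `i`: the names, and the subterms that are headed by a
symbol of another theory, are replaced by names. -/
def abs (i : Fin n) (ν : Msg (combine T) → ℕ) : Msg (combine T) → Msg (T i)
  | .leaf a => .leaf (ν (.leaf a))
  | .app (.inl c) ts => .app (.inl c) fun j => abs i ν (ts j)
  | .app (.inr f) ts => absOp i f (fun j => abs i ν (ts j)) (ν (.app (.inr f) ts))

variable {i : Fin n} {ν : Msg (combine T) → ℕ}

theorem absOp_own (f : (T i).Op) (us : Fin ((T i).arity f) → Msg (T i)) (a : ℕ) :
    absOp i ⟨i, f⟩ us a = opApp f us :=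
  dif_pos (rfl : i = i)

theorem abs_own (f : (T i).Op) (ts : Fin ((T i).arity f) → Msg (combine T)) :
    abs i ν (ownApp i f ts) = opApp f fun j => abs i ν (ts j) :=
  absOp_own f _ _

theorem abs_alien {f : (combine T).Op} (hf : f.1 ≠ i)
    (ts : Fin ((combine T).msgArity (.inr f)) → Msg (combine T)) :
    abs i ν (.app (.inr f) ts) = .leaf (ν (.app (.inr f) ts)) := by
  obtain ⟨j, f⟩ := f
  simp only [abs, absOp]
  rw [dif_neg hf]

/-- Replaces the names of a message of the theory `i` by messages of the combined theory. -/
def conc (i : Fin n) (τ : ℕ → Msg (combine T)) : Msg (T i) → Msg (combine T)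
  | .leaf a => τ a
  | .app (.inl c) ts => .app (.inl c) fun j => conc i τ (ts j)
  | .app (.inr f) ts => .app (.inr ⟨i, f⟩ : Con ⊕ (combine T).Op) fun j => conc i τ (ts j)

variable {τ : ℕ → Msg (combine T)}

theorem conc_fill {X : Type} (σ : X → Msg (T i)) : ∀ t : Term (T i).Op (T i).arity X,
    conc i τ (t.fill σ) = Term.fill (T := combine T) (fun x => conc i τ (σ x)) (embed T i t)
  | .leaf _ => rfl
  | .app f ts => congrArg (ownApp i f) (funext fun j => conc_fill σ (ts j))

theorem abs_fill {X : Type} (σ : X → Msg (combine T)) : ∀ t : Term (T i).Op (T i).arity X,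
    abs i ν (Term.fill (T := combine T) σ (embed T i t)) = t.fill fun x => abs i ν (σ x)
  | .leaf _ => rfl
  | .app f ts =>
    (abs_own f fun j => Term.fill (T := combine T) σ (embed T i (ts j))).trans
      (congrArg (opApp f) (funext fun j => abs_fill σ (ts j)))

theorem conc_bin (f : (T i).Op) (hf : (T i).arity f = 2) (M N : Msg (T i)) :
    conc i τ (bin f hf M N) = bin (T := combine T) (own i f) hf (conc i τ M) (conc i τ N) :=
  congrArg (ownApp i f) (map_vec₂ hf (conc i τ) M N)

theorem ACEq.conc {M N : Msg (T i)} (h : ACEq M N) : ACEq (conc i τ M) (conc i τ N) := by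
  induction h with
  | refl => exact .refl _
  | symm _ ih => exact ih.symm
  | trans _ _ ih₁ ih₂ => exact ih₁.trans ih₂
  | congr f h ih =>
    cases f with
    | inl c => exact .congr _ ih
    | inr f => exact .congr _ ih
  | comm f hf M N =>
    rw [conc_bin, conc_bin]
    exact ACEq.comm (T := combine T) (own i f) hf _ _
  | assoc f hf M N P =>
    simp only [conc_bin]
    exact ACEq.assoc (T := combine T) (own i f) hf _ _ _

theorem RuleStep.conc {M N : Msg (T i)} (h : RuleStep M N) :
    RuleStep (conc i τ M) (conc i τ N) := by
  induction h with
  | root q hq σ =>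
    rw [conc_fill, conc_fill]
    exact RuleStep.root (T := combine T) (embed T i q.1, embed T i q.2) ⟨i, q, hq, rfl⟩ _
  | arg f ts j u _ ih =>
    have hu : (fun k => Intruder.conc i τ (Function.update ts j u k)) =
        Function.update (fun k => Intruder.conc i τ (ts k)) j (Intruder.conc i τ u) := by
      funext k
      by_cases hk : k = j
      · subst hk; simp
      · simp [hk]
    cases f with
    | inl c => exact RuleStep.arg_eq (T := combine T) (f := .inl c) ih hu
    | inr f => exact RuleStep.arg_eq (T := combine T) (f := .inr (own i f)) ih hu

theorem EqMod.conc {M N : Msg (T i)} (h : EqMod M N) : EqMod (conc i τ M) (conc i τ N) := by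
  induction h with
  | rel _ _ h => exact h.elim (fun h => h.conc.eqMod) fun h => h.conc.eqMod
  | refl => exact .refl _
  | symm _ _ _ ih => exact ih.symm
  | trans _ _ _ _ _ ih₁ ih₂ => exact ih₁.trans ih₂

/-- The original is recovered only modulo AC, since AC-equal aliens share one name. -/
theorem conc_abs {N : Msg (combine T)} (h : ∀ K, Subterm K N → ACEq (τ (ν K)) K) :
    ACEq (conc i τ (abs i ν N)) N := by
  induction N with
  | leaf a => exact h _ (.refl _)
  | app f ts ih =>
    have ih' := fun j => ih j fun K hK => h K (.arg _ _ j hK)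
    cases f with
    | inl c => exact .congr _ ih'
    | inr f =>
      by_cases hf : f.1 = i
      · obtain ⟨j, f⟩ := f
        obtain rfl : j = i := hf
        have key : ∀ ts : Fin ((T j).arity f) → Msg (combine T),
            (∀ k, ACEq (conc j τ (abs j ν (ts k))) (ts k)) →
            ACEq (conc j τ (abs j ν (ownApp j f ts))) (ownApp j f ts) := by
          intro ts h
          rw [abs_own]
          exact ACEq.congr (T := combine T) (.inr (own j f)) h
        exact key ts ih'
      · rw [abs_alien hf]
        exact h _ (.refl _)

theorem abs_bin (f : (T i).Op) (hf : (T i).arity f = 2) (M N : Msg (combine T)) :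
    abs i ν (bin (T := combine T) (own i f) hf M N) = bin f hf (abs i ν M) (abs i ν N) :=
  (abs_own f _).trans (congrArg (opApp f) (map_vec₂ hf (abs i ν) M N))

/-- AC steps of theory `i` at visible positions survive; every other one happens within an alien,
whose name depends only on its AC class. -/
theorem ACEq.abs (hν : ∀ M N, ACEq M N → ν M = ν N) {M N : Msg (combine T)} (h : ACEq M N) :
    ACEq (abs i ν M) (abs i ν N) := by
  induction h with
  | refl => exact .refl _
  | symm _ ih => exact ih.symm
  | trans _ _ ih₁ ih₂ => exact ih₁.trans ih₂
  | congr f h ih =>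
    cases f with
    | inl c => exact .congr _ ih
    | inr f =>
      by_cases hf : f.1 = i
      · obtain ⟨j, f⟩ := f
        obtain rfl : j = i := hf
        have key : ∀ ts us : Fin ((T j).arity f) → Msg (combine T),
            (∀ k, ACEq (Intruder.abs j ν (ts k)) (Intruder.abs j ν (us k))) →
            ACEq (Intruder.abs j ν (ownApp j f ts)) (Intruder.abs j ν (ownApp j f us)) := by
          intro ts us h
          rw [abs_own, abs_own]
          exact ACEq.congr (T := T j) (.inr f) h
        exact key _ _ ih
      · rw [abs_alien hf, abs_alien hf, hν _ _ (.congr _ h)]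
        exact .refl _
  | comm f hf M N =>
    by_cases hfi : f.1 = i
    · obtain ⟨j, f⟩ := f
      obtain rfl : j = i := hfi
      have key := ACEq.comm (T := T j) f hf (Intruder.abs j ν M) (Intruder.abs j ν N)
      rw [← abs_bin, ← abs_bin] at key
      exact key
    · have h := hν _ _ (.comm f hf M N)
      simp only [bin] at h ⊢
      rw [abs_alien hfi, abs_alien hfi, h]
      exact .refl _
  | assoc f hf M N P =>
    by_cases hfi : f.1 = i
    · obtain ⟨j, f⟩ := f
      obtain rfl : j = i := hfi
      have key := ACEq.assoc (T := T j) f hf (Intruder.abs j ν M) (Intruder.abs j ν N)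
        (Intruder.abs j ν P)
      simp only [← abs_bin] at key
      exact key
    · have h := hν _ _ (.assoc f hf M N P)
      simp only [bin] at h ⊢
      rw [abs_alien hfi, abs_alien hfi, h]
      exact .refl _

open Classical in
/-- The maximal subterms that are headed by symbols of theories other than `i` are normal. -/
def AlienNormal (i : Fin n) : Msg (combine T) → Prop
  | .leaf _ => True
  | .app (.inl _) ts => ∀ j, AlienNormal i (ts j)
  | .app (.inr f) ts =>
      if f.1 = i then ∀ j, AlienNormal i (ts j) else Normal (T := combine T) (.app (.inr f) ts)

theorem Normal.alienNormal {M : Msg (combine T)} (h : Normal M) : AlienNormal i M := by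
  induction M with
  | leaf a => trivial
  | app f ts ih =>
    cases f with
    | inl c => exact fun j => ih j (h.arg j)
    | inr f =>
      simp only [AlienNormal]
      split_ifs
      · exact fun j => ih j (h.arg j)
      · exact h

theorem alienNormal_bin {f : (combine T).Op} (hf : (combine T).arity f = 2)
    (M N : Msg (combine T)) (hfi : f.1 = i) :
    AlienNormal i (bin f hf M N) ↔ AlienNormal i M ∧ AlienNormal i N := by
  simp only [bin, AlienNormal, if_pos hfi]
  exact forall_bin hf M N _

theorem alienNormal_bin_ne {f : (combine T).Op} (hf : (combine T).arity f = 2)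
    (M N : Msg (combine T)) (hfi : f.1 ≠ i) :
    AlienNormal i (bin f hf M N) ↔ Normal (bin f hf M N) := by
  simp only [bin, AlienNormal, if_neg hfi]

theorem AlienNormal.congr {M N : Msg (combine T)} (h : ACEq M N) :
    AlienNormal i M ↔ AlienNormal i N := by
  induction h with
  | refl => exact .rfl
  | symm _ ih => exact ih.symm
  | trans _ _ ih₁ ih₂ => exact ih₁.trans ih₂
  | congr f h ih =>
    cases f with
    | inl c => exact forall_congr' ih
    | inr f =>
      simp only [AlienNormal]
      split_ifs
      · exact forall_congr' ih
      · exact Normal.congr (.congr _ h)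
  | comm f hf M N =>
    by_cases hfi : f.1 = i
    · rw [alienNormal_bin _ _ _ hfi, alienNormal_bin _ _ _ hfi, and_comm]
    · rw [alienNormal_bin_ne _ _ _ hfi, alienNormal_bin_ne _ _ _ hfi]
      exact Normal.congr (.comm f hf M N)
  | assoc f hf M N P =>
    by_cases hfi : f.1 = i
    · simp only [alienNormal_bin _ _ _ hfi, and_assoc]
    · rw [alienNormal_bin_ne _ _ _ hfi, alienNormal_bin_ne _ _ _ hfi]
      exact Normal.congr (.assoc f hf M N P)

theorem alienNormal_fill {X : Type} (σ : X → Msg (combine T)) :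
    ∀ t : Term (T i).Op (T i).arity X,
      AlienNormal i (Term.fill (T := combine T) σ (embed T i t)) ↔
        ∀ x, t.Occ x → AlienNormal i (σ x)
  | .leaf x => by simp [Term.fill, embed, Term.Occ]
  | .app f ts => by
    simp only [Term.fill, embed, AlienNormal, if_true, Term.Occ]
    constructor
    · rintro h x ⟨j, hx⟩
      exact (alienNormal_fill σ (ts j)).1 (h j) x hx
    · exact fun h j => (alienNormal_fill σ (ts j)).2 fun x hx => h x ⟨j, hx⟩

/-- The redex cannot lie in a maximal alien subterm, as these are normal, so the rule belongs to
theory `i` and its step is visible in the abstraction. Normality of aliens persists because the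
right side has no new variables. -/
theorem RuleStep.abs (hconv : ∀ i, (T i).ACConvergent) {M N : Msg (combine T)} (h : RuleStep M N) (hM : AlienNormal i M) :
    AlienNormal i N ∧ EqMod (abs i ν M) (abs i ν N) := by
  induction h with
  | root q hq σ =>
    have hstep := RuleStep.root q hq σ
    obtain ⟨j, q, hq, rfl⟩ := hq
    by_cases hj : j = i
    · subst hj
      refine ⟨(alienNormal_fill σ q.2).2 fun x hx =>
        (alienNormal_fill σ q.1).1 hM x ((hconv j).occ_left hq hx), ?_⟩
      rw [abs_fill, abs_fill]
      exact (RuleStep.root q hq _).eqMod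
    -- The left side of a rule of another theory is headed by a symbol of that theory, so the redex
    -- is itself alien and hence normal.
    · exfalso
      cases hq' : q.1 with
      | leaf x => exact (hconv j).left_ne_leaf hq x hq'
      | app f us =>
        simp only [hq', embed, Term.fill, AlienNormal, if_neg hj] at hM hstep
        exact hM _ hstep.rew
  | arg f ts j u hu ih =>
    have hupd : (fun k => Intruder.abs i ν (Function.update ts j u k)) =
        Function.update (fun k => Intruder.abs i ν (ts k)) j (Intruder.abs i ν u) := by
      funext k
      by_cases hk : k = j
      · subst hk; simp
      · simp [hk]
    have hall : (∀ k, AlienNormal i (ts k)) → AlienNormal i u →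
        ∀ k, AlienNormal i (Function.update ts j u k) := by
      intro h hu' k
      by_cases hk : k = j
      · subst hk; simpa using hu'
      · simpa [hk] using h k
    cases f with
    | inl c =>
      obtain ⟨h₁, h₂⟩ := ih (hM j)
      refine ⟨hall hM h₁, ?_⟩
      exact EqMod.arg_eq (T := T i) (f := .inl c) h₂ hupd
    | inr f =>
      by_cases hf : f.1 = i
      · obtain ⟨l, f⟩ := f
        obtain rfl : l = i := hf
        simp only [AlienNormal, if_true] at hM
        obtain ⟨h₁, h₂⟩ := ih (hM j)
        refine ⟨?_, ?_⟩
        · simp only [AlienNormal, if_true]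
          exact hall hM h₁
        · have key : ∀ ts us : Fin ((T l).arity f) → Msg (combine T),
              EqMod (opApp f fun k => Intruder.abs l ν (ts k))
                (opApp f fun k => Intruder.abs l ν (us k)) →
              EqMod (Intruder.abs l ν (ownApp l f ts)) (Intruder.abs l ν (ownApp l f us)) := by
            intro ts us h
            rwa [abs_own, abs_own]
          exact key _ _ (EqMod.arg_eq (T := T l) (f := .inr f) h₂ hupd)
      · simp only [AlienNormal, if_neg hf] at hM
        exact absurd (RuleStep.arg _ ts j u hu).rew (hM _)

theorem rewrites_abs (hconv : ∀ i, (T i).ACConvergent) (hν : ∀ M N, ACEq M N → ν M = ν N)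
    {M N : Msg (combine T)} (h : Relation.ReflTransGen Rew M N) (hM : AlienNormal i M) :
    AlienNormal i N ∧ EqMod (abs i ν M) (abs i ν N) := by
  induction h with
  | refl => exact ⟨hM, .refl _⟩
  | tail _ h ih =>
    obtain ⟨A, B, h₁, h₂, h₃⟩ := h
    obtain ⟨hN, he⟩ := ih
    obtain ⟨hB, he'⟩ := h₂.abs hconv ((AlienNormal.congr h₁).1 hN)
    exact ⟨(AlienNormal.congr h₃).1 hB,
      he.trans ((h₁.abs hν).eqMod.trans (he'.trans (h₃.abs hν).eqMod))⟩

/-- `M` equals, modulo the combined theory, a context over the signature of the theory `i` filled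
with messages of `S`. -/
def Direct (i : Fin n) (S : Set (Msg (combine T))) (M : Msg (combine T)) : Prop :=
  ∃ (k : ℕ) (C : Term (T i).Op (T i).arity (Fin k)) (σ : Fin k → Msg (combine T)),
    (∀ j, σ j ∈ S) ∧ EqMod M (Term.fill (T := combine T) σ (embed T i C))

/-- From left to right, the equality is first turned into a rewriting of the filled context to the
normal goal, since only rewriting from normal aliens can be followed through the abstraction. From
right to left, names are replaced by the messages they stand for. -/
theorem direct_iff_elem (hconv : ∀ i, (T i).ACConvergent) (hcomb : (combine T).ACConvergent)
    (hν : ∀ M N, ACEq M N → ν M = ν N) {S : Set (Msg (combine T))} {M : Msg (combine T)}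
    (hS : ∀ N ∈ S, Normal N) (hM : Normal M)
    (hSτ : ∀ N ∈ S, ∀ K, Subterm K N → ACEq (τ (ν K)) K)
    (hMτ : ∀ K, Subterm K M → ACEq (τ (ν K)) K) :
    Direct i S M ↔ Elem (abs i ν '' S) (abs i ν M) := by
  constructor
  · rintro ⟨k, C, σ, hσ, he⟩
    obtain ⟨P, hP, hPM⟩ := hcomb.rewrites_to_normal hM he
    obtain ⟨-, h⟩ := rewrites_abs hconv hν (i := i) hP
      ((alienNormal_fill σ C).2 fun x _ => (hS _ (hσ x)).alienNormal)
    rw [abs_fill] at h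
    exact ⟨k, C, _, fun j => ⟨_, hσ j, rfl⟩, h.trans (hPM.abs hν).eqMod⟩
  · rintro ⟨k, C, σ, hσ, he⟩
    choose s hs hsσ using hσ
    refine ⟨k, C, s, hs, ?_⟩
    have h := (he.conc (τ := τ)).symm
    rw [conc_fill] at h
    refine (conc_abs hMτ).symm.eqMod.trans (h.trans ?_)
    refine (ACEq.fill_congr (fun x => ?_) _).eqMod
    rw [← hsσ x]
    exact conc_abs (hSτ _ (hs x))

/-- A rewrite step of the abstraction would lift, by putting the aliens back, to a step of `M`.
Queries are therefore legitimate inputs for the oracles. -/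
theorem Normal.abs {M : Msg (combine T)} (hM : Normal M)
    (hMτ : ∀ K, Subterm K M → ACEq (τ (ν K)) K) : Normal (abs i ν M) := by
  rintro N ⟨A, B, h₁, h₂, h₃⟩
  exact hM _ ⟨_, _, (conc_abs hMτ).symm.trans (h₁.conc (τ := τ)), h₂.conc, h₃.conc⟩

end Abstraction

end Intruder
namespace Intruder

/-! ### Subterms and saturated sets -/

section Saturated

variable {T : Theory}

def Term.weight : Msg T → ℕ
  | .leaf _ => 1
  | .app _ ts => 1 + ∑ j, (ts j).weight

theorem Term.weight_arg {f} (ts : Fin (T.msgArity f) → Msg T) (j) :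
    (ts j).weight < (Term.app f ts : Msg T).weight := by
  have := Finset.single_le_sum (f := fun j => (ts j).weight) (fun _ _ => Nat.zero_le _)
    (Finset.mem_univ j)
  simp only [weight]
  omega

theorem Subterm.weight {M N : Msg T} (h : Subterm N M) : N = M ∨ N.weight < M.weight := by
  induction h with
  | refl => exact .inl rfl
  | arg f ts j _ ih =>
    have := Term.weight_arg ts j
    rcases ih with rfl | h
    · exact .inr this
    · exact .inr (h.trans this)

theorem subterm_app {f} {ts : Fin (T.msgArity f) → Msg T} {N : Msg T} :
    Subterm N (.app f ts) ↔ N = .app f ts ∨ ∃ j, Subterm N (ts j) := by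
  constructor
  · intro h
    cases h with
    | refl => exact .inl rfl
    | arg _ _ j h => exact .inr ⟨j, h⟩
  · rintro (rfl | ⟨j, h⟩)
    · exact .refl _
    · exact .arg f ts j h

theorem subterm_leaf {a : ℕ} {N : Msg T} : Subterm N (.leaf a) ↔ N = .leaf a :=
  ⟨fun h => by cases h; rfl, fun h => h ▸ .refl _⟩

theorem subterm_antisymm {M N : Msg T} (h : Subterm M N) (h' : Subterm N M) : M = N := by
  rcases h.weight with h | h
  · exact h
  · rcases h'.weight with h' | h'
    · exact h'.symm
    · omega

theorem arg_ne_app {f} (ts : Fin (T.msgArity f) → Msg T) (j) : ts j ≠ .app f ts := fun h => by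
  have := Term.weight_arg ts j
  rw [h] at this
  exact lt_irrefl _ this

variable {U : Set (Msg T)}

theorem pst_of_subterm {M N : Msg T} (hM : M ∈ pst U) (h : Subterm N M) : N ∈ pst U := by
  obtain ⟨X, hX, hMX, hne⟩ := hM
  refine ⟨X, hX, h.trans hMX, ?_⟩
  rintro rfl
  exact hne (subterm_antisymm hMX h)

/-- The additional signatures bring in no new proper subterms, because both of their arguments are
proper subterms already. -/
theorem pst_of_st {M N : Msg T} (hM : M ∈ St U) (h : Subterm N M) (hne : N ≠ M) : N ∈ pst U := by
  rcases hM with (hM | hM) | ⟨A, hA, B, hB, rfl⟩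
  · exact ⟨M, hM, h, hne⟩
  · exact pst_of_subterm hM h
  · rcases subterm_app.1 h with h | ⟨j, h⟩
    · exact absurd h hne
    · have : (![A, B] : Fin 2 → Msg T) j ∈ pst U := by
        change Fin 2 at j
        fin_cases j
        exacts [hA, hB]
      exact pst_of_subterm this h

theorem st_of_subterm {M N : Msg T} (hM : M ∈ St U) (h : Subterm N M) : N ∈ St U := by
  by_cases hne : N = M
  · exact hne ▸ hM
  · exact .inl (.inr (pst_of_st hM h hne))

theorem arg_mem_pst {f} {ts : Fin (T.msgArity f) → Msg T} (h : .app f ts ∈ St U) (j) :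
    ts j ∈ pst U :=
  pst_of_st h (.arg f ts j (.refl _)) (arg_ne_app ts j)

end Saturated

/-- Each round that is not stationary adds an element of `A`, so at most `A.ncard` rounds can be so.
`F` is not assumed monotone. -/
theorem iterate_fixed {α : Type} {A : Set α} (hA : A.Finite) {F : Set α → Set α}
    (hF : ∀ S ⊆ A, S ⊆ F S ∧ F S ⊆ A) {S : Set α} (hS : S ⊆ A) {m : ℕ} (hm : A.ncard ≤ m) :
    F (F^[m] S) = F^[m] S := by
  have hsub : ∀ t, F^[t] S ⊆ A := fun t => by
    induction t with
    | zero => exact hS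
    | succ t ih => rw [Function.iterate_succ_apply']; exact (hF _ ih).2
  have key : ∀ t, F (F^[t] S) = F^[t] S ∨ t < (F (F^[t] S)).ncard := by
    intro t
    induction t with
    | zero =>
      by_cases h : F S = S
      · exact .inl h
      · refine .inr ((Nat.zero_le _).trans_lt (Set.ncard_lt_ncard
          ((hF S hS).1.ssubset_of_ne (Ne.symm h)) (hA.subset (hF S hS).2)))
    | succ t ih =>
      rw [Function.iterate_succ_apply']
      by_cases h : F (F (F^[t] S)) = F (F^[t] S)
      · exact .inl h
      · rcases ih with h' | h'
        · exact absurd (congrArg F h') h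
        · have h₁ := (hF _ (hsub t)).2
          have := Set.ncard_lt_ncard ((hF _ h₁).1.ssubset_of_ne (Ne.symm h))
            (hA.subset (hF _ h₁).2)
          exact .inr (by omega)
  rcases key m with h | h
  · exact h
  · have := Set.ncard_le_ncard (hF _ (hsub m)).2 hA
    omega

/-! ### Saturation for the linear system -/

section Saturation

variable {n : ℕ} {T : Fin n → Theory} {Γ Δ : Set (Msg (combine T))} {M N P : Msg (combine T)}

theorem RD.mono (h : Γ ⊆ Δ) (hM : RD Γ M) : RD Δ M := by
  induction hM with
  | id i k C σ hσ he => exact .id i k C σ (fun j => h (hσ j)) he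
  | pair _ _ ih₁ ih₂ => exact .pair ih₁ ih₂
  | enc _ _ ih₁ ih₂ => exact .enc ih₁ ih₂
  | sign _ _ ih₁ ih₂ => exact .sign ih₁ ih₂
  | blind _ _ ih₁ ih₂ => exact .blind ih₁ ih₂

/-- The messages that one application of a left rule adds to `Γ`, for the goal `P`. -/
inductive LeftStep (Γ : Set (Msg (combine T))) (P : Msg (combine T)) : Msg (combine T) → Prop
  | pair_fst {A B} : pair A B ∈ Γ → LeftStep Γ P A
  | pair_snd {A B} : pair A B ∈ Γ → LeftStep Γ P B
  | enc_fst {A K} : enc A K ∈ Γ → RD Γ K → LeftStep Γ P A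
  | enc_snd {A K} : enc A K ∈ Γ → RD Γ K → LeftStep Γ P K
  | sign {A K L} : sign A K ∈ Γ → pub L ∈ Γ → ACEq K L → LeftStep Γ P A
  | blind_fst {A K} : blind A K ∈ Γ → RD Γ K → LeftStep Γ P A
  | blind_snd {A K} : blind A K ∈ Γ → RD Γ K → LeftStep Γ P K
  | unblind_fst {A R K} : sign (blind A R) K ∈ Γ → RD Γ R → LeftStep Γ P (sign A K)
  | unblind_snd {A R K} : sign (blind A R) K ∈ Γ → RD Γ R → LeftStep Γ P R
  | ls {A} : Guarded A → (∃ M ∈ Γ ∪ {P}, Subterm A M) → RD Γ A → LeftStep Γ P A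
  | lcs {A} : (∃ M ∈ Γ ∪ {P}, CrossSubterm A M) → RD Γ A → LeftStep Γ P A

theorem exists_mem_mono {p : Msg (combine T) → Prop} (h : Γ ⊆ Δ) (hp : ∃ M ∈ Γ ∪ {P}, p M) :
    ∃ M ∈ Δ ∪ {P}, p M := by
  obtain ⟨M, hM, hp⟩ := hp
  exact ⟨M, Set.union_subset_union_left _ h hM, hp⟩

theorem LeftStep.mono (h : Γ ⊆ Δ) (hN : LeftStep Γ P N) : LeftStep Δ P N := by
  cases hN with
  | pair_fst h₁ => exact .pair_fst (h h₁)
  | pair_snd h₁ => exact .pair_snd (h h₁)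
  | enc_fst h₁ h₂ => exact .enc_fst (h h₁) (h₂.mono h)
  | enc_snd h₁ h₂ => exact .enc_snd (h h₁) (h₂.mono h)
  | sign h₁ h₂ h₃ => exact .sign (h h₁) (h h₂) h₃
  | blind_fst h₁ h₂ => exact .blind_fst (h h₁) (h₂.mono h)
  | blind_snd h₁ h₂ => exact .blind_snd (h h₁) (h₂.mono h)
  | unblind_fst h₁ h₂ => exact .unblind_fst (h h₁) (h₂.mono h)
  | unblind_snd h₁ h₂ => exact .unblind_snd (h h₁) (h₂.mono h)
  | ls h₁ h₂ h₃ => exact .ls h₁ (exists_mem_mono h h₂) (h₃.mono h)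
  | lcs h₂ h₃ => exact .lcs (exists_mem_mono h h₂) (h₃.mono h)

theorem LD.mono (hP : LD Γ P) : ∀ {Δ}, Γ ⊆ Δ → LD Δ P := by
  induction hP with
  | r h => exact fun hs => .r (h.mono hs)
  | lp h _ ih => exact fun hs => .lp (hs h) (ih (Set.union_subset_union_left _ hs))
  | le h h' _ ih =>
    exact fun hs => .le (hs h) (h'.mono hs) (ih (Set.union_subset_union_left _ hs))
  | sign h h' h'' _ ih =>
    exact fun hs => .sign (hs h) (hs h') h'' (ih (Set.union_subset_union_left _ hs))
  | blind₁ h h' _ ih =>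
    exact fun hs => .blind₁ (hs h) (h'.mono hs) (ih (Set.union_subset_union_left _ hs))
  | blind₂ h h' _ ih =>
    exact fun hs => .blind₂ (hs h) (h'.mono hs) (ih (Set.union_subset_union_left _ hs))
  | ls h h' h'' _ ih =>
    exact fun hs => .ls h (exists_mem_mono hs h') (h''.mono hs)
      (ih (Set.union_subset_union_left _ hs))
  | lcs h' h'' _ ih =>
    exact fun hs => .lcs (exists_mem_mono hs h') (h''.mono hs)
      (ih (Set.union_subset_union_left _ hs))

/-- A rule may add two messages at once; by monotonicity the second one does no harm. -/
theorem LD.of_leftStep (hN : LeftStep Γ P N) (h : LD (Γ ∪ {N}) P) : LD Γ P := by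
  have h₁ : ∀ B, LD (Γ ∪ {N, B}) P := fun B =>
    h.mono (Set.union_subset_union_right _ (by simp))
  have h₂ : ∀ B, LD (Γ ∪ {B, N}) P := fun B =>
    h.mono (Set.union_subset_union_right _ (by simp))
  cases hN with
  | pair_fst h => exact .lp h (h₁ _)
  | pair_snd h => exact .lp h (h₂ _)
  | enc_fst h h' => exact .le h h' (h₁ _)
  | enc_snd h h' => exact .le h h' (h₂ _)
  | sign h₁ h₂ h₃ => exact .sign h₁ h₂ h₃ h
  | blind_fst h h' => exact .blind₁ h h' (h₁ _)
  | blind_snd h h' => exact .blind₁ h h' (h₂ _)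
  | unblind_fst h' h'' => exact .blind₂ h' h'' (h₁ _)
  | unblind_snd h' h'' => exact .blind₂ h' h'' (h₂ _)
  | ls h₁ h₂ h₃ => exact .ls h₁ h₂ h₃ h
  | lcs h₁ h₂ => exact .lcs h₁ h₂ h

theorem LD.of_leftSteps {D : Set (Msg (combine T))} (hD : D.Finite)
    (hs : ∀ N ∈ D, LeftStep Γ P N) (h : LD (Γ ∪ D) P) : LD Γ P := by
  induction D, hD using Set.Finite.induction_on with
  | empty => simpa using h
  | @insert a s _ _ ih =>
    refine ih (fun N hN => hs N (.inr hN)) (LD.of_leftStep (N := a)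
      ((hs a (.inl rfl)).mono Set.subset_union_left) ?_)
    rwa [Set.union_assoc, Set.union_singleton]

/-- A set closed under left steps absorbs every left rule of a derivation, so only its final right
part remains. -/
theorem RD.of_ld (hP : LD Γ P) :
    ∀ {Δ}, Γ ⊆ Δ → (∀ N, LeftStep Δ P N → N ∈ Δ) → RD Δ P := by
  induction hP with
  | r h => exact fun hs _ => h.mono hs
  | lp h _ ih =>
    refine fun hs hc => ih (Set.union_subset hs ?_) hc
    rintro _ (rfl | rfl)
    exacts [hc _ (.pair_fst (hs h)), hc _ (.pair_snd (hs h))]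
  | le h h' _ ih =>
    refine fun hs hc => ih (Set.union_subset hs ?_) hc
    rintro _ (rfl | rfl)
    exacts [hc _ (.enc_fst (hs h) (h'.mono hs)), hc _ (.enc_snd (hs h) (h'.mono hs))]
  | sign h h' h'' _ ih =>
    refine fun hs hc => ih (Set.union_subset hs ?_) hc
    rintro _ rfl
    exact hc _ (.sign (hs h) (hs h') h'')
  | blind₁ h h' _ ih =>
    refine fun hs hc => ih (Set.union_subset hs ?_) hc
    rintro _ (rfl | rfl)
    exacts [hc _ (.blind_fst (hs h) (h'.mono hs)), hc _ (.blind_snd (hs h) (h'.mono hs))]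
  | blind₂ h h' _ ih =>
    refine fun hs hc => ih (Set.union_subset hs ?_) hc
    rintro _ (rfl | rfl)
    exacts [hc _ (.unblind_fst (hs h) (h'.mono hs)), hc _ (.unblind_snd (hs h) (h'.mono hs))]
  | ls h h' h'' _ ih =>
    refine fun hs hc => ih (Set.union_subset hs ?_) hc
    rintro _ rfl
    exact hc _ (.ls h (exists_mem_mono hs h') (h''.mono hs))
  | lcs h' h'' _ ih =>
    refine fun hs hc => ih (Set.union_subset hs ?_) hc
    rintro _ rfl
    exact hc _ (.lcs (exists_mem_mono hs h') (h''.mono hs))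

theorem CrossSubterm.subterm (h : CrossSubterm N M) : Subterm N M := by
  obtain ⟨f, g, ts, us, -, rfl, ⟨j, hj⟩, h⟩ := h
  exact (hj ▸ Subterm.arg (.inr g) us j (.refl _) : Subterm _ _).trans h

theorem vec₂_mem_pst {U : Set (Msg (combine T))} {c : Con} {A B : Msg (combine T)}
    (hc : c.arity = 2)
    (h : (.app (.inl c) (fun j => (![A, B] : Fin 2 → Msg (combine T)) (Fin.cast hc j)) :
      Msg (combine T)) ∈ St U) : A ∈ pst U ∧ B ∈ pst U :=
  (forall_bin hc A B (· ∈ pst U)).1 (arg_mem_pst h)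

/-- This keeps saturation within a fixed finite set: the rules that take a message apart yield
proper subterms, and the locality conditions of `ls` and `lcs` ask for subterms. -/
theorem LeftStep.mem_st {U : Set (Msg (combine T))} (hΓ : Γ ∪ {P} ⊆ St U)
    (hN : LeftStep Γ P N) : N ∈ St U := by
  have hΓ' : ∀ {M}, M ∈ Γ → M ∈ St U := fun h => hΓ (.inl h)
  have hp : ∀ {M}, M ∈ pst U → M ∈ St U := fun h => .inl (.inr h)
  cases hN with
  | pair_fst h => exact hp (vec₂_mem_pst (c := .pair) rfl (hΓ' h)).1
  | pair_snd h => exact hp (vec₂_mem_pst (c := .pair) rfl (hΓ' h)).2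
  | enc_fst h => exact hp (vec₂_mem_pst (c := .enc) rfl (hΓ' h)).1
  | enc_snd h => exact hp (vec₂_mem_pst (c := .enc) rfl (hΓ' h)).2
  | sign h => exact hp (vec₂_mem_pst (c := .sign) rfl (hΓ' h)).1
  | blind_fst h => exact hp (vec₂_mem_pst (c := .blind) rfl (hΓ' h)).1
  | blind_snd h => exact hp (vec₂_mem_pst (c := .blind) rfl (hΓ' h)).2
  | unblind_fst h =>
    -- The new signature need not be a subterm, but its two arguments are proper subterms of the
    -- sequent.
    obtain ⟨h₁, h₂⟩ := vec₂_mem_pst (c := .sign) rfl (hΓ' h)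
    exact .inr ⟨_, (vec₂_mem_pst (c := .blind) rfl (hp h₁)).1, _, h₂, rfl⟩
  | unblind_snd h =>
    obtain ⟨h₁, h₂⟩ := vec₂_mem_pst (c := .sign) rfl (hΓ' h)
    exact hp (vec₂_mem_pst (c := .blind) rfl (hp h₁)).2
  | ls _ h =>
    obtain ⟨M, hM, h⟩ := h
    exact st_of_subterm (hΓ hM) h
  | lcs h =>
    obtain ⟨M, hM, h⟩ := h
    exact st_of_subterm (hΓ hM) h.subterm

/-- One round of saturation within `A`. -/
def saturate (A : Set (Msg (combine T))) (P : Msg (combine T)) (S : Set (Msg (combine T))) :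
    Set (Msg (combine T)) := {N | N ∈ A ∧ (N ∈ S ∨ LeftStep S P N)}

/-- After `m` rounds the set is stationary and therefore closed under left steps, so a derivation
collapses to its right part. Conversely, each round consists of finitely many left steps, which can
be prefixed to a derivation one by one. -/
theorem ld_iff_rd_saturate (hfin : (St (Γ ∪ {P})).Finite) {m : ℕ}
    (hm : (St (Γ ∪ {P})).ncard ≤ m) :
    LD Γ P ↔ RD ((saturate (St (Γ ∪ {P})) P)^[m] Γ) P := by
  set A := St (Γ ∪ {P}) with hA
  have hΓA : Γ ∪ {P} ⊆ A := fun N hN => .inl (.inl hN)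
  have hPA : P ∈ A := hΓA (.inr rfl)
  have hsat : ∀ S ⊆ A, S ⊆ saturate A P S ∧ saturate A P S ⊆ A := fun S hS =>
    ⟨fun N hN => ⟨hS hN, .inl hN⟩, fun N hN => hN.1⟩
  have hΓ : Γ ⊆ A := fun N hN => hΓA (.inl hN)
  have hit : ∀ t, Γ ⊆ (saturate A P)^[t] Γ ∧ (saturate A P)^[t] Γ ⊆ A := by
    intro t
    induction t with
    | zero => exact ⟨subset_rfl, hΓ⟩
    | succ t ih =>
      rw [Function.iterate_succ_apply']
      exact ⟨ih.1.trans (hsat _ ih.2).1, (hsat _ ih.2).2⟩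
  constructor
  · intro h
    refine RD.of_ld h (hit m).1 fun N hN => ?_
    rw [← iterate_fixed hfin hsat hΓ hm]
    exact ⟨hN.mem_st (Set.union_subset (hit m).2 (Set.singleton_subset_iff.2 hPA)), .inr hN⟩
  · have key : ∀ t, LD ((saturate A P)^[t] Γ) P → LD Γ P := by
      intro t
      induction t with
      | zero => exact id
      | succ t ih =>
        intro h
        rw [Function.iterate_succ_apply'] at h
        set S := (saturate A P)^[t] Γ
        refine ih (LD.of_leftSteps (D := {N | N ∈ A ∧ LeftStep S P N})
          (hfin.subset fun N hN => hN.1) (fun N hN => hN.2) (h.mono ?_))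
        rintro N ⟨hN, hN' | hN'⟩
        exacts [.inl hN', .inr ⟨hN, hN'⟩]
    exact fun h => key m (.r h)

end Saturation

end Intruder
namespace Intruder

/-! ### Representatives in a list -/

section Rep

variable {α : Type} {r : α → α → Prop} {l : List α}

open Classical in
/-- The first element of the list that is related to `x`. -/
noncomputable def rep (r : α → α → Prop) (l : List α) (x : α) : α :=
  (l.find? fun y => decide (r y x)).getD x

theorem find?_eq_rep (hr : Equivalence r) {x : α} (hx : x ∈ l) {p : α → Bool}
    (hp : ∀ y, p y = true ↔ r y x) :
    l.find? p = some (rep r l x) ∧ rep r l x ∈ l ∧ r (rep r l x) x := by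
  have : ∃ y, l.find? p = some y := by
    rw [← Option.isSome_iff_exists, List.find?_isSome]
    exact ⟨x, hx, (hp x).2 (hr.refl x)⟩
  obtain ⟨y, hy⟩ := this
  have hpr : (fun y => @decide (r y x) (Classical.propDecidable _)) = p :=
    funext fun y => by rw [Bool.eq_iff_iff, hp]; simp
  have : rep r l x = y := by rw [rep, hpr, hy, Option.getD_some]
  rw [this]
  exact ⟨hy, List.mem_of_find?_eq_some hy, (hp y).1 (List.find?_some hy)⟩

theorem rep_mem (hr : Equivalence r) {x : α} (hx : x ∈ l) : rep r l x ∈ l := by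
  classical exact (find?_eq_rep (p := fun y => decide (r y x)) hr hx (by simp)).2.1

theorem rel_rep (hr : Equivalence r) {x : α} (hx : x ∈ l) : r (rep r l x) x := by
  classical exact (find?_eq_rep (p := fun y => decide (r y x)) hr hx (by simp)).2.2

theorem rep_congr (hr : Equivalence r) {x y : α} (hx : x ∈ l) (hy : y ∈ l) (h : r x y) :
    rep r l x = rep r l y := by
  classical
  have h₁ := (find?_eq_rep (p := fun z => decide (r z x)) hr hx (by simp)).1
  have h₂ := (find?_eq_rep (p := fun z => decide (r z y)) hr hy (by simp)).1
  have : (fun z => decide (r z x)) = fun z => decide (r z y) := by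
    funext z
    exact decide_eq_decide.2 ⟨fun hz => hr.trans hz h, fun hz => hr.trans hz (hr.symm h)⟩
  rw [this, h₂] at h₁
  exact (Option.some.inj h₁).symm

theorem rep_eq_iff (hr : Equivalence r) {x y : α} (hx : x ∈ l) (hy : y ∈ l) :
    rep r l x = rep r l y ↔ r x y :=
  ⟨fun h => hr.trans (hr.symm (rel_rep hr hx)) (h ▸ rel_rep hr hy), rep_congr hr hx hy⟩

theorem rep_rep (hr : Equivalence r) {x : α} (hx : x ∈ l) : rep r l (rep r l x) = rep r l x :=
  rep_congr hr (rep_mem hr hx) hx (rel_rep hr hx)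

theorem rep_of_prefix {x : α} {l₁ l₂ : List α} (hr : Equivalence r) (h : ¬ ∃ y ∈ l₁, r y x) :
    rep r (l₁ ++ x :: l₂) x = x := by
  classical
  have : l₁.find? (fun y => decide (r y x)) = none := by
    rw [List.find?_eq_none]
    intro y hy
    simpa using fun hyx => h ⟨y, hy, hyx⟩
  rw [rep, List.find?_append, this]
  simp [hr.refl x]

/-- A representative never comes after the element it represents; this preserves the order of
children before parents. -/
theorem rep_mem_prefix {x : α} {l₁ l₂ : List α} (hx : x ∈ l₁) (hr : Equivalence r) :
    rep r (l₁ ++ l₂) x ∈ l₁ := by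
  classical
  obtain ⟨h₁, h₂, -⟩ := find?_eq_rep (p := fun y => decide (r y x)) hr hx (by simp)
  rw [rep, List.find?_append, h₁]
  exact h₂

end Rep

/-! ### The nodes of a DAG -/

section Dag

variable {T : Theory} {Γ : Set (Msg T)} {P : Msg T} (G : Dag Γ P)

theorem Dag.arg_mem {f} {ts : Fin (T.msgArity f) → Msg T} (h : .app f ts ∈ G.nodes) (j) :
    ts j ∈ G.nodes :=
  (G.mem_nodes _).2 (.inl (.inr (arg_mem_pst ((G.mem_nodes _).1 h) j)))

theorem Dag.subterm_mem {M N : Msg T} (hM : M ∈ G.nodes) (h : Subterm N M) : N ∈ G.nodes :=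
  (G.mem_nodes _).2 (st_of_subterm ((G.mem_nodes _).1 hM) h)

theorem Dag.goal_mem : P ∈ G.nodes := (G.mem_nodes _).2 (.inl (.inl (.inr rfl)))

theorem Dag.hyp_mem {N : Msg T} (h : N ∈ Γ) : N ∈ G.nodes := (G.mem_nodes _).2 (.inl (.inl (.inl h)))

theorem Dag.size_eq : size Γ P = G.nodes.length := by
  classical
  have : St (Γ ∪ {P}) = (G.nodes.toFinset : Set (Msg T)) := by
    ext N; simp [G.mem_nodes]
  rw [size, this, Set.ncard_coe_finset, List.toFinset_card_of_nodup G.nodup]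

theorem Dag.finite (G : Dag Γ P) : (St (Γ ∪ {P})).Finite :=
  (List.finite_toSet G.nodes).subset fun N hN => (G.mem_nodes N).2 hN

theorem Dag.addr_inj {M N : Msg T} (hM : M ∈ G.nodes) (hN : N ∈ G.nodes) :
    G.addr M = G.addr N ↔ M = N := G.addr_injOn.eq_iff hM hN

theorem Dag.subterm_prefix {l₁ l₂ : List (Msg T)} {M : Msg T} {f}
    {ts : Fin (T.msgArity f) → Msg T} {j} (h : G.nodes = l₁ ++ .app f ts :: l₂)
    (hM : Subterm M (ts j)) : M ∈ l₁ := by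
  have key : ∀ M N, Subterm M N → ∀ l₁ l₂, G.nodes = l₁ ++ N :: l₂ → M = N ∨ M ∈ l₁ := by
    intro M N hMN
    induction hMN with
    | refl => exact fun _ _ _ => .inl rfl
    | arg f ts j _ ih =>
      intro l₁ l₂ h
      obtain ⟨a, b, hab⟩ := List.append_of_mem (G.sorted l₁ f ts l₂ h j)
      rw [hab] at h ⊢
      rcases ih a (b ++ .app f ts :: l₂) (by simpa using h) with h | h
      · exact .inr (by simp [h])
      · exact .inr (by simp [h])
  rcases key _ _ (.arg f ts j hM) l₁ l₂ h with h' | h'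
  · have h₁ := hM.weight
    have h₂ := Term.weight_arg ts j
    rw [h'] at h₁
    rcases h₁ with h₁ | h₁
    · rw [h₁] at h₂; omega
    · omega
  · exact h'

end Dag

/-! ### Queries to the theories as DAGs built from the given nodes -/

section Query

variable {n : ℕ} {T : Fin n → Theory} {Γ : Set (Msg (combine T))} {P : Msg (combine T)}
  (G : Dag Γ P)

theorem aceq_equivalence {T : Theory} : Equivalence (ACEq : Msg T → Msg T → Prop) :=
  ⟨.refl, .symm, .trans⟩

open Classical in
/-- The address of the first node that is AC-equal to the message. -/
noncomputable def Dag.nu (M : Msg (combine T)) : ℕ :=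
  ((G.nodes.find? fun K => decide (ACEq K M)).map G.addr).getD 0

open Classical in
/-- The node with a given address. -/
noncomputable def Dag.nodeAt (a : ℕ) : Msg (combine T) :=
  if h : ∃ K ∈ G.nodes, G.addr K = a then h.choose else .leaf 0

theorem Dag.nu_congr (M N : Msg (combine T)) (h : ACEq M N) : G.nu M = G.nu N := by
  classical
  have : (fun K => decide (ACEq K M)) = fun K => decide (ACEq K N) := by
    funext K
    exact decide_eq_decide.2 ⟨fun hK => hK.trans h, fun hK => hK.trans h.symm⟩
  rw [Dag.nu, Dag.nu, this]

variable {G} in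
theorem Dag.nu_eq {N : Msg (combine T)} (hN : N ∈ G.nodes) :
    G.nu N = G.addr (rep ACEq G.nodes N) := by
  classical
  rw [Dag.nu, (find?_eq_rep aceq_equivalence hN (by simp)).1]
  rfl

variable {G} in
theorem Dag.nodeAt_addr {N : Msg (combine T)} (hN : N ∈ G.nodes) : G.nodeAt (G.addr N) = N := by
  have h : ∃ K ∈ G.nodes, G.addr K = G.addr N := ⟨N, hN, rfl⟩
  rw [Dag.nodeAt, dif_pos h]
  exact (G.addr_inj h.choose_spec.1 hN).1 h.choose_spec.2

theorem Dag.nodeAt_nu {N : Msg (combine T)} (hN : N ∈ G.nodes) : ACEq (G.nodeAt (G.nu N)) N := by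
  rw [Dag.nu_eq hN, Dag.nodeAt_addr (rep_mem aceq_equivalence hN)]
  exact rel_rep aceq_equivalence hN

variable (i : Fin n)

/-- The abstraction of a message for the theory `i`. -/
noncomputable def Dag.ab (M : Msg (combine T)) : Msg (T i) := abs i G.nu M

/-- Equality of the abstractions. -/
def Dag.Same (M N : Msg (combine T)) : Prop := G.ab i M = G.ab i N

theorem Dag.same_equivalence : Equivalence (G.Same i) :=
  ⟨fun _ => rfl, fun h => h.symm, fun h h' => h.trans h'⟩

/-- The symbols that the abstraction for the theory `i` keeps. -/
def Kept (i : Fin n) (f : Con ⊕ (combine T).Op) : Prop := ∀ g, f = .inr g → g.1 = i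

/-- `N` is an immediate subterm of `M` that is visible in the abstraction of `M`. -/
def KeptArg (i : Fin n) (M N : Msg (combine T)) : Prop :=
  ∃ f, Kept i f ∧ ∃ ts, M = .app f ts ∧ ∃ j, ts j = N

variable {G i}

/-- The symbol depends neither on the DAG nor on the arguments, so that a program can contain its
code as a constant. -/
theorem Kept.exists_symbol {f : Con ⊕ (combine T).Op} (hf : Kept i f) :
    ∃ (g : Con ⊕ (T i).Op) (h : (T i).msgArity g = (combine T).msgArity f),
      ∀ {Γ P} (G : Dag (T := combine T) Γ P) (ts : Fin ((combine T).msgArity f) → Msg (combine T)),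
        G.ab i (.app f ts) = .app g fun j => G.ab i (ts (Fin.cast h j)) := by
  cases f with
  | inl c => exact ⟨.inl c, rfl, fun _ _ => rfl⟩
  | inr f =>
    obtain ⟨j, f⟩ := f
    obtain rfl : j = i := hf _ rfl
    exact ⟨.inr f, rfl, fun _ ts => abs_own f ts⟩

theorem Dag.ab_kept {f : Con ⊕ (combine T).Op} (hf : Kept i f)
    (ts : Fin ((combine T).msgArity f) → Msg (combine T)) :
    ∃ (g : Con ⊕ (T i).Op) (h : (T i).msgArity g = (combine T).msgArity f),
      G.ab i (.app f ts) = .app g fun j => G.ab i (ts (Fin.cast h j)) :=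
  let ⟨g, h, he⟩ := hf.exists_symbol
  ⟨g, h, he G ts⟩

/-- Arguments of an abstraction come from arguments of the message. Iterated, this lifts every
subterm of an abstraction to a subterm of the message. -/
theorem Dag.ab_eq_app {M : Msg (combine T)} {g : Con ⊕ (T i).Op} {us}
    (h : G.ab i M = .app g us) (j) : ∃ N, KeptArg i M N ∧ G.ab i N = us j := by
  cases M with
  | leaf a => simp [Dag.ab, abs] at h
  | app f ts =>
    by_cases hf : Kept i f
    · obtain ⟨g', hg', he⟩ := Dag.ab_kept (G := G) hf ts
      rw [he] at h
      cases h
      exact ⟨_, ⟨f, hf, ts, rfl, _, rfl⟩, rfl⟩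
    · simp only [Kept, not_forall] at hf
      obtain ⟨f, rfl, hf⟩ := hf
      simp [Dag.ab, abs_alien hf] at h

theorem KeptArg.subterm {M N : Msg (combine T)} (h : KeptArg i M N) : Subterm N M := by
  obtain ⟨f, -, ts, rfl, j, rfl⟩ := h
  exact .arg f ts j (.refl _)

theorem KeptArg.ab {M N : Msg (combine T)} (h : KeptArg i M N) :
    ∃ g us j, G.ab i M = .app g us ∧ us j = G.ab i N := by
  obtain ⟨f, hf, ts, rfl, j, rfl⟩ := h
  obtain ⟨g, hg, he⟩ := Dag.ab_kept (G := G) hf ts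
  exact ⟨g, _, Fin.cast hg.symm j, he, rfl⟩

theorem Dag.subterm_ab {X Y : Msg (T i)} (h : Subterm X Y) :
    ∀ {M}, G.ab i M = Y → ∃ N, Subterm N M ∧ G.ab i N = X := by
  induction h with
  | refl => exact fun {M} h => ⟨M, .refl _, h⟩
  | arg f ts j _ ih =>
    intro M hM
    obtain ⟨N, hN, hN'⟩ := Dag.ab_eq_app hM j
    obtain ⟨K, hK, hK'⟩ := ih hN'
    exact ⟨K, hK.trans hN.subterm, hK'⟩

theorem Dag.ab_sign (A B : Msg (combine T)) : G.ab i (sign A B) = sign (G.ab i A) (G.ab i B) :=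
  congrArg (conApp .sign) (map_vec₂ (rfl : 2 = 2) (G.ab i) A B)

theorem sign_inj {T : Theory} {A B C D : Msg T} (h : sign A B = sign C D) : A = C ∧ B = D := by
  injection h with _ h
  exact ⟨congrFun h (0 : Fin 2), congrFun h (1 : Fin 2)⟩

theorem Dag.ab_eq_sign {M : Msg (combine T)} {X Y : Msg (T i)} (h : G.ab i M = sign X Y) :
    ∃ A B, M = sign A B ∧ G.ab i A = X ∧ G.ab i B = Y := by
  cases M with
  | leaf a => simp [Dag.ab, abs, sign] at h
  | app f ts =>
    cases f with
    | inl c =>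
      have hc : c = .sign := by
        have : (.app (.inl c) (fun j => G.ab i (ts j)) : Msg (T i)) = sign X Y := h
        rw [sign] at this
        injection this with h₁
        injection h₁
      subst hc
      have hs : (.app (.inl .sign) ts : Msg (combine T)) = sign (ts (0 : Fin 2)) (ts (1 : Fin 2)) := by
        rw [sign]
        congr 1
        funext j
        change Fin 2 at j
        fin_cases j <;> rfl
      rw [hs, Dag.ab_sign] at h
      exact ⟨_, _, hs, sign_inj h⟩
    | inr f =>
      by_cases hf : f.1 = i
      · obtain ⟨j, f⟩ := f
        obtain rfl : j = i := hf
        have : opApp f (fun k => G.ab j (ts k)) = sign X Y := (abs_own f ts).symm.trans h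
        rw [sign, opApp] at this
        injection this with h₁
        cases h₁
      · simp [Dag.ab, abs_alien hf, sign] at h

variable (G i) {S : Set (Msg (combine T))} {K : Msg (combine T)}

theorem Dag.pst_query (hS : ∀ N ∈ S, N ∈ G.nodes) (hK : K ∈ G.nodes) {X : Msg (T i)}
    (hX : X ∈ pst (G.ab i '' S ∪ {G.ab i K})) : ∃ N ∈ pst (Γ ∪ {P}), G.ab i N = X := by
  obtain ⟨Y, hY, hXY, hne⟩ := hX
  obtain ⟨M, hM, rfl⟩ : ∃ M ∈ G.nodes, G.ab i M = Y := by
    rcases hY with ⟨M, hM, rfl⟩ | rfl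
    exacts [⟨M, hS M hM, rfl⟩, ⟨K, hK, rfl⟩]
  obtain ⟨N, hN, rfl⟩ := Dag.subterm_ab hXY rfl
  exact ⟨N, pst_of_st ((G.mem_nodes _).1 hM) hN (by rintro rfl; exact hne rfl), rfl⟩

/-- The saturated set of a query is covered by the given nodes. For a signature of two proper
subterms, both lift to proper subterms of the sequent, whose signature is a node by the definition
of `St`. -/
theorem Dag.st_query (hS : ∀ N ∈ S, N ∈ G.nodes) (hK : K ∈ G.nodes) {X : Msg (T i)}
    (hX : X ∈ St (G.ab i '' S ∪ {G.ab i K})) : ∃ N ∈ G.nodes, G.ab i N = X := by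
  rcases hX with ((⟨M, hM, rfl⟩ | rfl) | hX) | ⟨X, hX, Y, hY, rfl⟩
  · exact ⟨M, hS M hM, rfl⟩
  · exact ⟨K, hK, rfl⟩
  · obtain ⟨N, hN, rfl⟩ := G.pst_query i hS hK hX
    exact ⟨N, (G.mem_nodes _).2 (.inl (.inr hN)), rfl⟩
  · obtain ⟨A, hA, rfl⟩ := G.pst_query i hS hK hX
    obtain ⟨B, hB, rfl⟩ := G.pst_query i hS hK hY
    exact ⟨sign A B, (G.mem_nodes _).2 (.inr ⟨A, hA, B, hB, rfl⟩), Dag.ab_sign A B⟩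

open Classical in
/-- The address of a node of a query: that of the first node with this abstraction. -/
noncomputable def Dag.queryAddr (X : Msg (T i)) : ℕ :=
  ((G.nodes.find? fun N => decide (G.ab i N = X)).map G.addr).getD 0

variable {G} in
theorem Dag.queryAddr_ab {N : Msg (combine T)} (hN : N ∈ G.nodes) :
    G.queryAddr i (G.ab i N) = G.addr (rep (G.Same i) G.nodes N) := by
  classical
  rw [Dag.queryAddr, (find?_eq_rep (G.same_equivalence i) hN (by simp [Dag.Same])).1]
  rfl

/-- The nodes whose abstractions are the nodes of a query. -/
def Dag.InQuery (S : Set (Msg (combine T))) (K N : Msg (combine T)) : Prop :=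
  G.ab i N ∈ St (G.ab i '' S ∪ {G.ab i K}) ∧ rep (G.Same i) G.nodes N = N

open Classical in
/-- The DAG of the query for the theory `i` on `S ⊢ K`. -/
noncomputable def Dag.query (hS : ∀ N ∈ S, N ∈ G.nodes) (hK : K ∈ G.nodes) :
    Dag (G.ab i '' S) (G.ab i K) where
  nodes := (G.nodes.filter (G.InQuery i S K)).map (G.ab i)
  nodup := by
    refine List.Nodup.map_on ?_ (G.nodup.filter _)
    intro M hM N hN h
    simp only [List.mem_filter, decide_eq_true_eq] at hM hN
    rw [← hM.2.2, ← hN.2.2]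
    exact rep_congr (G.same_equivalence i) hM.1 hN.1 h
  mem_nodes X := by
    simp only [List.mem_map, List.mem_filter, decide_eq_true_eq]
    constructor
    · rintro ⟨N, hN, rfl⟩
      exact hN.2.1
    · intro hX
      obtain ⟨N, hN, rfl⟩ := G.st_query i hS hK hX
      have h := rel_rep (G.same_equivalence i) hN
      exact ⟨_, ⟨rep_mem (G.same_equivalence i) hN, h.symm ▸ hX,
        rep_rep (G.same_equivalence i) hN⟩, h⟩
  sorted l₁ g us l₂ h j := by
    obtain ⟨a, b, hab, rfl, hb⟩ := List.map_eq_append_iff.1 h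
    obtain ⟨M, b', rfl, hM, rfl⟩ := List.map_eq_cons_iff.1 hb
    obtain ⟨c, d, hcd, rfl, hd⟩ := List.filter_eq_append_iff.1 hab
    obtain ⟨e, d', rfl, he, hMq, rfl⟩ := List.filter_eq_cons_iff.1 hd
    rw [← List.append_assoc] at hcd
    simp only [decide_eq_true_eq] at hMq he
    obtain ⟨N, hN, hNj⟩ := Dag.ab_eq_app hM j
    obtain ⟨f, hf, ts, rfl, k, rfl⟩ := hN
    have hk := G.sorted _ _ _ _ hcd k
    have hkG : ts k ∈ G.nodes := by rw [hcd]; exact List.mem_append_left _ hk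
    have hr := rel_rep (G.same_equivalence i) hkG
    -- The child may be represented by a different node, but that one comes no later than the child
    -- and thus still before the parent.
    have hmem := rep_mem_prefix (l₂ := .app f ts :: d') hk (G.same_equivalence i)
    rw [← hcd] at hmem
    have hrr := rep_rep (G.same_equivalence i) hkG
    have hin : G.InQuery i S K (rep (G.Same i) G.nodes (ts k)) := by
      refine ⟨?_, hrr⟩
      rw [show G.ab i (rep (G.Same i) G.nodes (ts k)) = us j from Eq.trans hr hNj]
      exact .inl (.inr (arg_mem_pst (hM ▸ hMq.1) j))
    rcases List.mem_append.1 hmem with hmem | hmem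
    · exact List.mem_map.2 ⟨_, List.mem_filter.2 ⟨hmem, by simpa using hin⟩, Eq.trans hr hNj⟩
    · exact absurd hin (he _ hmem)
  addr := G.queryAddr i
  addr_injOn := by
    intro X hX Y hY h
    simp only [Set.mem_ofPred_eq, List.mem_map, List.mem_filter] at hX hY
    obtain ⟨M, hM, rfl⟩ := hX
    obtain ⟨N, hN, rfl⟩ := hY
    rw [Dag.queryAddr_ab i hM.1, Dag.queryAddr_ab i hN.1,
      G.addr_inj (rep_mem (G.same_equivalence i) hM.1) (rep_mem (G.same_equivalence i) hN.1),
      rep_eq_iff (G.same_equivalence i) hM.1 hN.1] at h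
    exact h

/-- The nodes of the query are listed by a sublist of the given nodes. With monotonicity of the time
bound, one oracle call is no dearer than a call at the size of the sequent. -/
theorem Dag.query_size (hS : ∀ N ∈ S, N ∈ G.nodes) (hK : K ∈ G.nodes) :
    size (G.ab i '' S) (G.ab i K) ≤ size Γ P := by
  rw [(G.query i hS hK).size_eq, G.size_eq]
  simpa [Dag.query] using List.length_filter_le _ _

open Classical in
/-- The input of the program for the theory `i` for the query `S ⊢ K`. -/
noncomputable def Dag.queryTree (S : Set (Msg (combine T))) (K : Msg (combine T)) : Tree :=
  Tree.ofList ((G.nodes.filter (G.InQuery i S K)).map fun N =>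
    .cons (.atom (G.queryAddr i (G.ab i N)))
      (.cons (.cons (bit (G.ab i N ∈ G.ab i '' S)) (bit (G.ab i N = G.ab i K)))
        (nodeTree (G.queryAddr i) (G.ab i N))))

theorem Dag.query_tree (hS : ∀ N ∈ S, N ∈ G.nodes) (hK : K ∈ G.nodes) :
    (G.query i hS hK).tree = G.queryTree i S K := by
  simp only [Dag.tree, Dag.query, Dag.queryTree, List.map_map]
  rfl

/-- One round of the computation of the subterms of the abstractions of the elements of `W`. -/
def Dag.visible (W : Set (Msg (combine T))) : Set (Msg (combine T)) :=
  {N | N ∈ G.nodes ∧ (N ∈ W ∨ ∃ M ∈ W, M ∈ G.nodes ∧ (G.Same i M N ∨ KeptArg i M N))}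

/-- Besides descending to visible arguments, a round passes to all nodes with the same abstraction,
because the subterm relation in question is that of the abstractions. -/
theorem Dag.mem_visible_iff (hS : ∀ N ∈ S, N ∈ G.nodes) {N : Msg (combine T)} (hN : N ∈ G.nodes) :
    N ∈ (G.visible i)^[G.nodes.length] S ↔ ∃ Y ∈ G.ab i '' S, Subterm (G.ab i N) Y := by
  have hsub : ∀ W ⊆ {N | N ∈ G.nodes}, W ⊆ G.visible i W ∧ G.visible i W ⊆ {N | N ∈ G.nodes} :=
    fun W hW => ⟨fun N hN => ⟨hW hN, .inl hN⟩, fun N hN => hN.1⟩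
  constructor
  · have key : ∀ t, ∀ N ∈ (G.visible i)^[t] S, ∃ Y ∈ G.ab i '' S, Subterm (G.ab i N) Y := by
      intro t
      induction t with
      | zero => exact fun N hN => ⟨_, ⟨N, hN, rfl⟩, .refl _⟩
      | succ t ih =>
        rw [Function.iterate_succ_apply']
        rintro N ⟨-, hN | ⟨M, hM, -, hMN | hMN⟩⟩
        · exact ih N hN
        · rw [← show G.ab i M = G.ab i N from hMN]
          exact ih M hM
        · obtain ⟨Y, hY, h⟩ := ih M hM
          obtain ⟨g, us, j, h₁, h₂⟩ := hMN.ab (G := G)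
          exact ⟨Y, hY, .trans (h₁ ▸ h₂ ▸ .arg g us j (.refl _)) h⟩
    exact fun h => key _ N h
  · have hfix := iterate_fixed (List.finite_toSet G.nodes) hsub (S := S) hS
      (m := G.nodes.length) (by
        classical
        rw [← List.coe_toFinset, Set.ncard_coe_finset]
        exact List.toFinset_card_le _)
    set W := (G.visible i)^[G.nodes.length] S with hW
    have hSW : S ⊆ W := by
      have : ∀ t, S ⊆ (G.visible i)^[t] S := fun t => by
        induction t with
        | zero => exact subset_rfl
        | succ t ih =>
          rw [Function.iterate_succ_apply']
          exact fun N hN => ⟨hS N hN, .inl (ih hN)⟩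
      exact this _
    have hWn : ∀ N ∈ W, N ∈ G.nodes := fun N hN => by
      rw [← hfix] at hN; exact hN.1
    rintro ⟨_, ⟨M, hM, rfl⟩, h⟩
    have key : ∀ X Y : Msg (T i), Subterm X Y → ∀ M ∈ W, G.ab i M = Y →
        ∀ N ∈ G.nodes, G.ab i N = X → N ∈ W := by
      intro X Y h
      induction h with
      | refl X =>
        intro M hM hMX N hN hNX
        rw [← hfix]
        exact ⟨hN, .inr ⟨M, hM, hWn M hM, .inl (hMX.trans hNX.symm)⟩⟩
      | arg f ts j _ ih =>
        intro M hM hMX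
        obtain ⟨L, hL, hLj⟩ := Dag.ab_eq_app hMX j
        refine ih L ?_ hLj
        rw [← hfix]
        exact ⟨G.subterm_mem (hWn M hM) hL.subterm, .inr ⟨M, hM, hWn M hM, .inr hL⟩⟩
    exact key _ _ h M (hSW hM) rfl N hN rfl

/-- `N` represents a proper subterm of the abstraction of an element of `S`. -/
def Dag.VisiblePst (S : Set (Msg (combine T))) (N : Msg (combine T)) : Prop :=
  ∃ M ∈ (G.visible i)^[G.nodes.length] S, ∃ L ∈ G.nodes, KeptArg i M L ∧ G.Same i L N

/-- Properness is expressed by one explicit step to an argument, which can be read off the nodes. -/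
theorem mem_pst_iff_arg {T : Theory} {U : Set (Msg T)} {N : Msg T} :
    N ∈ pst U ↔ ∃ M ∈ U, ∃ f ts j, Subterm (.app f ts) M ∧ ts j = N := by
  constructor
  · rintro ⟨M, hM, h, hne⟩
    refine ⟨M, hM, ?_⟩
    clear hM
    induction h with
    | refl => exact absurd rfl hne
    | @arg f ts j N h ih =>
      by_cases hj : N = ts j
      · exact ⟨f, ts, j, .refl _, hj.symm⟩
      · obtain ⟨f', ts', j', h₁, h₂⟩ := ih hj
        exact ⟨f', ts', j', .arg f ts j h₁, h₂⟩
  · rintro ⟨M, hM, f, ts, j, h, rfl⟩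
    refine ⟨M, hM, .trans (.arg f ts j (.refl _)) h, ?_⟩
    rintro rfl
    exact arg_ne_app ts j (subterm_antisymm (.arg f ts j (.refl _)) h)

theorem Dag.mem_of_visible (hS : ∀ N ∈ S, N ∈ G.nodes) (t : ℕ) :
    ∀ N ∈ (G.visible i)^[t] S, N ∈ G.nodes := by
  cases t with
  | zero => exact hS
  | succ t =>
    rw [Function.iterate_succ_apply']
    exact fun N hN => hN.1

theorem Dag.visiblePst_iff (hS : ∀ N ∈ S, N ∈ G.nodes) {N : Msg (combine T)} :
    G.VisiblePst i S N ↔ G.ab i N ∈ pst (G.ab i '' S) := by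
  have hn := fun t => G.mem_of_visible i hS t
  rw [mem_pst_iff_arg]
  constructor
  · rintro ⟨M, hM, L, -, hL, hLN⟩
    obtain ⟨Y, hY, h⟩ := (G.mem_visible_iff i hS (hn _ M hM)).1 hM
    obtain ⟨g, us, j, h₁, h₂⟩ := hL.ab (G := G)
    exact ⟨Y, hY, g, us, j, h₁ ▸ h, h₂.trans hLN⟩
  · rintro ⟨_, ⟨M, hM, rfl⟩, f, ts, j, h, hN⟩
    obtain ⟨L, hL, hLf⟩ := Dag.subterm_ab h rfl
    have hLn := G.subterm_mem (hS M hM) hL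
    obtain ⟨L', hL', hLj⟩ := Dag.ab_eq_app hLf j
    exact ⟨L, (G.mem_visible_iff i hS hLn).2 ⟨_, ⟨M, hM, rfl⟩, hLf ▸ h⟩, L',
      G.subterm_mem hLn hL'.subterm, hL', hLj.trans hN⟩

/-- The abstracted messages disappear from the condition, which becomes a search among the given
nodes. In the last case, a message whose abstraction is a signature is a signature itself. -/
theorem Dag.mem_st_query_iff (hS : ∀ N ∈ S, N ∈ G.nodes) (hK : K ∈ G.nodes)
    {N : Msg (combine T)} (hN : N ∈ G.nodes) :
    G.ab i N ∈ St (G.ab i '' S ∪ {G.ab i K}) ↔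
      (∃ M ∈ S, G.Same i M N) ∨ G.Same i K N ∨ G.VisiblePst i (S ∪ {K}) N ∨
        ∃ A ∈ G.nodes, ∃ B ∈ G.nodes, N = sign A B ∧ G.VisiblePst i (S ∪ {K}) A ∧
          G.VisiblePst i (S ∪ {K}) B := by
  have hU : G.ab i '' (S ∪ {K}) = G.ab i '' S ∪ {G.ab i K} := by
    rw [Set.image_union, Set.image_singleton]
  have hSK : ∀ N ∈ S ∪ {K}, N ∈ G.nodes := by
    rintro N (hN | rfl)
    exacts [hS N hN, hK]
  simp only [G.visiblePst_iff i hSK, hU]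
  constructor
  · rintro (((⟨M, hM, h⟩ | h) | h) | ⟨X, hX, Y, hY, h⟩)
    · exact .inl ⟨M, hM, h⟩
    · exact .inr (.inl h.symm)
    · exact .inr (.inr (.inl h))
    · obtain ⟨A, B, rfl, rfl, rfl⟩ := Dag.ab_eq_sign h
      exact .inr (.inr (.inr ⟨A, G.arg_mem hN (0 : Fin 2), B, G.arg_mem hN (1 : Fin 2), rfl,
        hX, hY⟩))
  · rintro (⟨M, hM, h⟩ | h | h | ⟨A, hA, B, hB, rfl, hAp, hBp⟩)
    · exact .inl (.inl (.inl ⟨M, hM, h⟩))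
    · exact .inl (.inl (.inr h.symm))
    · exact .inl (.inr h)
    · exact .inr ⟨_, hAp, _, hBp, Dag.ab_sign A B⟩

theorem Dag.node_normal (hcomb : (combine T).ACConvergent) (hΓ : ∀ N ∈ Γ, Normal N)
    (hP : Normal P) {N : Msg (combine T)} (hN : N ∈ G.nodes) : Normal N := by
  have hU : ∀ N ∈ Γ ∪ {P}, Normal N := by
    rintro N (hN | rfl)
    exacts [hΓ N hN, hP]
  have hp : ∀ N ∈ pst (Γ ∪ {P}), Normal N := fun N ⟨M, hM, h, _⟩ => (hU M hM).subterm h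
  rcases (G.mem_nodes N).1 hN with (hN | hN) | ⟨A, hA, B, hB, rfl⟩
  · exact hU N hN
  · exact hp N hN
  · exact hcomb.normal_con (c := .sign)
      ((forall_bin rfl A B Normal).2 ⟨hp A hA, hp B hB⟩)

/-- Addresses of first AC-equal nodes serve as the names for aliens; `nodeAt` reads them back modulo
AC. -/
theorem Dag.direct_iff (hconv : ∀ i, (T i).ACConvergent) (hcomb : (combine T).ACConvergent)
    (hΓ : ∀ N ∈ Γ, Normal N) (hP : Normal P) (hS : ∀ N ∈ S, N ∈ G.nodes) (hK : K ∈ G.nodes) :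
    Direct i S K ↔ Elem (G.ab i '' S) (G.ab i K) :=
  direct_iff_elem (τ := G.nodeAt) hconv hcomb G.nu_congr
    (fun N hN => G.node_normal hcomb hΓ hP (hS N hN)) (G.node_normal hcomb hΓ hP hK)
    (fun N hN _ h => G.nodeAt_nu (G.subterm_mem (hS N hN) h))
    (fun _ h => G.nodeAt_nu (G.subterm_mem hK h))

theorem Dag.ab_normal (hcomb : (combine T).ACConvergent)
    (hΓ : ∀ N ∈ Γ, Normal N) (hP : Normal P) (hK : K ∈ G.nodes) : Normal (G.ab i K) :=
  Normal.abs (τ := G.nodeAt) (G.node_normal hcomb hΓ hP hK)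
    fun _ h => G.nodeAt_nu (G.subterm_mem hK h)

end Query

end Intruder
namespace Intruder

open Intruder.Tree (ofList)

/-! ### Nodes, sets of nodes and tables -/

section Nodes

variable {n : ℕ} {T : Fin n → Theory}

/-- The entry of a node in the input. -/
noncomputable def Dag.entry {T : Theory} {Γ : Set (Msg T)} {P : Msg T} (G : Dag Γ P) (N : Msg T) :
    Tree :=
  .cons (.atom (G.addr N)) (.cons (.cons (bit (N ∈ Γ)) (bit (N = P))) (nodeTree G.addr N))

/-- An instance of the deduction problem for the combined theory, with oracle programs that
answer all queries arising from it. -/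
structure Instance (T : Fin n → Theory) where
  mach : Machine n
  hyps : Set (Msg (combine T))
  goal : Msg (combine T)
  dag : Dag hyps goal
  hyps_normal : ∀ N ∈ hyps, Normal N
  goal_normal : Normal goal
  size_eq : mach.size = size hyps goal
  oracle_spec : ∀ i S K, (∀ N ∈ S, N ∈ dag.nodes) → K ∈ dag.nodes →
    ∃ t ≤ mach.cost, Runs (mach.oracle i) (dag.queryTree i S K)
      (bit (Elem (dag.ab i '' S) (dag.ab i K))) t

noncomputable abbrev instances (T : Fin n → Theory) : Setup n where
  Inst := Instance T
  mach := Instance.mach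
  root I := I.dag.tree

variable {α β γ : Type}

abbrev Env.I (E : Env (instances T) α) (a : α) : Instance T := E.inst a

abbrev Env.nodes (E : Env (instances T) α) (a : α) : List (Msg (combine T)) := (E.I a).dag.nodes

noncomputable abbrev Env.entry (E : Env (instances T) α) (a : α) (N : Msg (combine T)) : Tree :=
  (E.I a).dag.entry N

/-- The nodes `N a` can be computed. -/
structure CmpN (E : Env (instances T) α) (N : α → Msg (combine T)) : Prop where
  cmp : Cmp E (fun a => E.entry a (N a))
  mem : ∀ a, E.valid a → N a ∈ E.nodes a

variable {E : Env (instances T) α} {N K : α → Msg (combine T)}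

theorem cmp_nodes : Cmp E (fun a => ofList ((E.nodes a).map (E.entry a))) := Cmp.root

theorem length_nodes (a : α) : (E.nodes a).length = (E.mach a).size :=
  ((E.I a).size_eq.trans (E.I a).dag.size_eq).symm

theorem lenBdd_nodes : LenBdd E E.nodes :=
  ⟨1, 1, fun a _ => by rw [length_nodes]; simp⟩

/-- The environment extended by a node. -/
noncomputable def Env.node (E : Env (instances T) α) : Env (instances T) (α × Msg (combine T)) :=
  E.bind (fun a N => N ∈ E.nodes a) E.entry

theorem CmpN.weaken {Q : α → γ → Prop} {v : α → γ → Tree} (h : CmpN E N) :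
    CmpN (E.bind Q v) (fun p => N p.1) := ⟨Cmp.weaken h.cmp, fun p hp => h.mem p.1 hp.1⟩

theorem CmpN.assume {q : α → Prop} (h : CmpN E N) : CmpN (E.assume q) N :=
  ⟨Cmp.assume h.cmp, fun a ha => h.mem a ha.1⟩

theorem CmpN.top : CmpN E.node (fun p => p.2) := ⟨Cmp.top, fun _ hp => hp.2⟩

theorem CmpN.node (h : CmpN E N) : CmpN E.node (fun p => N p.1) := h.weaken

theorem CmpP.exists_node {p : α → Msg (combine T) → Prop}
    (hp : CmpP E.node (fun q => p q.1 q.2)) : CmpP E (fun a => ∃ N ∈ E.nodes a, p a N) :=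
  CmpP.exists_mem cmp_nodes lenBdd_nodes hp

theorem CmpN.addr (h : CmpN E N) : Cmp E (fun a => .atom ((E.I a).dag.addr (N a))) := h.cmp.fst

theorem CmpN.eq (hN : CmpN E N) (hK : CmpN E K) : CmpP E (fun a => N a = K a) :=
  (CmpP.eqAtoms hN.addr hK.addr).congr fun a ha =>
    (E.I a).dag.addr_inj (hN.mem a ha) (hK.mem a ha)

theorem CmpN.is_hyp (h : CmpN E N) : CmpP E (fun a => N a ∈ (E.I a).hyps) := h.cmp.snd.fst.fst

theorem CmpN.is_goal (h : CmpN E N) : CmpP E (fun a => N a = (E.I a).goal) := h.cmp.snd.fst.snd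

theorem CmpN.tree (h : CmpN E N) : Cmp E (fun a => nodeTree (E.I a).dag.addr (N a)) :=
  h.cmp.snd.snd

/-- The entry of a node is retrieved by searching the input list for its address. Links from a node
to its children are followed in this way. -/
theorem CmpN.of_addr (h : Cmp E (fun a => .atom ((E.I a).dag.addr (N a))))
    (hmem : ∀ a, E.valid a → N a ∈ E.nodes a) : CmpN E N :=
  ⟨Cmp.find (p := fun a x => (E.I a).dag.addr x = (E.I a).dag.addr (N a)) cmp_nodes lenBdd_nodes
    (CmpP.eqAtoms CmpN.top.addr (Cmp.weaken h)) Cmp.top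
    (fun a ha x hx hp => by rw [((E.I a).dag.addr_inj hx (hmem a ha)).1 hp])
    (fun a ha => ⟨N a, hmem a ha, rfl⟩), hmem⟩

theorem CmpN.goal : CmpN E (fun a => (E.I a).goal) :=
  ⟨Cmp.find (p := fun a x => x = (E.I a).goal) cmp_nodes lenBdd_nodes CmpN.top.is_goal Cmp.top
    (fun a _ x _ hp => by rw [hp]) (fun a _ => ⟨_, (E.I a).dag.goal_mem, rfl⟩),
    fun a _ => (E.I a).dag.goal_mem⟩

theorem CmpP.const (p : Prop) : CmpP E (fun _ => p) := by
  by_cases h : p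
  · exact CmpP.true.congr fun _ _ => by simp [h]
  · exact CmpP.false.congr fun _ _ => by simp [h]

/-! ### Labels and children -/

section Label

variable {T : Theory}

theorem Con.code_injective : Function.Injective Con.code := by
  intro c d h
  cases c <;> cases d <;> simp_all [Con.code]

instance : Finite Con := Finite.of_injective (fun c : Con => (⟨c.code, by cases c <;> decide⟩ : Fin 5))
  fun _ _ h => Con.code_injective (by simpa using h)

instance : Finite (Con ⊕ T.Op) := by
  have := T.finite
  infer_instance

def symKind : Con ⊕ T.Op → ℕ
  | .inl _ => 1
  | .inr _ => 2

def symCode : Con ⊕ T.Op → ℕ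
  | .inl c => c.code
  | .inr f => T.code f

theorem sym_ext {f g : Con ⊕ T.Op} (h : symKind f = symKind g) (h' : symCode f = symCode g) :
    f = g := by
  cases f <;> cases g <;> simp [symKind] at h
  · rw [Con.code_injective h']
  · rw [T.code_injective h']

/-- The message is headed by `f`. -/
def IsApp (f : Con ⊕ T.Op) (N : Msg T) : Prop := ∃ ts, N = .app f ts

open Classical in
/-- The `j`-th argument of a message that is headed by `f`. -/
noncomputable def argD (f : Con ⊕ T.Op) (j : Fin (T.msgArity f)) (N : Msg T) : Msg T :=
  if h : IsApp f N then h.choose j else .leaf 0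

@[simp] theorem argD_app {f : Con ⊕ T.Op} {j : Fin (T.msgArity f)} {ts} :
    argD f j (.app f ts) = ts j := by
  have h : IsApp f (.app f ts : Msg T) := ⟨ts, rfl⟩
  rw [argD, dif_pos h]
  have := h.choose_spec
  injection this with _ this
  exact (congrFun this j).symm

@[simp] theorem isApp_app {f g : Con ⊕ T.Op} {ts} : IsApp g (.app f ts : Msg T) ↔ f = g := by
  constructor
  · rintro ⟨us, h⟩
    injection h
  · rintro rfl
    exact ⟨ts, rfl⟩

@[simp] theorem not_isApp_leaf {f : Con ⊕ T.Op} {a : ℕ} : ¬ IsApp f (.leaf a : Msg T) := by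
  rintro ⟨us, h⟩
  cases h

theorem IsApp.eq {f : Con ⊕ T.Op} {N : Msg T} (h : IsApp f N) :
    N = .app f fun j => argD f j N := by
  obtain ⟨ts, rfl⟩ := h
  simp

theorem nodeTree_app (addr : Msg T → ℕ) (f : Con ⊕ T.Op) (ts : Fin (T.msgArity f) → Msg T) :
    nodeTree addr (.app f ts) = .cons (.cons (.atom (symKind f)) (.atom (symCode f)))
      (ofList (List.ofFn fun j => .atom (addr (ts j)))) := by
  cases f <;> rfl

/-- The kind and the code of the label, and the children. -/
theorem nodeTree_eq (addr : Msg T → ℕ) (N : Msg T) :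
    ∃ k c t, nodeTree addr N = .cons (.cons (.atom k) (.atom c)) t ∧
      ∀ f, IsApp f N ↔ k = symKind f ∧ c = symCode f := by
  cases N with
  | leaf a => exact ⟨0, a, _, rfl, fun f => by cases f <;> simp [symKind]⟩
  | app g ts =>
    refine ⟨_, _, _, nodeTree_app addr g ts, fun f => ?_⟩
    rw [isApp_app]
    exact ⟨by rintro rfl; simp, fun h => sym_ext h.1 h.2⟩

end Label

theorem Cmp.nth {E : Env (instances T) α} {k : ℕ} (j : Fin k) :
    ∀ {v : α → Fin k → Tree}, Cmp E (fun a => ofList (List.ofFn (v a))) →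
      Cmp E (fun a => v a j) := by
  induction k with
  | zero => exact j.elim0
  | succ k ih =>
    intro v h
    simp only [List.ofFn_succ, ofList] at h
    cases j using Fin.cases with
    | zero => exact h.fst
    | succ j => exact ih j h.snd

theorem Cmp.ofFn {k : ℕ} : ∀ {v : α → Fin k → Tree}, (∀ j, Cmp E (fun a => v a j)) →
    Cmp E (fun a => ofList (List.ofFn (v a))) := by
  induction k with
  | zero => exact fun _ => by simpa [ofList] using Cmp.atom 0
  | succ k ih =>
    intro v h
    simp only [List.ofFn_succ, ofList]
    exact (h 0).cons (ih fun j => h j.succ)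

theorem CmpN.isApp (h : CmpN E N) (f : Con ⊕ (combine T).Op) : CmpP E (fun a => IsApp f (N a)) := by
  choose k c t h₁ h₂ using fun a => nodeTree_eq (E.I a).dag.addr (N a)
  have h' := h.tree
  simp only [h₁] at h'
  exact ((CmpP.eqAtoms h'.fst.fst (.atom _)).and (CmpP.eqAtoms h'.fst.snd (.atom _))).congr
    fun a _ => (h₂ a f).symm

theorem argD_mem {f : Con ⊕ (combine T).Op} {j} {a : α} {M : Msg (combine T)}
    (hN : M ∈ E.nodes a) (hf : IsApp f M) : argD f j M ∈ E.nodes a := by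
  obtain ⟨ts, rfl⟩ := hf
  rw [argD_app]
  exact (E.I a).dag.arg_mem hN j

theorem CmpN.argD (h : CmpN E N) {f : Con ⊕ (combine T).Op} (hf : ∀ a, E.valid a → IsApp f (N a))
    (j) : CmpN E (fun a => argD f j (N a)) := by
  refine CmpN.of_addr ?_ fun a ha => argD_mem (h.mem a ha) (hf a ha)
  have h' : Cmp E (fun a => .cons (.cons (.atom (symKind f)) (.atom (symCode f)))
      (ofList (List.ofFn fun j => .atom ((E.I a).dag.addr (Intruder.argD f j (N a)))))) := by
    refine Cmp.congr h.tree fun a ha => ?_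
    conv_lhs => rw [(hf a ha).eq]
    rw [nodeTree_app]
  exact Cmp.nth j h'.snd

theorem CmpP.and_isApp {f : Con ⊕ (combine T).Op} {q : α → Prop} (h : CmpN E N)
    (hq : CmpP (E.assume fun a => IsApp f (N a)) q) : CmpP E (fun a => IsApp f (N a) ∧ q a) :=
  (h.isApp f).and' hq

/-- `K` is the `j`-th argument of `N`. -/
theorem CmpN.arg_eq (hN : CmpN E N) (hK : CmpN E K) (f : Con ⊕ (combine T).Op) (j) :
    CmpP E (fun a => IsApp f (N a) ∧ Intruder.argD f j (N a) = K a) :=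
  .and_isApp hN ((hN.assume.argD (fun _ h => h.2) j).eq hK.assume)

theorem CmpN.eq_app {f : Con ⊕ (combine T).Op} {ts : α → Fin ((combine T).msgArity f) →
    Msg (combine T)} (hN : CmpN E N) (hts : ∀ j, CmpN E (fun a => ts a j)) :
    CmpP E (fun a => N a = .app f (ts a)) := by
  refine ((hN.isApp f).and (CmpP.forall_finite fun j => hN.arg_eq (hts j) f j)).congr fun a _ => ?_
  constructor
  · rintro ⟨h, h'⟩
    rw [h.eq]
    congr 1
    funext j
    exact (h' j).2
  · intro h
    rw [h]
    exact ⟨⟨_, rfl⟩, fun j => ⟨⟨_, rfl⟩, argD_app⟩⟩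

theorem exists_app_iff {T : Theory} {f : Con ⊕ T.Op} {M N : Msg T} :
    (∃ ts, M = .app f ts ∧ ∃ j, ts j = N) ↔ ∃ j, IsApp f M ∧ argD f j M = N := by
  constructor
  · rintro ⟨ts, rfl, j, rfl⟩
    exact ⟨j, ⟨ts, rfl⟩, argD_app⟩
  · rintro ⟨j, ⟨ts, rfl⟩, h⟩
    exact ⟨ts, rfl, j, by simpa using h⟩

theorem CmpN.keptArg (i : Fin n) (hN : CmpN E N) (hK : CmpN E K) :
    CmpP E (fun a => KeptArg i (N a) (K a)) := by
  refine (CmpP.exists_finite fun f => (CmpP.const (Kept i f)).and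
    (CmpP.exists_finite fun j => hN.arg_eq hK f j)).congr fun a _ => ?_
  simp only [KeptArg, exists_app_iff]

/-! ### Sets of nodes -/

open Classical in
-- Elements that are not nodes leave no trace, so only sets of nodes are represented faithfully.
noncomputable def Instance.encSet (I : Instance T) (S : Set (Msg (combine T))) : Tree :=
  ofList ((I.dag.nodes.filter (· ∈ S)).map I.dag.entry)

/-- The sets `S a` of nodes can be computed. -/
def CmpS (E : Env (instances T) α) (S : α → Set (Msg (combine T))) : Prop :=
  Cmp E (fun a => (E.I a).encSet (S a))

variable {S : α → Set (Msg (combine T))}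

theorem CmpS.weaken {Q : α → γ → Prop} {v : α → γ → Tree} (h : CmpS E S) :
    CmpS (E.bind Q v) (fun p => S p.1) := Cmp.weaken h

theorem CmpS.node (h : CmpS E S) : CmpS E.node (fun p => S p.1) := h.weaken

theorem CmpS.of_mem (h : CmpP E.node (fun q => q.2 ∈ S q.1)) : CmpS E S := by
  classical
  exact Cmp.filterMap (p := fun a x => x ∈ S a) cmp_nodes lenBdd_nodes h Cmp.top

theorem CmpS.mem (h : CmpS E S) (hN : CmpN E N) : CmpP E (fun a => N a ∈ S a) := by
  classical
  refine (CmpP.exists_mem (p := fun a x => x = N a) h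
    (lenBdd_nodes.mono fun a _ => List.length_filter_le _ _) (CmpN.eq ⟨Cmp.top, ?_⟩ hN.weaken)).congr
    fun a ha => ?_
  · exact fun p hp => (List.mem_filter.1 hp.2).1
  · constructor
    · rintro ⟨x, hx, rfl⟩
      simpa using (List.mem_filter.1 hx).2
    · exact fun h => ⟨_, List.mem_filter.2 ⟨hN.mem a ha, by simpa using h⟩, rfl⟩

/-- The environment extended by a set of nodes. -/
noncomputable def Env.set (E : Env (instances T) α) :
    Env (instances T) (α × Set (Msg (combine T))) :=
  E.bind (fun _ _ => True) (fun a => (E.I a).encSet)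

theorem CmpS.top : CmpS E.set (fun p => p.2) := Cmp.top

theorem CmpS.iterate {F : α → Set (Msg (combine T)) → Set (Msg (combine T))} (h₀ : CmpS E S)
    (hF : CmpS E.set (fun p => F p.1 p.2)) :
    CmpS E (fun a => (F a)^[(E.nodes a).length] (S a)) :=
  Cmp.iterate (encS := fun a => (E.I a).encSet) cmp_nodes lenBdd_nodes h₀ hF

/-! ### Recursion on the nodes -/

/-- The values `v` of the nodes of a list. -/
noncomputable def Instance.table (I : Instance T) (v : Msg (combine T) → Tree)
    (l : List (Msg (combine T))) : Tree :=
  ofList (l.reverse.map fun N => .cons (I.dag.entry N) (v N))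

/-- The environment for the computation of the value of a node, with the values of the nodes
before it. -/
noncomputable def Env.tab (E : Env (instances T) α) (v : α → Msg (combine T) → Tree) :
    Env (instances T) (α × List (Msg (combine T)) × Msg (combine T) × List (Msg (combine T))) :=
  E.step E.nodes E.entry (fun a => (E.I a).table (v a))

variable {v : α → Msg (combine T) → Tree}

theorem cmp_tab_table : Cmp (E.tab v) (fun q => (E.I q.1).table (v q.1) q.2.1) := Cmp.step_state

theorem CmpN.tab_top : CmpN (E.tab v) (fun q => q.2.2.1) :=
  ⟨Cmp.step_elem, fun q hq => by
    change q.2.2.1 ∈ E.nodes q.1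
    rw [hq.2]; simp⟩

theorem Cmp.tab {w : α → Tree} (h : Cmp E w) : Cmp (E.tab v) (fun q => w q.1) := h.step_weaken

theorem CmpN.tab (h : CmpN E N) : CmpN (E.tab v) (fun q => N q.1) :=
  ⟨Cmp.tab h.cmp, fun q hq => h.mem q.1 hq.1⟩

theorem CmpS.tab (h : CmpS E S) : CmpS (E.tab v) (fun q => S q.1) := Cmp.tab h

theorem cmp_table (h : Cmp (E.tab v) (fun q => v q.1 q.2.2.1)) :
    Cmp E (fun a => (E.I a).table (v a) (E.nodes a)) := by
  refine Cmp.fold (fun a l => (E.I a).table (v a) l) cmp_nodes lenBdd_nodes (.atom 0) ?_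
  refine ((CmpN.tab_top.cmp.cons h).cons cmp_tab_table).congr fun q _ => ?_
  simp [Instance.table, ofList]
  rfl

theorem cmp_lookup {L : α → List (Msg (combine T))}
    (h : Cmp E (fun a => (E.I a).table (v a) (L a))) (hL : ∀ a, E.valid a → L a <+: E.nodes a)
    (hN : CmpN E N) (hmem : ∀ a, E.valid a → N a ∈ L a) : Cmp E (fun a => v a (N a)) := by
  refine Cmp.find (p := fun a x => x = N a) (h := v) h
    (lenBdd_nodes.mono fun a ha => by simpa using (hL a ha).length_le)
    (CmpN.eq ⟨Cmp.top_fst, fun p hp => ?_⟩ hN.weaken) Cmp.top_snd (fun a _ x _ hx => by rw [hx])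
    (fun a ha => ⟨N a, by simpa using hmem a ha, rfl⟩)
  exact (hL _ hp.1).subset (by simpa using hp.2)

theorem tab_prefix {q} (hq : (E.tab v).valid q) : q.2.1 <+: E.nodes q.1 :=
  ⟨q.2.2.1 :: q.2.2.2, hq.2.symm⟩

/-- Computation by recursion on the nodes. -/
theorem cmp_rec (h : Cmp (E.tab v) (fun q => v q.1 q.2.2.1)) (hN : CmpN E N) :
    Cmp E (fun a => v a (N a)) :=
  cmp_lookup (cmp_table h) (fun _ _ => List.prefix_rfl) hN hN.mem

/-- Children precede parents in the list; hence the values of the arguments are already in the table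
when a node is treated. -/
theorem argD_mem_prefix {q} (hq : (E.tab v).valid q) {f : Con ⊕ (combine T).Op}
    (hf : IsApp f q.2.2.1) (j) : argD f j q.2.2.1 ∈ q.2.1 := by
  have h := hq.2
  change E.nodes q.1 = _ at h
  rw [hf.eq] at h
  exact (E.I q.1).dag.sorted q.2.1 f _ q.2.2.2 h j

theorem subterm_mem_prefix {q} (hq : (E.tab v).valid q) {K M : Msg (combine T)} (hK : K ∈ q.2.1)
    (hM : Subterm M K) : M ∈ q.2.1 := by
  obtain ⟨a, b, hab⟩ := List.append_of_mem hK
  have h := hq.2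
  change E.nodes q.1 = _ at h
  rw [hab] at h ⊢
  cases K with
  | leaf c =>
    rw [subterm_leaf] at hM
    simp [hM]
  | app f ts =>
    rcases subterm_app.1 hM with rfl | ⟨j, hj⟩
    · simp
    · have := (E.I q.1).dag.subterm_prefix (l₂ := b ++ q.2.2.1 :: q.2.2.2) (by simpa using h) hj
      simp [this]

theorem Cmp.tab_arg {f : Con ⊕ (combine T).Op} (j) :
    Cmp ((E.tab v).assume fun q => IsApp f q.2.2.1) (fun q => v q.1 (Intruder.argD f j q.2.2.1)) :=
  cmp_lookup (E := (E.tab v).assume fun q => IsApp f q.2.2.1) (v := fun q => v q.1)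
    (L := fun q => q.2.1) cmp_tab_table.assume (fun _ hq => tab_prefix hq.1)
    (CmpN.argD CmpN.tab_top.assume (fun _ hq => hq.2) j)
    (fun _ hq => argD_mem_prefix hq.1 hq.2 j)

/-! ### Equivalence relations on nodes, decided through tables of representatives -/

section RelRec

variable {r : α → Msg (combine T) → Msg (combine T) → Prop}

/-- With representatives stored, the relation between two treated nodes is decided by comparing two
addresses. -/
noncomputable def Env.repVal (E : Env (instances T) α)
    (r : α → Msg (combine T) → Msg (combine T) → Prop) (a : α) (N : Msg (combine T)) : Tree :=
  E.entry a (rep (r a) (E.nodes a) N)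

/-- The environment for the comparison of a node with a node before it. -/
noncomputable def Env.cmpr (E : Env (instances T) α)
    (r : α → Msg (combine T) → Msg (combine T) → Prop) :
    Env (instances T) ((α × List (Msg (combine T)) × Msg (combine T) × List (Msg (combine T))) ×
      Msg (combine T)) :=
  (E.tab (E.repVal r)).bind (fun q K => K ∈ q.2.1.reverse)
    (fun q K => .cons (E.entry q.1 K) (E.repVal r q.1 K))

theorem CmpN.cmpr_left : CmpN (E.cmpr r) (fun q => q.2) :=
  ⟨Cmp.top_fst, fun q hq => (tab_prefix hq.1).subset (by simpa using hq.2)⟩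

theorem CmpN.cmpr_right : CmpN (E.cmpr r) (fun q => q.1.2.2.1) := CmpN.tab_top.weaken

theorem cmp_cmpr_table :
    Cmp (E.cmpr r) (fun q => (E.I q.1.1).table (E.repVal r q.1.1) q.1.2.1) :=
  cmp_tab_table.weaken

theorem CmpN.rep_of_table {L : α → List (Msg (combine T))} (hr : ∀ a, Equivalence (r a))
    (h : Cmp E (fun a => (E.I a).table (E.repVal r a) (L a)))
    (hL : ∀ a, E.valid a → L a <+: E.nodes a) (hN : CmpN E N) (hmem : ∀ a, E.valid a → N a ∈ L a) :
    CmpN E (fun a => rep (r a) (E.nodes a) (N a)) :=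
  ⟨cmp_lookup (v := E.repVal r) h hL hN hmem, fun a ha => rep_mem (hr a) (hN.mem a ha)⟩

theorem CmpP.rel_of_table {L : α → List (Msg (combine T))} (hr : ∀ a, Equivalence (r a))
    (h : Cmp E (fun a => (E.I a).table (E.repVal r a) (L a)))
    (hL : ∀ a, E.valid a → L a <+: E.nodes a) (hN : CmpN E N) (hmem : ∀ a, E.valid a → N a ∈ L a)
    (hK : CmpN E K) (hmem' : ∀ a, E.valid a → K a ∈ L a) : CmpP E (fun a => r a (N a) (K a)) :=
  ((CmpN.rep_of_table hr h hL hN hmem).eq (CmpN.rep_of_table hr h hL hK hmem')).congr fun a ha =>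
    rep_eq_iff (hr a) (hN.mem a ha) (hK.mem a ha)

/-- A new node is compared with the earlier ones. If some earlier node is related, its stored
representative is copied; otherwise the new node represents itself. The comparison may consult the
table of the earlier nodes, which makes the recursion possible. -/
theorem cmp_rep_table (hr : ∀ a, Equivalence (r a))
    (h : CmpP (E.cmpr r) (fun q => r q.1.1 q.2 q.1.2.2.1)) :
    Cmp (E.tab (E.repVal r)) (fun q => E.repVal r q.1 q.2.2.1) := by
  have hlen : LenBdd (E.tab (E.repVal r)) (fun q => q.2.1.reverse) :=
    (lenBdd_nodes (E := E.tab (E.repVal r))).mono fun q hq => by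
      rw [List.length_reverse]
      exact (tab_prefix hq).length_le
  refine Cmp.cond (p := fun q => ∃ K ∈ q.2.1.reverse, r q.1 K q.2.2.1)
    (x := fun q => E.repVal r q.1 q.2.2.1) (CmpP.exists_mem cmp_tab_table hlen h) ?_
    (CmpN.tab_top.cmp.assume) fun q hq => ⟨fun _ => rfl, fun hp => ?_⟩
  · obtain ⟨c, k, hlen⟩ := hlen
    refine Cmp.find (p := fun q K => r q.1 K q.2.2.1) (h := fun q K => E.repVal r q.1 K)
      cmp_tab_table.assume ⟨c, k, fun q hq => hlen q hq.1⟩ ?_ Cmp.top_snd ?_ (fun q hq => hq.2)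
    · exact CmpFrom.comp (CmpFrom.cons Cmp.root Cmp.vars : Cmp _ _)
        (CmpFrom.reindex (F := Env.bind _ _ _) id h (fun q hq => ⟨hq.1.1, hq.2⟩) fun _ _ => rfl)
    · intro q hq K hK hKN
      simp only [Env.repVal]
      rw [rep_congr (hr _) ((tab_prefix hq.1).subset (by simpa using hK)) (CmpN.tab_top.mem q hq.1) hKN]
  · have h' := hq.2
    change E.nodes q.1 = _ at h'
    simp only [Env.repVal]
    rw [h', rep_of_prefix (hr _) (by simpa using hp)]
    rfl

theorem CmpN.rep (hr : ∀ a, Equivalence (r a))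
    (h : CmpP (E.cmpr r) (fun q => r q.1.1 q.2 q.1.2.2.1)) (hN : CmpN E N) :
    CmpN E (fun a => rep (r a) (E.nodes a) (N a)) :=
  .rep_of_table hr (cmp_table (cmp_rep_table hr h)) (fun _ _ => List.prefix_rfl) hN hN.mem

theorem CmpP.rel (hr : ∀ a, Equivalence (r a))
    (h : CmpP (E.cmpr r) (fun q => r q.1.1 q.2 q.1.2.2.1)) (hN : CmpN E N) (hK : CmpN E K) :
    CmpP E (fun a => r a (N a) (K a)) :=
  .rel_of_table hr (cmp_table (cmp_rep_table hr h)) (fun _ _ => List.prefix_rfl) hN hN.mem hK hK.mem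

theorem CmpP.rel_args (hr : ∀ a, Equivalence (r a)) (f : Con ⊕ (combine T).Op) :
    CmpP (((E.cmpr r).assume fun q => IsApp f q.2).assume fun q => IsApp f q.1.2.2.1)
      (fun q => ∀ j, r q.1.1 (argD f j q.2) (argD f j q.1.2.2.1)) := by
  refine CmpP.forall_finite fun j => CmpP.rel_of_table (r := fun q => r q.1.1)
    (L := fun q => q.1.2.1) (fun q => hr q.1.1) cmp_cmpr_table.assume.assume ?_
    (CmpN.argD CmpN.cmpr_left.assume.assume ?_ j) ?_
    (CmpN.argD CmpN.cmpr_right.assume.assume ?_ j) ?_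
  · exact fun _ hq => tab_prefix hq.1.1.1
  · exact fun _ hq => hq.1.2
  · exact fun _ hq => subterm_mem_prefix hq.1.1.1 (by simpa using hq.1.1.2)
      (by obtain ⟨ts, h⟩ := hq.1.2
          rw [h, argD_app]
          exact .arg _ _ _ (.refl _))
  · exact fun _ hq => hq.2
  · exact fun _ hq => argD_mem_prefix hq.1.1.1 hq.2 j

end RelRec

end Nodes

end Intruder
namespace Intruder

open Intruder.Tree (ofList)

/-! ### Binary numbers of fixed width -/

section Bits

/-- The `w` lowest binary digits of `x`. -/
noncomputable def bits (w x : ℕ) : Tree :=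
  ofList ((List.range w).map fun j => bit (x.testBit j = true))

/-- The carry into the digit `j` in the addition of `x` and `y`. -/
def Carry (x y j : ℕ) : Prop := 2 ^ j ≤ x % 2 ^ j + y % 2 ^ j

theorem testBit_iff {x j : ℕ} : x.testBit j = true ↔ x / 2 ^ j % 2 = 1 := by
  simp [Nat.testBit_eq_decide_div_mod_eq]

theorem add_div_pow (x y j : ℕ) [Decidable (Carry x y j)] :
    (x + y) / 2 ^ j = x / 2 ^ j + y / 2 ^ j + if Carry x y j then 1 else 0 := by
  rw [Nat.add_div (by positivity)]
  congr

theorem testBit_add {x y j : ℕ} : (x + y).testBit j = true ↔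
    (x.testBit j = true ↔ (y.testBit j = true ↔ Carry x y j)) := by
  classical
  simp only [testBit_iff, add_div_pow]
  by_cases h : Carry x y j <;> simp only [h, if_true, if_false, iff_true, iff_false] <;> omega

/-- The next carry is the majority of the two digits and the current carry. -/
theorem carry_succ {x y j : ℕ} : Carry x y (j + 1) ↔
    (x.testBit j = true ∧ y.testBit j = true) ∨ (x.testBit j = true ∧ Carry x y j) ∨
      (y.testBit j = true ∧ Carry x y j) := by
  have hx := Nat.mod_lt x (show 0 < 2 ^ j by positivity)
  have hy := Nat.mod_lt y (show 0 < 2 ^ j by positivity)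
  simp only [testBit_iff]
  rw [Carry, Nat.mod_pow_succ, Nat.mod_pow_succ, pow_succ, Carry]
  rcases Nat.mod_two_eq_zero_or_one (x / 2 ^ j) with h | h <;>
    rcases Nat.mod_two_eq_zero_or_one (y / 2 ^ j) with h' | h' <;> rw [h, h'] <;> omega

theorem range_eq_append {w j : ℕ} {pre suf : List ℕ} (h : List.range w = pre ++ j :: suf) :
    j = pre.length := by
  have h₁ := congrArg (fun l => l[pre.length]?) h
  have h₂ := congrArg List.length h
  simp only [List.length_range, List.length_append, List.length_cons] at h₂
  simp only [List.getElem?_append_right le_rfl, Nat.sub_self, List.getElem?_cons_zero] at h₁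
  rw [List.getElem?_range (by omega)] at h₁
  exact (Option.some.inj h₁).symm

variable {n : ℕ} {Θ : Setup n} {α : Type} {E : Env Θ α} {w x y : α → ℕ}

/-- School addition from the lowest digit upwards, with the carry in the loop state. The last carry
is dropped, as only `w a` digits are asked for. -/
theorem cmp_bits_add (hx : Cmp E (fun a => bits (w a) (x a))) (hy : Cmp E (fun a => bits (w a) (y a)))
    (hw : LenBdd E (fun a => List.range (w a))) : Cmp E (fun a => bits (w a) (x a + y a)) := by
  have h₁ := Cmp.zip hx hy hw
  have h₂ : Cmp E (fun a => .cons (bit (Carry (x a) (y a) (List.range (w a)).length))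
      (ofList ((List.range (w a)).reverse.map fun j => bit ((x a + y a).testBit j = true)))) := by
    refine Cmp.fold (fun a l => .cons (bit (Carry (x a) (y a) l.length))
      (ofList (l.reverse.map fun j => bit ((x a + y a).testBit j = true)))) h₁ hw ?_ ?_
    · refine (Cmp.atom 0).cons (.atom 0) |>.congr fun a _ => ?_
      rw [bit_false (by simp [Carry, Nat.mod_one])]
      rfl
    · have hs := Cmp.step_state (E := E) (l := fun a => List.range (w a))
        (enc := fun a j => .cons (bit ((x a).testBit j = true)) (bit ((y a).testBit j = true)))
        (S := fun a l => .cons (bit (Carry (x a) (y a) l.length))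
          (ofList (l.reverse.map fun j => bit ((x a + y a).testBit j = true))))
      have he := Cmp.step_elem (E := E) (l := fun a => List.range (w a))
        (enc := fun a j => .cons (bit ((x a).testBit j = true)) (bit ((y a).testBit j = true)))
        (S := fun a l => .cons (bit (Carry (x a) (y a) l.length))
          (ofList (l.reverse.map fun j => bit ((x a + y a).testBit j = true))))
      have hc := CmpP.of_bit hs.fst
      have hxj := CmpP.of_bit he.fst
      have hyj := CmpP.of_bit he.snd
      refine (Cmp.cons ((hxj.and hyj).or ((hxj.and hc).or (hyj.and hc)))
        (Cmp.cons (hxj.iff (hyj.iff hc)) hs.snd)).congr fun q hq => ?_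
      have hj := range_eq_append hq.2
      simp only [List.length_append, List.length_singleton, List.reverse_append,
        List.reverse_singleton, List.singleton_append, List.map_cons, ofList]
      rw [bit_congr carry_succ, bit_congr (testBit_add (j := q.2.2.1)), ← hj]
  simpa [bits] using Cmp.reverse h₂.snd (hw.mono fun a _ => by simp)

theorem cmp_bits_eq (hx : Cmp E (fun a => bits (w a) (x a))) (hy : Cmp E (fun a => bits (w a) (y a)))
    (hw : LenBdd E (fun a => List.range (w a))) (hxw : ∀ a, E.valid a → x a < 2 ^ w a)
    (hyw : ∀ a, E.valid a → y a < 2 ^ w a) : CmpP E (fun a => x a = y a) := by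
  refine (CmpP.forall_mem (p := fun a j => (x a).testBit j = true ↔ (y a).testBit j = true)
    (Cmp.zip hx hy hw) hw (CmpP.iff Cmp.top_fst Cmp.top_snd)).congr fun a ha => ?_
  constructor
  · intro h
    refine Nat.eq_of_testBit_eq fun j => ?_
    by_cases hj : j < w a
    · exact Bool.eq_iff_iff.2 (h j (List.mem_range.2 hj))
    · have h2 : 2 ^ w a ≤ 2 ^ j := Nat.pow_le_pow_right (by norm_num) (by omega)
      rw [Nat.testBit_lt_two_pow ((hxw a ha).trans_le h2),
        Nat.testBit_lt_two_pow ((hyw a ha).trans_le h2)]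
  · intro h
    simp [h]

theorem bits_zero (w : ℕ) : bits w 0 = ofList (List.replicate w (.atom 0)) := by
  simp [bits, bit_false]

theorem bits_one (w : ℕ) : bits (w + 1) 1 = .cons (.atom 1) (ofList (List.replicate w (.atom 0))) := by
  rw [bits, List.range_succ_eq_map, List.map_cons, ofList, List.map_map]
  congr 1
  · exact bit_true (by simp)
  · congr 1
    refine List.eq_replicate_iff.2 ⟨by simp, fun b hb => ?_⟩
    obtain ⟨j, -, rfl⟩ := List.mem_map.1 hb
    exact bit_false (by simp [Nat.testBit_succ])

end Bits

/-! ### Equality modulo AC -/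

section ACNodes

variable {n : ℕ} {T : Fin n → Theory} {α : Type} {E : Env (instances T) α}
  {N K : α → Msg (combine T)}

theorem lenBdd_range : LenBdd E (fun a => List.range (E.nodes a).length) :=
  lenBdd_nodes.mono fun _ _ => by simp

theorem cmp_zeros : Cmp E (fun a => ofList (List.replicate (E.nodes a).length (.atom 0))) :=
  (Cmp.map (h := fun _ _ => .atom 0) cmp_nodes lenBdd_nodes (.atom 0)).congr fun _ _ => by
    rw [List.map_const']

theorem cmp_bits_zero : Cmp E (fun a => bits (E.nodes a).length 0) :=
  cmp_zeros.congr fun _ _ => (bits_zero _).symm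

theorem cmp_bits_one : Cmp E (fun a => bits (E.nodes a).length 1) := by
  have hlen : ∀ a, ∃ w, (E.nodes a).length = w + 1 := fun a =>
    Nat.exists_eq_succ_of_ne_zero (by rw [length_nodes]; have := (E.mach a).size_pos; omega)
  choose w hw using hlen
  have h : Cmp E (fun a => .cons (.atom 0) (ofList (List.replicate (w a) (.atom 0)))) :=
    cmp_zeros.congr fun a _ => by rw [hw, List.replicate_succ, ofList]
  exact ((Cmp.atom 1).cons h.snd).congr fun a _ => by rw [hw, bits_one]

/-- The multiplicities of arguments can be computed. -/
theorem cmp_cnt {f : (combine T).Op} (hf : f ∈ (combine T).ac) {p : α → Msg (combine T) → Prop}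
    (hp : CmpP E.node (fun q => p q.1 q.2)) (hN : CmpN E N) :
    Cmp E (fun a => bits (E.nodes a).length (cnt (p a) f (N a))) := by
  classical
  have har := (combine T).ac_binary f hf
  refine cmp_rec (v := fun a N => bits (E.nodes a).length (cnt (p a) f N)) ?_ hN
  set v := fun a N => bits (E.nodes a).length (cnt (p a) f N)
  have hp' : CmpP (E.tab v) (fun q => p q.1 q.2.2.1) :=
    Cmp.of_step (w := fun a x => bit (p a x)) (fun _ _ _ hx => hx) hp
  refine Cmp.cond (p := fun q => IsApp (.inr f) q.2.2.1) (CmpN.tab_top.isApp _)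
    (x := fun q => bits (E.nodes q.1).length
      (cnt (p q.1) f (argD (.inr f) (Fin.cast har.symm (0 : Fin 2)) q.2.2.1) +
        cnt (p q.1) f (argD (.inr f) (Fin.cast har.symm (1 : Fin 2)) q.2.2.1))) ?_
    (y := fun q => bits (E.nodes q.1).length (if p q.1 q.2.2.1 then 1 else 0)) ?_ ?_
  -- Under the AC symbol itself the counts of the two arguments, already tabulated, are added.
  · exact cmp_bits_add (Cmp.tab_arg (v := v) _) (Cmp.tab_arg (v := v) _) lenBdd_range
  · refine Cmp.cond hp'.assume (cmp_bits_one (E := Env.assume _ _)) (cmp_bits_zero (E := Env.assume _ _))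
      fun q _ => ⟨fun h => ?_, fun h => ?_⟩
    · simp only [h, if_true]; rfl
    · simp only [h, if_false]; rfl
  · intro q hq
    constructor
    · rintro ⟨ts, hts⟩
      obtain ⟨A, B, h, rfl, rfl⟩ := app_eq_bin har ts
      simp only [hts, argD_app]
      rw [h, cnt_bin]
    · intro h
      congr 1
      generalize q.2.2.1 = M at h
      cases M with
      | leaf a => rfl
      | app g ts =>
        rw [isApp_app] at h
        simp [cnt, h]

/-- Both arguments may be the same shared node, so the count can double at every node but not do
more. It may be exponential, yet it has at most linearly many binary digits. -/
theorem cnt_le {f : (combine T).Op} (hf : f ∈ (combine T).ac) {Γ : Set (Msg (combine T))}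
    {P : Msg (combine T)} (G : Dag Γ P) (p : Msg (combine T) → Prop) :
    ∀ (k : ℕ) (l₁ l₂ : List (Msg (combine T))) (M : Msg (combine T)), l₁.length = k →
      G.nodes = l₁ ++ M :: l₂ → cnt p f M ≤ 2 ^ k := by
  intro k
  induction k using Nat.strong_induction_on with
  | _ k ih =>
    intro l₁ l₂ M hk h
    have hpos : 1 ≤ 2 ^ k := Nat.one_le_two_pow
    cases M with
    | leaf a => simp only [cnt]; split_ifs <;> omega
    | app g ts =>
      by_cases hg : g = .inr f
      · subst hg
        have hts : ∀ j, cnt p f (ts j) ≤ 2 ^ (k - 1) ∧ 1 ≤ k := by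
          intro j
          obtain ⟨a, b, hab⟩ := List.append_of_mem (G.sorted _ _ _ _ h j)
          have hlen : a.length < k := by rw [← hk, hab]; simp
          refine ⟨(ih _ hlen a (b ++ .app (.inr f) ts :: l₂) (ts j) rfl ?_).trans
            (Nat.pow_le_pow_right (by norm_num) (by omega)), by omega⟩
          rw [h, hab]; simp
        obtain ⟨A, B, hAB, hA, hB⟩ := app_eq_bin ((combine T).ac_binary f hf) ts
        rw [hAB, cnt_bin, ← hA, ← hB]
        have h₁ := hts (Fin.cast ((combine T).ac_binary f hf).symm (0 : Fin 2))
        have h₂ := hts (Fin.cast ((combine T).ac_binary f hf).symm (1 : Fin 2))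
        have h₃ : 2 ^ k = 2 ^ (k - 1) * 2 := by rw [← pow_succ]; congr 1; omega
        omega
      · simp only [cnt, hg, if_false]; split_ifs <;> omega

theorem cnt_lt {f : (combine T).Op} (hf : f ∈ (combine T).ac) {Γ : Set (Msg (combine T))}
    {P : Msg (combine T)} (G : Dag Γ P) (p : Msg (combine T) → Prop) {M : Msg (combine T)}
    (hM : M ∈ G.nodes) : cnt p f M < 2 ^ G.nodes.length := by
  obtain ⟨l₁, l₂, h⟩ := List.append_of_mem hM
  refine (cnt_le hf G p _ l₁ l₂ M rfl h).trans_lt (Nat.pow_lt_pow_right (by norm_num) ?_)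
  rw [h]; simp

theorem cmp_cnt_eq {f : (combine T).Op} (hf : f ∈ (combine T).ac)
    {p : α → Msg (combine T) → Prop} (hp : CmpP E.node (fun q => p q.1 q.2)) (hN : CmpN E N)
    (hK : CmpN E K) : CmpP E (fun a => cnt (p a) f (N a) = cnt (p a) f (K a)) :=
  cmp_bits_eq (cmp_cnt hf hp hN) (cmp_cnt hf hp hK) lenBdd_range
    (fun a ha => cnt_lt hf _ _ (hN.mem a ha)) (fun a ha => cnt_lt hf _ _ (hK.mem a ha))

theorem isApp_of_aceq {T : Theory} {f : Con ⊕ T.Op} {M N : Msg T} (h : ACEq M N) (hM : IsApp f M) :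
    IsApp f N := by
  obtain ⟨ts, rfl⟩ := hM
  cases N with
  | leaf a => exact absurd h aceq_app_leaf
  | app g us => exact isApp_app.2 (aceq_app_head h).symm

theorem Subterm.ne_app {T : Theory} {f} {K : Msg T} (ts : Fin (T.msgArity f) → Msg T) (j)
    (h : Subterm K (ts j)) : K ≠ .app f ts := by
  rintro rfl
  have h₁ := Term.weight_arg ts j
  rcases h.weight with h | h
  · rw [← h] at h₁
    exact lt_irrefl _ h₁
  · omega

open Classical in
-- Restricting the count to `l` loses nothing, since flattened arguments are proper subterms. The
-- restriction is there because AC equality is known only between nodes of the table.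
theorem cnt_eq_count_flat {T : Theory} {g : T.Op} {ts : Fin (T.msgArity (.inr g)) → Msg T}
    {l : List (Msg T)} (h : ∀ K, Subterm K (.app (.inr g) ts) → K = .app (.inr g) ts ∨ K ∈ l)
    {c : Msg T} : cnt (fun K => K ∈ l ∧ ACEq K c) g (.app (.inr g) ts) =
      (flat g (.app (.inr g) ts)).count (cls c) := by
  rw [count_flat, cnt, cnt, if_pos rfl, if_pos rfl]
  refine Finset.sum_congr rfl fun j _ => cnt_congr g fun K hK => ?_
  rw [cls_eq]
  exact and_iff_right ((h K (.arg _ _ j hK)).resolve_left (hK.ne_app ts j))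

/-- Comparison of different nodes, in terms of subterms of theirs that are in `l`. -/
theorem aceq_iff {T : Theory} {M N : Msg T} (hne : M ≠ N) {l : List (Msg T)}
    (hM : ∀ K, Subterm K M → K = M ∨ K ∈ l) (hN : ∀ K, Subterm K N → K = N ∨ K ∈ l) :
    ACEq M N ↔ ∃ f : Con ⊕ T.Op, IsApp f M ∧ IsApp f N ∧
      ((f ∉ Sum.inr '' T.ac ∧ ∀ j, ACEq (argD f j M) (argD f j N)) ∨
        ∃ g ∈ T.ac, f = .inr g ∧ ∀ c ∈ l,
          cnt (fun K => K ∈ l ∧ ACEq K c) g M = cnt (fun K => K ∈ l ∧ ACEq K c) g N) := by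
  classical
  cases M with
  | leaf a =>
    simp only [not_isApp_leaf, false_and, exists_false, iff_false, aceq_leaf]
    exact fun h => hne h.symm
  | app f ts =>
    have hhead : ∀ Q : Con ⊕ T.Op → Prop, (∃ g, IsApp g (.app f ts : Msg T) ∧ Q g) ↔ Q f := by
      intro Q
      constructor
      · rintro ⟨g, hg, hQ⟩
        rwa [isApp_app.1 hg]
      · exact fun h => ⟨f, isApp_app.2 rfl, h⟩
    rw [hhead]
    constructor
    · intro h
      have hN' := isApp_of_aceq h (isApp_app.2 rfl)
      refine ⟨hN', ?_⟩
      obtain ⟨us, rfl⟩ := hN'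
      by_cases hf : f ∈ Sum.inr '' T.ac
      · obtain ⟨g, hg, rfl⟩ := hf
        refine .inr ⟨g, hg, rfl, fun c hc => ?_⟩
        rw [cnt_eq_count_flat hM, cnt_eq_count_flat hN, h.flat_eq]
      · refine .inl ⟨hf, fun j => ?_⟩
        rw [argD_app, argD_app]
        exact (aceq_app hf).1 h j
    · rintro ⟨⟨us, rfl⟩, ⟨hf, h⟩ | ⟨g, hg, rfl, h⟩⟩
      · simp only [argD_app] at h
        exact .congr f h
      · refine aceq_of_flat_eq hg (Multiset.ext.2 fun q => ?_)
        -- Every class in one of the two multisets has a member in `l`, so comparing the counts for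
        -- elements of `l` suffices.
        have key : ∀ {K : Msg T} {ts}, (∀ X, Subterm X K → X = K ∨ X ∈ l) →
            K = .app (.inr g) ts → q ∈ flat g K → ∃ c ∈ l, cls c = q := by
          rintro _ ts hK rfl hq
          obtain ⟨X, hX, hq, hX'⟩ := exists_subterm_of_mem_flat hq
          obtain ⟨j, hj⟩ := hX' ts rfl
          exact ⟨X, (hK X hX).resolve_left (hj.ne_app ts j), hq⟩
        have h' : (∃ c ∈ l, cls c = q) →
            (flat g (.app (.inr g) ts)).count q = (flat g (.app (.inr g) us)).count q := by
          rintro ⟨c, hc, rfl⟩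
          have := h c hc
          rwa [cnt_eq_count_flat hM, cnt_eq_count_flat hN] at this
        by_cases h₁ : q ∈ flat g (.app (.inr g) ts)
        · exact h' (key hM rfl h₁)
        · by_cases h₂ : q ∈ flat g (.app (.inr g) us)
          · exact h' (key hN rfl h₂)
          · rw [Multiset.count_eq_zero_of_notMem h₁, Multiset.count_eq_zero_of_notMem h₂]

theorem CmpP.cnt_of_table {L : α → List (Msg (combine T))}
    (h : Cmp E (fun a => (E.I a).table (E.repVal (fun _ => ACEq) a) (L a)))
    (hL : ∀ a, E.valid a → L a <+: E.nodes a) (hN : CmpN E N) (hK : CmpN E K)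
    {g : (combine T).Op} (hg : g ∈ (combine T).ac) :
    CmpP E (fun a => ∀ c ∈ L a, cnt (fun X => X ∈ L a ∧ ACEq X c) g (N a) =
      cnt (fun X => X ∈ L a ∧ ACEq X c) g (K a)) := by
  have hlen : LenBdd E (fun a => (L a).reverse) := lenBdd_nodes.mono fun a ha => by
    rw [List.length_reverse]
    exact (hL a ha).length_le
  refine (CmpP.forall_mem (p := fun a c => cnt (fun X => X ∈ L a ∧ ACEq X c) g (N a) =
      cnt (fun X => X ∈ L a ∧ ACEq X c) g (K a)) h hlen ?_).congr fun a _ => by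
    simp only [List.mem_reverse]
  refine cmp_cnt_eq (p := fun p X => X ∈ L p.1 ∧ ACEq X p.2) hg (CmpP.and' ?_ ?_) hN.weaken hK.weaken
  · refine (CmpP.exists_mem (l := fun p => (L p.1.1).reverse) (p := fun p c => c = p.2)
      (Cmp.weaken (Cmp.weaken h)) hlen.weaken.weaken
      (CmpN.eq ⟨Cmp.top_fst, fun p hp => ?_⟩ CmpN.top.weaken)).congr fun p _ => by simp
    exact (hL _ hp.1.1.1).subset (by simpa using hp.2)
  · refine CmpP.rel_of_table (r := fun _ => ACEq) (L := fun p => L p.1.1) (fun _ => aceq_equivalence)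
      (Cmp.weaken (Cmp.weaken h)).assume (fun p hp => hL _ hp.1.1.1) CmpN.top.assume
      (fun p hp => hp.2) ⟨Cmp.assume (Cmp.weaken Cmp.top_fst), fun p hp => ?_⟩ fun p hp => ?_
    · exact (hL _ hp.1.1.1).subset (by simpa using hp.1.1.2)
    · simpa using hp.1.1.2

/-- The criterion `aceq_iff` is applied with the nodes before the new one as the list: both messages
have all their proper subterms there, and AC equality among these is in the table. -/
theorem CmpP.aceq_cmpr : CmpP (E.cmpr fun _ => ACEq) (fun q => ACEq q.2 q.1.2.2.1) := by
  have hp : ∀ q, (E.cmpr fun _ => ACEq).valid q → q.1.2.1 <+: E.nodes q.1.1 := fun q hq =>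
    tab_prefix hq.1
  have := (combine T).finite
  refine (CmpP.exists_finite fun f => CmpP.and' (CmpN.cmpr_left.isApp f)
    (CmpP.and' (CmpN.cmpr_right.assume.isApp f) (CmpP.or (CmpP.and (.const (f ∉ Sum.inr '' (combine T).ac))
      (CmpP.rel_args (fun _ => aceq_equivalence) f))
      (CmpP.exists_finite (κ := (combine T).Op) (p := fun g q => g ∈ (combine T).ac ∧ f = .inr g ∧
        ∀ c ∈ q.1.2.1, cnt (fun K => K ∈ q.1.2.1 ∧ ACEq K c) g q.2 =
            cnt (fun K => K ∈ q.1.2.1 ∧ ACEq K c) g q.1.2.2.1) fun g => ?_)))).congr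
      fun q hq => (aceq_iff (l := q.1.2.1) ?_ ?_ ?_).symm
  · by_cases hg : g ∈ (combine T).ac
    · refine (CmpP.const _).and ((CmpP.const _).and (CmpP.cnt_of_table (L := fun q => q.1.2.1)
        cmp_cmpr_table.assume.assume ?_ CmpN.cmpr_left.assume.assume
        CmpN.cmpr_right.assume.assume hg))
      exact fun q hq => hp q hq.1.1
    · exact CmpP.false.congr fun _ _ => by simp [hg]
  -- An earlier node differs from the current one because the list has no duplicates.
  · intro h
    have h₁ := (E.I q.1.1).dag.nodup
    have h₂ := hq.1.2
    change E.nodes q.1.1 = _ at h₂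
    have h₃ : q.2 ∈ q.1.2.1 := by simpa using hq.2
    change (E.nodes q.1.1).Nodup at h₁
    rw [h₂, List.nodup_append] at h₁
    exact h₁.2.2 _ h₃ _ (by simp) h
  · exact fun K hK => .inr (subterm_mem_prefix hq.1 (by simpa using hq.2) hK)
  · intro K hK
    by_cases h : ∃ f, IsApp f q.1.2.2.1
    · obtain ⟨f, hf⟩ := h
      rw [hf.eq] at hK ⊢
      rcases subterm_app.1 hK with hK | ⟨j, hj⟩
      · exact .inl hK
      · exact .inr (subterm_mem_prefix hq.1 (argD_mem_prefix hq.1 hf j) hj)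
    · generalize q.1.2.2.1 = M at *
      cases M with
      | leaf a => exact .inl (subterm_leaf.1 hK)
      | app f ts => exact absurd ⟨f, isApp_app.2 rfl⟩ h

theorem CmpN.rep_aceq (hN : CmpN E N) : CmpN E (fun a => Intruder.rep ACEq (E.nodes a) (N a)) :=
  CmpN.rep (r := fun _ => ACEq) (fun _ => aceq_equivalence) CmpP.aceq_cmpr hN

theorem CmpP.aceq (hN : CmpN E N) (hK : CmpN E K) : CmpP E (fun a => ACEq (N a) (K a)) :=
  CmpP.rel (r := fun _ => ACEq) (fun _ => aceq_equivalence) CmpP.aceq_cmpr hN hK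

end ACNodes

end Intruder
namespace Intruder

open Intruder.Tree (ofList)

/-! ### Queries to the oracles -/

section Queries

variable {n : ℕ} {T : Fin n → Theory} {i : Fin n}

/-- The abstraction of the message for the theory `i` is a name. -/
def Atomic (i : Fin n) (M : Msg (combine T)) : Prop := ∀ f, Kept i f → ¬ IsApp f M

section

variable {Γ : Set (Msg (combine T))} {P : Msg (combine T)} {G : Dag Γ P} {M N : Msg (combine T)}

theorem Atomic.ab (h : Atomic i M) : G.ab i M = .leaf (G.nu M) := by
  cases M with
  | leaf a => rfl
  | app f ts =>
    have hf := h f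
    simp only [isApp_app, not_true_eq_false, imp_false, Kept, not_forall] at hf
    obtain ⟨g, rfl, hg⟩ := hf
    exact abs_alien hg ts

theorem atomic_or (i : Fin n) (M : Msg (combine T)) : Atomic i M ∨ ∃ f, Kept i f ∧ IsApp f M := by
  by_cases h : ∃ f, Kept i f ∧ IsApp f M
  · exact .inr h
  · exact .inl fun f hf hM => h ⟨f, hf, hM⟩

theorem same_args {f g : Con ⊕ (combine T).Op} (hf : Kept i f) (hg : Kept i g) (hM : IsApp f M)
    (hN : IsApp g N) (h : G.Same i M N) :
    IsApp f N ∧ ∀ j, G.Same i (argD f j M) (argD f j N) := by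
  obtain ⟨ts, rfl⟩ := hM
  obtain ⟨us, rfl⟩ := hN
  have key : ∀ e : f = g, (∀ j, G.ab i (ts j) = G.ab i (us (e ▸ j))) →
      IsApp f (.app g us : Msg (combine T)) ∧
        ∀ j, G.Same i (argD f j (.app f ts)) (argD f j (.app g us)) := by
    rintro rfl h
    exact ⟨⟨us, rfl⟩, fun j => by rw [argD_app, argD_app]; exact h j⟩
  cases f with
  | inl c =>
    cases g with
    | inl d =>
      have h' : conApp c (fun j => G.ab i (ts j)) = conApp d (fun j => G.ab i (us j)) := h
      injection h' with h₁ h₂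
      injection h₁ with h₁
      subst h₁
      exact key rfl (congrFun (eq_of_heq h₂))
    | inr g =>
      obtain ⟨k, g⟩ := g
      obtain rfl : k = i := hg _ rfl
      have h' : conApp c (fun j => G.ab k (ts j)) = opApp g (fun j => G.ab k (us j)) :=
        h.trans (abs_own g us)
      injection h' with h₁
      cases h₁
  | inr f =>
    obtain ⟨k, f⟩ := f
    obtain rfl : k = i := hf _ rfl
    cases g with
    | inl d =>
      have h' : opApp f (fun j => G.ab k (ts j)) = conApp d (fun j => G.ab k (us j)) :=
        (abs_own f ts).symm.trans h
      injection h' with h₁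
      cases h₁
    | inr g =>
      obtain ⟨k', g⟩ := g
      obtain rfl : k' = k := hg _ rfl
      have h' : opApp f (fun j => G.ab k' (ts j)) = opApp g (fun j => G.ab k' (us j)) :=
        (abs_own f ts).symm.trans (h.trans (abs_own g us))
      injection h' with h₁ h₂
      injection h₁ with h₁
      subst h₁
      exact key rfl (congrFun (eq_of_heq h₂))

theorem Dag.nu_eq_iff (hM : M ∈ G.nodes) (hN : N ∈ G.nodes) : G.nu M = G.nu N ↔ ACEq M N := by
  rw [Dag.nu_eq hM, Dag.nu_eq hN,
    G.addr_inj (rep_mem aceq_equivalence hM) (rep_mem aceq_equivalence hN),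
    rep_eq_iff aceq_equivalence hM hN]

/-- Two abstractions agree either as names, which is AC equality of the originals, or through the
same visible head and equal abstractions of the arguments. This is the recursion by which `Dag.Same`
is computed. -/
theorem Dag.same_iff (hM : M ∈ G.nodes) (hN : N ∈ G.nodes) :
    G.Same i M N ↔ (Atomic i M ∧ Atomic i N ∧ ACEq M N) ∨
      ∃ f, Kept i f ∧ IsApp f M ∧ IsApp f N ∧ ∀ j, G.Same i (argD f j M) (argD f j N) := by
  have key : ∀ {M N : Msg (combine T)} {f}, Kept i f → IsApp f M → Atomic i N → ¬ G.Same i M N := by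
    rintro _ N f hf ⟨ts, rfl⟩ hN h
    obtain ⟨g, hg, he⟩ := Dag.ab_kept (G := G) hf ts
    rw [Dag.Same, he, hN.ab] at h
    cases h
  constructor
  · intro h
    rcases atomic_or i M with hM' | ⟨f, hf, hfM⟩
    · rcases atomic_or i N with hN' | ⟨g, hg, hgN⟩
      · refine .inl ⟨hM', hN', ?_⟩
        rw [Dag.Same, hM'.ab, hN'.ab] at h
        injection h with h
        exact (Dag.nu_eq_iff hM hN).1 h
      · exact absurd h.symm (key hg hgN hM')
    · rcases atomic_or i N with hN' | ⟨g, hg, hgN⟩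
      · exact absurd h (key hf hfM hN')
      · exact .inr ⟨f, hf, hfM, same_args hf hg hfM hgN h⟩
  · rintro (⟨hM', hN', h⟩ | ⟨f, hf, hfM, hfN, h⟩)
    · rw [Dag.Same, hM'.ab, hN'.ab, (Dag.nu_eq_iff hM hN).2 h]
    · obtain ⟨g, hg, he⟩ := hf.exists_symbol
      rw [Dag.Same, hfM.eq, hfN.eq, he, he]
      exact congrArg _ (funext fun j => h _)

end

variable {α : Type} {E : Env (instances T) α} {N K : α → Msg (combine T)}
  {S : α → Set (Msg (combine T))}

theorem CmpN.atomic (hN : CmpN E N) (i : Fin n) : CmpP E (fun a => Atomic i (N a)) :=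
  (CmpP.forall_finite fun f => (CmpP.const (Kept i f)).not.or (hN.isApp f).not).congr fun a _ => by
    simp only [Atomic, imp_iff_not_or]

theorem CmpP.same_cmpr (i : Fin n) : CmpP (E.cmpr fun a => (E.I a).dag.Same i)
    (fun q => (E.I q.1.1).dag.Same i q.2 q.1.2.2.1) :=
  (CmpP.or ((CmpN.cmpr_left.atomic i).and ((CmpN.cmpr_right.atomic i).and
    (CmpP.aceq CmpN.cmpr_left CmpN.cmpr_right)))
    (CmpP.exists_finite fun f => (CmpP.const (Kept i f)).and ((CmpN.cmpr_left.isApp f).and'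
      ((CmpN.cmpr_right.assume.isApp f).and'
        (CmpP.rel_args (fun a => (E.I a).dag.same_equivalence i) f))))).congr fun q hq =>
    (Dag.same_iff (CmpN.cmpr_left.mem q hq) (CmpN.cmpr_right.mem q hq)).symm

theorem CmpN.rep_same (hN : CmpN E N) (i : Fin n) :
    CmpN E (fun a => Intruder.rep ((E.I a).dag.Same i) (E.nodes a) (N a)) :=
  CmpN.rep (fun a => (E.I a).dag.same_equivalence i) (CmpP.same_cmpr i) hN

theorem CmpP.same (hN : CmpN E N) (hK : CmpN E K) (i : Fin n) :
    CmpP E (fun a => (E.I a).dag.Same i (N a) (K a)) :=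
  CmpP.rel (fun a => (E.I a).dag.same_equivalence i) (CmpP.same_cmpr i) hN hK

theorem CmpP.exists_mem_node {p : α → Msg (combine T) → Prop} (hS : CmpS E S)
    (hp : CmpP E.node (fun q => p q.1 q.2)) :
    CmpP E (fun a => ∃ N ∈ S a, N ∈ E.nodes a ∧ p a N) :=
  (CmpP.exists_node (p := fun a N => N ∈ S a ∧ p a N) ((hS.node.mem .top).and hp)).congr fun _ _ =>
    ⟨fun ⟨N, h₁, h₂, h₃⟩ => ⟨N, h₂, h₁, h₃⟩, fun ⟨N, h₁, h₂, h₃⟩ => ⟨N, h₂, h₁, h₃⟩⟩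

theorem CmpS.visible (hS : CmpS E S) (i : Fin n) :
    CmpS E (fun a => ((E.I a).dag.visible i)^[(E.nodes a).length] (S a)) := by
  refine CmpS.iterate (F := fun a => (E.I a).dag.visible i) hS (CmpS.of_mem ?_)
  have hW : CmpS E.set.node (fun q => q.1.2) := CmpS.top.node
  refine ((hW.mem .top).or (CmpP.exists_mem_node
    (p := fun q M => (E.I q.1.1).dag.Same i M q.2 ∨ KeptArg i M q.2) hW
    ((CmpP.same .top CmpN.top.node i).or (CmpN.top.keptArg i CmpN.top.node)))).congr fun q hq => ?_
  exact (and_iff_right hq.2).symm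

theorem CmpN.eq_vec₂ {A B : α → Msg (combine T)} {c : Con} (hc : c.arity = 2) (hN : CmpN E N)
    (hA : CmpN E A) (hB : CmpN E B) : CmpP E (fun a => N a = .app (.inl c)
      (fun j : Fin c.arity => (![A a, B a] : Fin 2 → Msg (combine T)) (Fin.cast hc j))) := by
  refine hN.eq_app (f := .inl c)
    (ts := fun a j => (![A a, B a] : Fin 2 → Msg (combine T)) (Fin.cast hc j)) fun j => ?_
  generalize Fin.cast hc j = k
  fin_cases k
  exacts [hA, hB]

theorem CmpP.visiblePst (hS : CmpS E S) (hSn : ∀ a, E.valid a → ∀ M ∈ S a, M ∈ E.nodes a)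
    (hN : CmpN E N) (i : Fin n) : CmpP E (fun a => (E.I a).dag.VisiblePst i (S a) (N a)) := by
  refine (CmpP.exists_mem_node
    (p := fun a M => ∃ L ∈ E.nodes a, KeptArg i M L ∧ (E.I a).dag.Same i L (N a))
    (hS.visible i) (CmpP.exists_node (E := E.node)
    (p := fun q L => KeptArg i q.2 L ∧ (E.I q.1).dag.Same i L (N q.1))
    ((CmpN.top.node.keptArg i .top).and (CmpP.same .top hN.node.node i)))).congr fun a ha => ?_
  constructor
  · rintro ⟨M, h₁, -, h⟩
    exact ⟨M, h₁, h⟩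
  · rintro ⟨M, h₁, h⟩
    exact ⟨M, h₁, (E.I a).dag.mem_of_visible i (hSn a ha) _ M h₁, h⟩

theorem CmpS.insert (hS : CmpS E S) (hK : CmpN E K) : CmpS E (fun a => S a ∪ {K a}) :=
  .of_mem ((hS.node.mem .top).or (CmpN.top.eq hK.node))

theorem CmpP.inQuery (hS : CmpS E S) (hSn : ∀ a, E.valid a → ∀ M ∈ S a, M ∈ E.nodes a)
    (hK : CmpN E K) (hN : CmpN E N) (i : Fin n) :
    CmpP E (fun a => (E.I a).dag.InQuery i (S a) (K a) (N a)) := by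
  have hU := hS.insert hK
  have hUn : ∀ a, E.valid a → ∀ M ∈ S a ∪ {K a}, M ∈ E.nodes a := by
    rintro a ha M (hM | rfl)
    exacts [hSn a ha M hM, hK.mem a ha]
  refine (CmpP.and ((CmpP.exists_mem_node (p := fun a M => (E.I a).dag.Same i M (N a)) hS (CmpP.same .top hN.node i)).or
    ((CmpP.same hK hN i).or ((CmpP.visiblePst hU hUn hN i).or
      (CmpP.exists_node (p := fun a A => ∃ B ∈ E.nodes a, N a = sign A B ∧
          (E.I a).dag.VisiblePst i (S a ∪ {K a}) A ∧ (E.I a).dag.VisiblePst i (S a ∪ {K a}) B)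
        (CmpP.exists_node (E := E.node) (p := fun q B => N q.1 = sign q.2 B ∧
          (E.I q.1).dag.VisiblePst i (S q.1 ∪ {K q.1}) q.2 ∧
            (E.I q.1).dag.VisiblePst i (S q.1 ∪ {K q.1}) B) ((CmpN.eq_vec₂ (c := .sign) rfl hN.node.node CmpN.top.node .top).and
        ((CmpP.visiblePst hU.node.node (fun q hq => hUn _ hq.1.1) CmpN.top.node i).and
          (CmpP.visiblePst hU.node.node (fun q hq => hUn _ hq.1.1) .top i)))))))) ((hN.rep_same i).eq hN)).congr
    fun a ha => ?_
  rw [Dag.InQuery, Dag.mem_st_query_iff _ i (hSn a ha) (hK.mem a ha) (hN.mem a ha)]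
  refine and_congr_left' (or_congr_left ⟨?_, ?_⟩)
  · rintro ⟨M, h₁, -, h⟩
    exact ⟨M, h₁, h⟩
  · rintro ⟨M, h₁, h⟩
    exact ⟨M, h₁, hSn a ha M h₁, h⟩

theorem CmpN.queryAddr (hN : CmpN E N) (i : Fin n) :
    Cmp E (fun a => .atom ((E.I a).dag.queryAddr i ((E.I a).dag.ab i (N a)))) :=
  (hN.rep_same i).addr.congr fun a ha => by rw [Dag.queryAddr_ab i (hN.mem a ha)]

/-- There are finitely many visible head symbols, each with a constant label in theory `i`; the case
`none` is that of messages abstracted to a name. -/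
theorem CmpN.queryNode (hN : CmpN E N) (i : Fin n) :
    Cmp E (fun a => nodeTree ((E.I a).dag.queryAddr i) ((E.I a).dag.ab i (N a))) := by
  have hsym := fun (f : {f : Con ⊕ (combine T).Op // Kept i f}) => f.2.exists_symbol
  choose g hg he using hsym
  refine Cmp.choose_finite (κ := Option {f : Con ⊕ (combine T).Op // Kept i f})
    (p := fun o a => o.elim (Atomic i (N a)) fun f => IsApp f.1 (N a))
    (v := fun o a => o.elim (.cons (.cons (.atom 0) (.atom ((E.I a).dag.nu (N a)))) (.atom 0))
      fun f => .cons (.cons (.atom (symKind (g f))) (.atom (symCode (g f))))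
        (ofList (List.ofFn fun j => .atom ((E.I a).dag.queryAddr i
          ((E.I a).dag.ab i (Intruder.argD f.1 (Fin.cast (hg f) j) (N a))))))) ?_ ?_ ?_ ?_
  · rintro (_ | f)
    · exact hN.atomic i
    · exact hN.isApp f.1
  · rintro (_ | f)
    · refine Cmp.cons (Cmp.cons (.atom 0) ?_) (.atom 0)
      exact hN.rep_aceq.addr.assume.congr fun a ha => by
        rw [Dag.nu_eq (hN.mem a ha.1)]
    · refine Cmp.cons (Cmp.cons (.atom _) (.atom _)) (Cmp.ofFn fun j => ?_)
      exact (CmpN.argD hN.assume (fun a ha => ha.2) _).queryAddr i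
  · intro a _
    rcases atomic_or i (N a) with h | ⟨f, hf, h⟩
    exacts [⟨none, h⟩, ⟨some ⟨f, hf⟩, h⟩]
  · rintro a _ (_ | f) h
    · have h : Atomic i (N a) := h
      simp only [h.ab]
      rfl
    · have h : IsApp f.1 (N a) := h
      conv_lhs => rw [h.eq, he, nodeTree_app]
      rfl

theorem cmp_queryTree (hS : CmpS E S) (hSn : ∀ a, E.valid a → ∀ M ∈ S a, M ∈ E.nodes a)
    (hK : CmpN E K) (i : Fin n) : Cmp E (fun a => (E.I a).dag.queryTree i (S a) (K a)) := by
  classical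
  refine Cmp.filterMap (p := fun a N => (E.I a).dag.InQuery i (S a) (K a) N) cmp_nodes lenBdd_nodes
    (CmpP.inQuery hS.node (fun q hq => hSn _ hq.1) hK.node .top i) ?_
  have h : Cmp E.node (fun q => .cons (.atom ((E.I q.1).dag.queryAddr i ((E.I q.1).dag.ab i q.2)))
      (.cons (.cons (bit ((E.I q.1).dag.ab i q.2 ∈ (E.I q.1).dag.ab i '' S q.1))
        (bit ((E.I q.1).dag.ab i q.2 = (E.I q.1).dag.ab i (K q.1))))
        (nodeTree ((E.I q.1).dag.queryAddr i) ((E.I q.1).dag.ab i q.2)))) := by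
    refine (CmpN.top.queryAddr i).cons (Cmp.cons (Cmp.cons ?_ (CmpP.same .top hK.node i))
      (CmpN.top.queryNode i))
    refine CmpP.congr (CmpP.exists_mem_node (E := E.node)
      (p := fun q M => (E.I q.1).dag.Same i M q.2) hS.node (CmpP.same .top CmpN.top.node i)) fun q hq => ?_
    constructor
    · rintro ⟨M, h₁, -, h⟩
      exact ⟨M, h₁, h⟩
    · rintro ⟨M, h₁, h⟩
      exact ⟨M, h₁, hSn _ hq.1 M h₁, h⟩
  exact CmpFrom.reindex id h (fun q hq => ⟨hq.1, hq.2.1⟩) fun _ _ => rfl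

/-- Here the oracles are called: the tree of the query is built and handed to the program for theory
`i`. -/
theorem CmpP.direct (hconv : ∀ i, (T i).ACConvergent) (hcomb : (combine T).ACConvergent)
    (hS : CmpS E S) (hSn : ∀ a, E.valid a → ∀ M ∈ S a, M ∈ E.nodes a)
    (hK : CmpN E K) (i : Fin n) : CmpP E (fun a => Direct i (S a) (K a)) :=
  CmpP.congr (p := fun a => Elem ((E.I a).dag.ab i '' S a) ((E.I a).dag.ab i (K a)))
    (Cmp.oracle i (cmp_queryTree hS hSn hK i) fun a ha =>
      (E.I a).oracle_spec i (S a) (K a) (hSn a ha) (hK.mem a ha))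
    fun a ha => ((E.I a).dag.direct_iff i hconv hcomb (E.I a).hyps_normal (E.I a).goal_normal (hSn a ha)
      (hK.mem a ha)).symm

end Queries

end Intruder
namespace Intruder

open Intruder.Tree (ofList)

/-! ### The decision procedure -/

section Decide

variable {n : ℕ} {T : Fin n → Theory} {α : Type} {E : Env (instances T) α}
  {N K P : α → Msg (combine T)} {S : α → Set (Msg (combine T))}

theorem CmpP.exists_node_pair {p : α × Msg (combine T) → Prop} (hp : CmpP E.node p) :
    CmpP E (fun a => ∃ N ∈ E.nodes a, p (a, N)) :=
  .exists_node (p := fun a N => p (a, N)) hp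

theorem CmpP.exists_mem_pair {p : α × Msg (combine T) → Prop} (hS : CmpS E S)
    (hp : CmpP E.node p) : CmpP E (fun a => ∃ N ∈ S a, N ∈ E.nodes a ∧ p (a, N)) :=
  .exists_mem_node (p := fun a N => p (a, N)) hS hp

theorem app_con_eq {T : Theory} {c : Con} (hc : c.arity = 2) (ts : Fin c.arity → Msg T) :
    (.app (.inl c) ts : Msg T) = .app (.inl c) (fun j : Fin c.arity =>
      (![ts (Fin.cast hc.symm (0 : Fin 2)), ts (Fin.cast hc.symm (1 : Fin 2))] : Fin 2 → Msg T)
        (Fin.cast hc j)) := by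
  congr 1
  funext j
  obtain ⟨k, rfl⟩ : ∃ k : Fin 2, j = Fin.cast hc.symm k := ⟨Fin.cast hc j, rfl⟩
  fin_cases k <;> rfl

/-- The hypotheses never change in a right derivation and goals only pass to arguments, so this is a
recursion on the nodes. `pub` is excluded because no right rule introduces it. -/
theorem rd_iff {S : Set (Msg (combine T))} {M : Msg (combine T)} :
    RD S M ↔ (∃ i, Direct i S M) ∨
      ∃ c : Con, c ≠ .pub ∧ IsApp (.inl c) M ∧ ∀ j, RD S (argD (.inl c) j M) := by
  have key : ∀ {c : Con} {A B : Msg (combine T)} (hc : c.arity = 2), c ≠ .pub → RD S A → RD S B →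
      ∃ d : Con, d ≠ .pub ∧ IsApp (.inl d) (.app (.inl c) (fun j : Fin c.arity =>
        (![A, B] : Fin 2 → Msg (combine T)) (Fin.cast hc j)) : Msg (combine T)) ∧
        ∀ j, RD S (argD (.inl d) j (.app (.inl c) (fun j : Fin c.arity =>
          (![A, B] : Fin 2 → Msg (combine T)) (Fin.cast hc j)))) := by
    intro c A B hc hp hA hB
    refine ⟨c, hp, ⟨_, rfl⟩, fun j => ?_⟩
    exact argD_app (T := combine T) (f := .inl c) ▸ (forall_bin hc A B (RD S)).2 ⟨hA, hB⟩ j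
  constructor
  · intro h
    cases h with
    | id i k C σ hσ he => exact .inl ⟨i, k, C, σ, hσ, he⟩
    | pair hA hB => exact .inr (key (c := .pair) rfl (by simp) hA hB)
    | enc hA hB => exact .inr (key (c := .enc) rfl (by simp) hA hB)
    | sign hA hB => exact .inr (key (c := .sign) rfl (by simp) hA hB)
    | blind hA hB => exact .inr (key (c := .blind) rfl (by simp) hA hB)
  · rintro (⟨i, k, C, σ, hσ, he⟩ | ⟨c, hc, ⟨ts, rfl⟩, h⟩)
    · exact .id i k C σ hσ he
    · simp only [argD_app] at h
      cases c with
      | pub => exact absurd rfl hc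
      | pair => exact app_con_eq (c := .pair) rfl ts ▸ .pair (h (0 : Fin 2)) (h (1 : Fin 2))
      | enc => exact app_con_eq (c := .enc) rfl ts ▸ .enc (h (0 : Fin 2)) (h (1 : Fin 2))
      | sign => exact app_con_eq (c := .sign) rfl ts ▸ .sign (h (0 : Fin 2)) (h (1 : Fin 2))
      | blind => exact app_con_eq (c := .blind) rfl ts ▸ .blind (h (0 : Fin 2)) (h (1 : Fin 2))

theorem CmpP.rd (hconv : ∀ i, (T i).ACConvergent) (hcomb : (combine T).ACConvergent)
    (hS : CmpS E S) (hSn : ∀ a, E.valid a → ∀ M ∈ S a, M ∈ E.nodes a) (hN : CmpN E N) :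
    CmpP E (fun a => RD (S a) (N a)) := by
  refine cmp_rec (v := fun a N => bit (RD (S a) N)) ?_ hN
  refine (CmpP.or (CmpP.exists_finite fun i => CmpP.direct hconv hcomb hS.tab
    (fun q hq => hSn q.1 hq.1) CmpN.tab_top i) (CmpP.exists_finite fun c : Con =>
      (CmpP.const (c ≠ .pub)).and ((CmpN.tab_top.isApp (.inl c)).and'
        (CmpP.forall_finite fun j => Cmp.tab_arg (v := fun a N => bit (RD (S a) N)) j)))).congr
    fun q _ => rd_iff.symm

theorem subterm_iff_arg {T : Theory} {K N : Msg T} :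
    Subterm K N ↔ K = N ∨ ∃ f, IsApp f N ∧ ∃ j, Subterm K (argD f j N) := by
  cases N with
  | leaf a => simp [subterm_leaf]
  | app f ts =>
    rw [subterm_app]
    refine or_congr_right ⟨?_, ?_⟩
    · rintro ⟨j, h⟩
      exact ⟨f, ⟨ts, rfl⟩, j, by rwa [argD_app]⟩
    · rintro ⟨g, hg, j, h⟩
      obtain rfl := isApp_app.1 hg
      rw [argD_app] at h
      exact ⟨j, h⟩

theorem CmpP.subterm (hK : CmpN E K) (hN : CmpN E N) : CmpP E (fun a => Subterm (K a) (N a)) := by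
  refine cmp_rec (v := fun a N => bit (Subterm (K a) N)) ?_ hN
  exact ((hK.tab.eq CmpN.tab_top).or (CmpP.exists_finite fun f => (CmpN.tab_top.isApp f).and'
    (CmpP.exists_finite fun j => Cmp.tab_arg (v := fun a N => bit (Subterm (K a) N)) j))).congr
    fun q _ => subterm_iff_arg.symm

theorem CmpP.crossSubterm (hK : CmpN E K) (hN : CmpN E N) :
    CmpP E (fun a => CrossSubterm (K a) (N a)) := by
  have := (combine T).finite
  refine (CmpP.exists_node_pair ((CmpP.subterm .top hN.node).and
    (CmpP.exists_finite fun f : (combine T).Op => CmpP.exists_finite fun g : (combine T).Op =>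
      (CmpP.const (f.1 ≠ g.1)).and ((hK.node.isApp (.inr f)).and
        (CmpP.exists_finite fun j => CmpN.top.arg_eq hK.node (.inr g) j))))).congr fun a ha => ?_
  constructor
  · rintro ⟨M, -, hM, f, g, hfg, ⟨ts, hts⟩, j, ⟨us, rfl⟩, h⟩
    rw [argD_app] at h
    exact ⟨f, g, ts, us, hfg, hts, ⟨j, h⟩, hM⟩
  · rintro ⟨f, g, ts, us, hfg, hts, ⟨j, h⟩, hM⟩
    exact ⟨_, (E.I a).dag.subterm_mem (hN.mem a ha) hM, hM, f, g, hfg, ⟨ts, hts⟩, j, ⟨us, rfl⟩,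
      by rwa [argD_app]⟩

theorem guarded_iff {T : Theory} {N : Msg T} : Guarded N ↔ ∀ f : T.Op, ¬ IsApp (.inr f) N := by
  constructor
  · rintro (⟨a, rfl⟩ | ⟨c, ts, rfl⟩) f
    · exact not_isApp_leaf
    · simp
  · intro h
    cases N with
    | leaf a => exact .inl ⟨a, rfl⟩
    | app f ts =>
      cases f with
      | inl c => exact .inr ⟨c, ts, rfl⟩
      | inr f => exact absurd ⟨ts, rfl⟩ (h f)

theorem CmpP.guarded (hN : CmpN E N) : CmpP E (fun a => Guarded (N a)) := by
  have := (combine T).finite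
  exact (CmpP.forall_finite fun f : (combine T).Op => (hN.isApp (.inr f)).not).congr fun _ _ =>
    guarded_iff.symm

/-- All messages that occur in an instance of a left rule, apart from a newly formed signature, can
be sought among the nodes. This bounds every existential quantifier. -/
theorem leftStep_iff {S : Set (Msg (combine T))} {P N : Msg (combine T)}
    {l : List (Msg (combine T))} (hP : P ∈ l) (hS : ∀ M ∈ S, M ∈ l)
    (hl : ∀ M ∈ l, ∀ N, Subterm N M → N ∈ l) : LeftStep S P N ↔
    (∃ M ∈ S, M ∈ l ∧ ∃ B ∈ l, M = pair N B ∨ M = pair B N ∨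
      ((M = enc N B ∨ M = blind N B) ∧ RD S B) ∨ ((M = enc B N ∨ M = blind B N) ∧ RD S N) ∨
      (M = sign N B ∧ ∃ L' ∈ S, L' ∈ l ∧ ∃ L ∈ l, L' = pub L ∧ ACEq B L)) ∨
    (∃ M ∈ S, M ∈ l ∧ ∃ X ∈ l, ∃ K ∈ l, ∃ A ∈ l, ∃ R ∈ l, M = sign X K ∧ X = blind A R ∧ RD S R ∧
      (N = sign A K ∨ N = R)) ∨
    (∃ M ∈ l, (M ∈ S ∨ M = P) ∧ (Guarded N ∧ Subterm N M ∨ CrossSubterm N M)) ∧ RD S N := by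
  have harg : ∀ {f} {ts : Fin ((combine T).msgArity f) → Msg (combine T)}, .app f ts ∈ l →
      ∀ j, ts j ∈ l := fun h j => hl _ h _ (.arg _ _ j (.refl _))
  have hSP : ∀ {p : Msg (combine T) → Prop}, (∃ M ∈ S ∪ {P}, p M) ↔
      ∃ M ∈ l, (M ∈ S ∨ M = P) ∧ p M := by
    intro p
    constructor
    · rintro ⟨M, hM | rfl, h⟩
      exacts [⟨M, hS M hM, .inl hM, h⟩, ⟨_, hP, .inr rfl, h⟩]
    · rintro ⟨M, -, hM, h⟩
      exact ⟨M, hM, h⟩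
  constructor
  · intro h
    cases h with
    | @pair_fst _ B h => exact .inl ⟨_, h, hS _ h, B, harg (hS _ h) (1 : Fin 2), .inl rfl⟩
    | @pair_snd A _ h => exact .inl ⟨_, h, hS _ h, A, harg (hS _ h) (0 : Fin 2), .inr (.inl rfl)⟩
    | @enc_fst _ K h hr =>
      exact .inl ⟨_, h, hS _ h, K, harg (hS _ h) (1 : Fin 2), .inr (.inr (.inl ⟨.inl rfl, hr⟩))⟩
    | @enc_snd A _ h hr =>
      exact .inl ⟨_, h, hS _ h, A, harg (hS _ h) (0 : Fin 2),
        .inr (.inr (.inr (.inl ⟨.inl rfl, hr⟩)))⟩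
    | @blind_fst _ K h hr =>
      exact .inl ⟨_, h, hS _ h, K, harg (hS _ h) (1 : Fin 2), .inr (.inr (.inl ⟨.inr rfl, hr⟩))⟩
    | @blind_snd A _ h hr =>
      exact .inl ⟨_, h, hS _ h, A, harg (hS _ h) (0 : Fin 2),
        .inr (.inr (.inr (.inl ⟨.inr rfl, hr⟩)))⟩
    | @sign _ K L h h' he =>
      exact .inl ⟨_, h, hS _ h, K, harg (hS _ h) (1 : Fin 2), .inr (.inr (.inr (.inr
        ⟨rfl, _, h', hS _ h', L, harg (hS _ h') (0 : Fin 1), rfl, he⟩)))⟩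
    | @unblind_fst A R K h hr =>
      have hX := harg (hS _ h) (0 : Fin 2)
      exact .inr (.inl ⟨_, h, hS _ h, _, hX, K, harg (hS _ h) (1 : Fin 2), A, harg hX (0 : Fin 2),
        R, harg hX (1 : Fin 2), rfl, rfl, hr, .inl rfl⟩)
    | @unblind_snd A R K h hr =>
      have hX := harg (hS _ h) (0 : Fin 2)
      exact .inr (.inl ⟨_, h, hS _ h, _, hX, K, harg (hS _ h) (1 : Fin 2), A, harg hX (0 : Fin 2),
        N, harg hX (1 : Fin 2), rfl, rfl, hr, .inr rfl⟩)
    | ls hg h hr =>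
      obtain ⟨M, hM, h₁, h₂⟩ := hSP.1 h
      exact .inr (.inr ⟨⟨M, hM, h₁, .inl ⟨hg, h₂⟩⟩, hr⟩)
    | lcs h hr =>
      obtain ⟨M, hM, h₁, h₂⟩ := hSP.1 h
      exact .inr (.inr ⟨⟨M, hM, h₁, .inr h₂⟩, hr⟩)
  · rintro (⟨M, hM, -, B, -, h⟩ | ⟨_, hM, -, _, -, K, -, A, -, R, -, rfl, rfl, hR, h⟩ |
      ⟨⟨M, hM, hMP, h⟩, hr⟩)
    · rcases h with rfl | rfl | ⟨rfl | rfl, hr⟩ | ⟨rfl | rfl, hr⟩ | ⟨rfl, _, h', -, L, -, rfl, he⟩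
      exacts [.pair_fst hM, .pair_snd hM, .enc_fst hM hr, .blind_fst hM hr, .enc_snd hM hr,
        .blind_snd hM hr, .sign hM h' he]
    · rcases h with rfl | rfl
      exacts [.unblind_fst hM hR, .unblind_snd hM hR]
    · rcases h with ⟨hg, h⟩ | h
      exacts [.ls hg (hSP.2 ⟨M, hM, hMP, h⟩) hr, .lcs (hSP.2 ⟨M, hM, hMP, h⟩) hr]

theorem CmpN.eq_pub (hN : CmpN E N) (hK : CmpN E K) : CmpP E (fun a => N a = pub (K a)) :=
  hN.eq_app (f := .inl .pub) (ts := fun a _ => K a) fun _ => hK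

theorem CmpP.leftStep (hconv : ∀ i, (T i).ACConvergent) (hcomb : (combine T).ACConvergent)
    (hS : CmpS E S) (hSn : ∀ a, E.valid a → ∀ M ∈ S a, M ∈ E.nodes a) (hP : CmpN E P)
    (hN : CmpN E N) : CmpP E (fun a => LeftStep (S a) (P a) (N a)) := by
  have hrd := CmpP.rd hconv hcomb hS hSn hN
  have h₁ : CmpP E (fun a => ∃ M ∈ S a, M ∈ E.nodes a ∧ ∃ B ∈ E.nodes a,
      M = pair (N a) B ∨ M = pair B (N a) ∨
      ((M = enc (N a) B ∨ M = blind (N a) B) ∧ RD (S a) B) ∨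
      ((M = enc B (N a) ∨ M = blind B (N a)) ∧ RD (S a) (N a)) ∨
      (M = sign (N a) B ∧ ∃ L' ∈ S a, L' ∈ E.nodes a ∧ ∃ L ∈ E.nodes a, L' = pub L ∧ ACEq B L)) := by
    have hM : CmpN E.node.node (fun q => q.1.2) := CmpN.top.node
    have hB : CmpN E.node.node (fun q => q.2) := .top
    have hN' : CmpN E.node.node (fun q => N q.1.1) := hN.node.node
    have hS' : CmpS E.node.node (fun q => S q.1.1) := hS.node.node
    have hB' : CmpP E.node.node (fun q => RD (S q.1.1) q.2) :=
      CmpP.rd hconv hcomb hS' (fun q hq => hSn _ hq.1.1) hB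
    have hL : CmpP E.node.node (fun q => ∃ L' ∈ S q.1.1, L' ∈ E.nodes q.1.1 ∧
        ∃ L ∈ E.nodes q.1.1, L' = pub L ∧ ACEq q.2 L) :=
      .exists_mem_pair hS' (.exists_node_pair ((CmpN.top.node.eq_pub .top).and (CmpP.aceq hB.node.node .top)))
    exact .exists_mem_pair hS (.exists_node_pair (
      (hM.eq_vec₂ (c := .pair) rfl hN' hB).or ((hM.eq_vec₂ (c := .pair) rfl hB hN').or (
        (((hM.eq_vec₂ (c := .enc) rfl hN' hB).or (hM.eq_vec₂ (c := .blind) rfl hN' hB)).and hB').or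
        ((((hM.eq_vec₂ (c := .enc) rfl hB hN').or (hM.eq_vec₂ (c := .blind) rfl hB hN')).and
          hrd.weaken.weaken).or ((hM.eq_vec₂ (c := .sign) rfl hN' hB).and hL))))))
  have h₂ : CmpP E (fun a => ∃ M ∈ S a, M ∈ E.nodes a ∧ ∃ X ∈ E.nodes a, ∃ K ∈ E.nodes a,
      ∃ A ∈ E.nodes a, ∃ R ∈ E.nodes a, M = sign X K ∧ X = blind A R ∧ RD (S a) R ∧
      (N a = sign A K ∨ N a = R)) := by
    refine .exists_mem_pair hS (.exists_node_pair (.exists_node_pair (.exists_node_pair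
      (.exists_node_pair (.and (CmpN.top.node.node.node.node.eq_vec₂ (c := .sign) rfl
        CmpN.top.node.node.node CmpN.top.node.node) (.and
        (CmpN.top.node.node.node.eq_vec₂ (c := .blind) rfl CmpN.top.node .top) (.and
        (CmpP.rd hconv hcomb hS.node.node.node.node.node (fun q hq => hSn _ hq.1.1.1.1.1) .top)
        ((hN.node.node.node.node.node.eq_vec₂ (c := .sign) rfl CmpN.top.node
          CmpN.top.node.node).or (hN.node.node.node.node.node.eq .top)))))))))
  have h₃ : CmpP E (fun a => ∃ M ∈ E.nodes a, (M ∈ S a ∨ M = P a) ∧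
      (Guarded (N a) ∧ Subterm (N a) M ∨ CrossSubterm (N a) M)) :=
    .exists_node_pair (((hS.node.mem .top).or (CmpN.top.eq hP.node)).and
      (((CmpP.guarded hN.node).and (CmpP.subterm hN.node .top)).or
        (CmpP.crossSubterm hN.node .top)))
  exact (h₁.or (h₂.or (h₃.and hrd))).congr fun a ha => (leftStep_iff (hP.mem a ha) (hSn a ha)
    fun M hM K hK => (E.I a).dag.subterm_mem hM hK).symm

theorem CmpP.ld (hconv : ∀ i, (T i).ACConvergent) (hcomb : (combine T).ACConvergent) :
    CmpP E (fun a => LD (E.I a).hyps (E.I a).goal) := by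
  -- The body of the iteration must be correct for an arbitrary set as state, whereas `RD` may
  -- depend on elements that are not encoded. Hence the intersection with the nodes, which changes
  -- nothing on the actual iterates (`hmem`).
  have hW : CmpS E.set (fun p => p.2 ∩ {N | N ∈ E.nodes p.1}) :=
    .of_mem ((CmpS.top.node.mem .top).congr fun q hq => (and_iff_left hq.2).symm)
  have hF : CmpS E.set (fun p => saturate {N | N ∈ E.nodes p.1} (E.I p.1).goal
      (p.2 ∩ {N | N ∈ E.nodes p.1})) :=
    .of_mem (((hW.node.mem .top).or (CmpP.leftStep hconv hcomb hW.node (fun _ _ _ hM => hM.2)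
      .goal .top)).congr fun q hq => (and_iff_right hq.2).symm)
  have hG := CmpS.iterate (F := fun a W => saturate {N | N ∈ E.nodes a} (E.I a).goal
    (W ∩ {N | N ∈ E.nodes a})) (S := fun a => (E.I a).hyps) (.of_mem CmpN.top.is_hyp) hF
  have hmem : ∀ a t, (fun W => saturate {N | N ∈ E.nodes a} (E.I a).goal
      (W ∩ {N | N ∈ E.nodes a}))^[t] (E.I a).hyps ⊆ {N | N ∈ E.nodes a} ∧
      (fun W => saturate {N | N ∈ E.nodes a} (E.I a).goal
      (W ∩ {N | N ∈ E.nodes a}))^[t] (E.I a).hyps =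
      (saturate {N | N ∈ E.nodes a} (E.I a).goal)^[t] (E.I a).hyps := by
    intro a t
    induction t with
    | zero => exact ⟨fun N hN => (E.I a).dag.hyp_mem hN, rfl⟩
    | succ t ih =>
      rw [Function.iterate_succ_apply', Function.iterate_succ_apply', Set.inter_eq_left.2 ih.1, ih.2]
      exact ⟨fun N hN => hN.1, rfl⟩
  refine (CmpP.rd hconv hcomb hG (fun a _ => (hmem a _).1) .goal).congr fun a _ => ?_
  have hA : {N | N ∈ E.nodes a} = St ((E.I a).hyps ∪ {(E.I a).goal}) :=
    Set.ext (E.I a).dag.mem_nodes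
  rw [(hmem a _).2, hA]
  exact (ld_iff_rd_saturate (E.I a).dag.finite (E.I a).dag.size_eq.le).symm

end Decide

end Intruder
namespace Intruder

/-! ### From the uniform program to complexity and decidability -/

section Reduction

variable {n : ℕ} {T : Fin n → Theory}

/-- One program with oracles for elementary deduction solves all instances. -/
theorem exists_uniform_program (hconv : ∀ i, (T i).ACConvergent)
    (hcomb : (combine T).ACConvergent) : ∃ (Q : (Fin n → Prog) → Prog) (c k : ℕ),
      ∀ I : Instance T, ∃ t ≤ c * I.mach.size ^ k * I.mach.cost,
        Runs (Q I.mach.oracle) I.dag.tree (bit (LD I.hyps I.goal)) t := by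
  obtain ⟨Q, c, k, h⟩ := CmpP.ld (E := (⟨fun _ => True, id, fun _ => .atom 0⟩ :
    Env (instances T) (Instance T))) hconv hcomb
  -- The calculus expects the input paired with a tree of variables, here the dummy `atom 0`.
  -- Attaching it takes four steps in total.
  refine ⟨fun O => .seq (.pair .id (.const 0)) (Q O), c + 4, k, fun I => ?_⟩
  obtain ⟨t, ht, hr⟩ := h I trivial
  refine ⟨_, ?_, .seq (.pair (.id _) (.const 0 _)) hr⟩
  have h₁ : 1 ≤ I.mach.size ^ k * I.mach.cost :=
    Nat.mul_pos (Nat.pow_pos I.mach.size_pos) I.mach.cost_pos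
  have h₂ : t ≤ c * I.mach.size ^ k * I.mach.cost := ht
  have h₃ : (c + 4) * I.mach.size ^ k * I.mach.cost =
      c * I.mach.size ^ k * I.mach.cost + 4 * (I.mach.size ^ k * I.mach.cost) := by ring
  omega

variable {Γ : Set (Msg (combine T))} {P : Msg (combine T)}

theorem Dag.size_pos (G : Dag Γ P) : 1 ≤ size Γ P := by
  rw [G.size_eq]
  exact List.length_pos_of_mem G.goal_mem

/-- The relation `R` between size and time is left open so that one argument covers both parts: it
is a time bound in the first and trivial in the second. -/
theorem Dag.runs_query (G : Dag Γ P) {i : Fin n} {p : Prog} {R : ℕ → ℕ → Prop}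
    (h : ∀ (Γ : Set (Msg (T i))) (M : Msg (T i)), Γ.Finite → (∀ N ∈ Γ, Normal N) → Normal M →
      ∀ G : Dag Γ M, ∃ t, R (size Γ M) t ∧ Runs p G.tree (bit (Elem Γ M)) t)
    (hcomb : (combine T).ACConvergent) (hΓ : ∀ N ∈ Γ, Normal N) (hP : Normal P)
    {S : Set (Msg (combine T))} {K : Msg (combine T)} (hS : ∀ N ∈ S, N ∈ G.nodes)
    (hK : K ∈ G.nodes) : ∃ m ≤ size Γ P, ∃ t, R m t ∧
      Runs p (G.queryTree i S K) (bit (Elem (G.ab i '' S) (G.ab i K))) t := by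
  refine ⟨_, G.query_size i hS hK, ?_⟩
  rw [← G.query_tree i hS hK]
  refine h _ _ (((List.finite_toSet G.nodes).subset hS).image _) ?_
    (G.ab_normal i hcomb hΓ hP hK) _
  rintro _ ⟨N, hN, rfl⟩
  exact G.ab_normal i hcomb hΓ hP (hS N hN)

end Reduction

end Intruder
theorem mainTheorem6 (n : ℕ) (hn : 1 ≤ n) (T : Fin n → Intruder.Theory)
    (hac : ∀ i, (T i).ac.Subsingleton)
    (hconv : ∀ i, (T i).ACConvergent)
    (hcomb : (Intruder.combine T).ACConvergent) :
    (∃ k : ℕ, ∀ f : ℕ → ℕ, Monotone f →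
      (∀ i, Intruder.DecidableInTime (T := T i) Intruder.Elem f) →
      Intruder.DecidableInTime (T := Intruder.combine T) Intruder.LD (fun m => m ^ k * f m)) ∧
    ((∀ i, Intruder.DecidableProblem (T := T i) Intruder.Elem) →
      Intruder.DecidableProblem (T := Intruder.combine T) Intruder.LD) := by
  obtain ⟨Q, c, k, hQ⟩ := Intruder.exists_uniform_program hconv hcomb
  refine ⟨⟨k, fun f hf h => ?_⟩, fun h => ?_⟩
  · choose p d hp using h
    -- The sum of the constants of the oracle programs bounds each one of them.
    refine ⟨Q p, c * ∑ i, d i, fun Γ P _ hΓ hP G => ?_⟩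
    have hq : ∀ i S K, (∀ N ∈ S, N ∈ G.nodes) → K ∈ G.nodes →
        ∃ t ≤ (∑ i, d i) * f (Intruder.size Γ P), Intruder.Runs (p i) (G.queryTree i S K)
          (Intruder.bit (Intruder.Elem (G.ab i '' S) (G.ab i K))) t := by
      intro i S K hS hK
      obtain ⟨m, hm, t, ht, hr⟩ := G.runs_query (R := fun m t => t ≤ d i * f m) (hp i) hcomb hΓ hP
        hS hK
      exact ⟨t, ht.trans (Nat.mul_le_mul (Finset.single_le_sum (fun _ _ => Nat.zero_le _)
        (Finset.mem_univ i)) (hf hm)), hr⟩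
    -- Nothing forces `f` to be positive, but there is at least one theory, and its program takes at
    -- least one step on the query for the sequent itself.
    have hpos : 1 ≤ (∑ i, d i) * f (Intruder.size Γ P) := by
      obtain ⟨t, ht, hr⟩ := hq ⟨0, hn⟩ Γ P (fun _ => G.hyp_mem) G.goal_mem
      exact hr.pos.trans ht
    obtain ⟨t, ht, hr⟩ := hQ ⟨⟨p, Intruder.size Γ P, _, G.size_pos, hpos⟩, Γ, P, G, hΓ, hP, rfl, hq⟩
    refine ⟨t, ht.trans_eq ?_, hr⟩
    dsimp only
    ring
  · choose p hp using h
    refine ⟨Q p, fun Γ P _ hΓ hP G => ?_⟩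
    -- Without a time bound, the cost of an oracle call is taken per instance: a query is given by a
    -- theory, a set of nodes and a node, so there are finitely many, and their running times have a
    -- maximum.
    have hq : ∀ x : Fin n × (𝒫 {N | N ∈ G.nodes} ×ˢ {N | N ∈ G.nodes} : Set _), ∃ t,
        Intruder.Runs (p x.1) (G.queryTree x.1 x.2.1.1 x.2.1.2) (Intruder.bit
          (Intruder.Elem (G.ab x.1 '' x.2.1.1) (G.ab x.1 x.2.1.2))) t := by
      intro x
      obtain ⟨m, -, t, -, hr⟩ := G.runs_query (R := fun _ _ => True)
        (fun Γ M h₁ h₂ h₃ G => (hp x.1 Γ M h₁ h₂ h₃ G).imp fun t ht => ⟨trivial, ht⟩) hcomb hΓ hP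
        x.2.2.1 x.2.2.2
      exact ⟨t, hr⟩
    choose t ht using hq
    have hfin : (𝒫 {N | N ∈ G.nodes} ×ˢ {N | N ∈ G.nodes} : Set _).Finite :=
      (List.finite_toSet G.nodes).powerset.prod (List.finite_toSet G.nodes)
    have := hfin.to_subtype
    obtain ⟨B, hB⟩ := (Set.finite_range t).bddAbove
    obtain ⟨s, -, hr⟩ := hQ ⟨⟨p, Intruder.size Γ P, B + 1, G.size_pos, Nat.le_add_left _ _⟩, Γ, P,
      G, hΓ, hP, rfl, fun i S K hS hK => ⟨t (i, ⟨(S, K), hS, hK⟩),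
        (hB ⟨_, rfl⟩).trans (Nat.le_succ _), ht (i, ⟨(S, K), hS, hK⟩)⟩⟩
    exact ⟨s, hr⟩
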